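/- Let $\mathcal X_1,\mathcal X_2,\mathcal X_3,\mathcal Y_1,\mathcal Y_2,\mathcal Y_3$ be finite alphabets. A compound multiple access channel with a relay (cMACr) is a discrete memoryless channel $p(y_1,y_2,y_3|x_1,x_2,x_3)$, where $x_1,x_2$ are the inputs of transmitters 1 and 2, $x_3$ is the input and $y_3$ the output of the relay, and $y_1,y_2$ are the outputs of receivers 1 and 2. A $(2^{nR_1},2^{nR_2},2^{nR_3},n)$ code consists of message sets $\mathcal W_i=\{1,\dots,2^{nR_i}\}$, $i=1,2,3$ (with $2^{nR_i}$ rounded up to an integer), encoders $f_i:\mathcal W_i\to\mathcal X_i^n$ for $i=1,2$, causal relay encoders $g_j:\mathcal W_3\times\mathcal Y_3^{j-1}\to\mathcal X_3$ for $j=1,\dots,n$, and decoders $h_i:\mathcal Y_i^n\to\mathcal W_1\times\mathcal W_2\times\mathcal W_3$ for $i=1,2$. Its error probability $P_e^n$ is the probability, for independent uniformly distributed messages, that at least one of the two receivers does not decode the triple $(W_1,W_2,W_3)$ correctly. A triplet $(R_1,R_2,R_3)$ with $R_j\ge 0$ is achievable if there is a sequence of such codes, $n=0,1,2,\dots$,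 with $P_e^n\to0$ as $n\to\infty$; the capacity region is the closure of the set of achievable triplets. Mutual informations are in bits. Let $Q$ and $\hat Y_3$ be random variables with finite alphabets such that the joint distribution is of the form $$p(q)\,p(x_1|q)\,p(x_2|q)\,p(x_3|q)\,p(\hat y_3|y_3,x_3,q)\,p(y_1,y_2,y_3|x_1,x_2,x_3),$$ and let $R_1,R_2,R_3\ge0$. Consider the conditions \begin{align*} R_1&\le\min\{I(X_1;Y_1,\hat Y_3|X_2,X_3,Q),\ I(X_1;Y_2,\hat Y_3|X_2,X_3,Q)\},\\ R_2&\le\min\{I(X_2;Y_2,\hat Y_3|X_1,X_3,Q),\ I(X_2;Y_1,\hat Y_3|X_1,X_3,Q)\},\\ R_1+R_2&\le\min\{I(X_1,X_2;Y_1,\hat Y_3|X_3,Q),\ I(X_1,X_2;Y_2,\hat Y_3|X_3,Q)\},\\ R_3+I(Y_3;\hat Y_3|X_3,Y_1,Q)&\le I(X_3;Y_1|Q),\\ R_3+I(Y_3;\hat Y_3|X_3,Y_2,Q)&\le I(X_3;Y_2|Q). \end{align*} (a) If these conditions hold, then $(R_1,R_2,R_3)$ belongs to the capacity region. If they all hold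 with strict inequality, then $(R_1,R_2,R_3)$ is achievable. (b) It suffices to use alphabets for $\hat Y_3$ of bounded cardinality: there is a constant $N$ that depends only on the channel alphabets such that, for every channel, every $Q$ and $\hat Y_3$ as above, there is a $\hat Y_3'$ with an alphabet of size at most $N$ and a joint distribution of the same form, with the same $p(q)$, $p(x_1|q)$, $p(x_2|q)$, $p(x_3|q)$, such that every nonnegative triplet that satisfies the conditions with $\hat Y_3$ satisfies them with $\hat Y_3'$. -/

import Mathlib

open Filter Topology

/-- A discrete memoryless compound multiple access channel with a relay: the transition
probabilities `p(y₁, y₂, y₃ | x₁, x₂, x₃)`. -/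
abbrev CMACr (X₁ X₂ X₃ Y₁ Y₂ Y₃ : Type*) [Fintype Y₁] [Fintype Y₂] [Fintype Y₃] :=
  X₁ → X₂ → X₃ → stdSimplex ℝ (Y₁ × Y₂ × Y₃)

/-- A code of block length `n` with `M₁`, `M₂`, `M₃` messages. The relay's input at time `j` is a
function of its own message and of its outputs at the times before `j`. -/
structure CMACrCode (X₁ X₂ X₃ Y₁ Y₂ Y₃ : Type*) (M₁ M₂ M₃ n : ℕ) where
  /-- encoder of transmitter 1 -/
  f₁ : Fin M₁ → Fin n → X₁
  /-- encoder of transmitter 2 -/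
  f₂ : Fin M₂ → Fin n → X₂
  /-- causal encoders of the relay -/
  g : (j : Fin n) → Fin M₃ → (Fin j → Y₃) → X₃
  /-- decoder of receiver 1 -/
  h₁ : (Fin n → Y₁) → Fin M₁ × Fin M₂ × Fin M₃
  /-- decoder of receiver 2 -/
  h₂ : (Fin n → Y₂) → Fin M₁ × Fin M₂ × Fin M₃

namespace CMACrCode

variable {X₁ X₂ X₃ Y₁ Y₂ Y₃ : Type*} {M₁ M₂ M₃ n : ℕ}

/-- The probability of the output sequences `y₁`, `y₂`, `y₃` when the messages `w` are sent. -/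
def outputProb [Fintype Y₁] [Fintype Y₂] [Fintype Y₃]
    (W : CMACr X₁ X₂ X₃ Y₁ Y₂ Y₃) (c : CMACrCode X₁ X₂ X₃ Y₁ Y₂ Y₃ M₁ M₂ M₃ n)
    (w : Fin M₁ × Fin M₂ × Fin M₃)
    (y₁ : Fin n → Y₁) (y₂ : Fin n → Y₂) (y₃ : Fin n → Y₃) : ℝ :=
  ∏ j : Fin n,
    W (c.f₁ w.1 j) (c.f₂ w.2.1 j) (c.g j w.2.2 (fun i => y₃ (i.castLE j.isLt.le)))
      (y₁ j, y₂ j, y₃ j)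

/-- The average probability of block error: the messages are uniform, and an error occurs when
at least one of the receivers decodes a wrong message triple. -/
noncomputable def errorProb [Fintype Y₁] [Fintype Y₂] [Fintype Y₃]
    (W : CMACr X₁ X₂ X₃ Y₁ Y₂ Y₃) (c : CMACrCode X₁ X₂ X₃ Y₁ Y₂ Y₃ M₁ M₂ M₃ n) : ℝ :=
  (1 / ((M₁ : ℝ) * M₂ * M₃)) *
    ∑ w : Fin M₁ × Fin M₂ × Fin M₃,
      ∑ y₁ : Fin n → Y₁, ∑ y₂ : Fin n → Y₂, ∑ y₃ : Fin n → Y₃,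
        if c.h₁ y₁ ≠ w ∨ c.h₂ y₂ ≠ w then c.outputProb W w y₁ y₂ y₃ else 0

end CMACrCode

/-- Number of messages `2 ^ (n R)`, rounded up to an integer. -/
noncomputable def messageCount (R : ℝ) (n : ℕ) : ℕ := ⌈(2 : ℝ) ^ ((n : ℝ) * R)⌉₊

/-- The nonnegative rate triplet `R` is achievable: there is a sequence of
`(2 ^ (n R₁), 2 ^ (n R₂), 2 ^ (n R₃), n)` codes whose error probability tends to `0`. -/
def Achievable {X₁ X₂ X₃ Y₁ Y₂ Y₃ : Type*} [Fintype Y₁] [Fintype Y₂] [Fintype Y₃]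
    (W : CMACr X₁ X₂ X₃ Y₁ Y₂ Y₃) (R : ℝ × ℝ × ℝ) : Prop :=
  0 ≤ R.1 ∧ 0 ≤ R.2.1 ∧ 0 ≤ R.2.2 ∧
    ∃ c : (n : ℕ) → CMACrCode X₁ X₂ X₃ Y₁ Y₂ Y₃
        (messageCount R.1 n) (messageCount R.2.1 n) (messageCount R.2.2 n) n,
      Tendsto (fun n => (c n).errorProb W) atTop (𝓝 0)

/-- The capacity region: the closure of the set of achievable rate triplets. -/
def capacityRegion {X₁ X₂ X₃ Y₁ Y₂ Y₃ : Type*} [Fintype Y₁] [Fintype Y₂] [Fintype Y₃]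
    (W : CMACr X₁ X₂ X₃ Y₁ Y₂ Y₃) : Set (ℝ × ℝ × ℝ) :=
  closure {R | Achievable W R}

open Classical in
/-- The probability mass function of the random variable `X` under the mass function `p`. -/
noncomputable def marginal {Ω A : Type*} [Fintype Ω] (p : Ω → ℝ) (X : Ω → A) (a : A) : ℝ :=
  ∑ ω, if X ω = a then p ω else 0

/-- Conditional mutual information `I(X; Y | Z)` in bits, for random variables with finitely
many values under the mass function `p`; a term with `p(x, y, z) = 0` is `0`. -/
noncomputable def condMutualInfo {Ω A B C : Type*} [Fintype Ω] [Fintype A] [Fintype B] [Fintype C]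
    (p : Ω → ℝ) (X : Ω → A) (Y : Ω → B) (Z : Ω → C) : ℝ :=
  ∑ a, ∑ b, ∑ c,
    marginal p (fun ω => (X ω, Y ω, Z ω)) (a, b, c) *
      Real.logb 2
        (marginal p (fun ω => (X ω, Y ω, Z ω)) (a, b, c) * marginal p Z c /
          (marginal p (fun ω => (X ω, Z ω)) (a, c) * marginal p (fun ω => (Y ω, Z ω)) (b, c)))

/-- The freely chosen factors `p(q)`, `p(x₁|q)`, `p(x₂|q)`, `p(x₃|q)` and `p(ŷ₃|y₃,x₃,q)` of the
joint distribution used by compress-and-forward. -/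
structure CFDist (X₁ X₂ X₃ Y₃ Q Yhat : Type*)
    [Fintype X₁] [Fintype X₂] [Fintype X₃] [Fintype Q] [Fintype Yhat] where
  /-- `p(q)` -/
  pQ : stdSimplex ℝ Q
  /-- `p(x₁|q)` -/
  pX₁ : Q → stdSimplex ℝ X₁
  /-- `p(x₂|q)` -/
  pX₂ : Q → stdSimplex ℝ X₂
  /-- `p(x₃|q)` -/
  pX₃ : Q → stdSimplex ℝ X₃
  /-- `p(ŷ₃|y₃,x₃,q)` -/
  pYhat : Y₃ → X₃ → Q → stdSimplex ℝ Yhat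

namespace CFDist

variable {X₁ X₂ X₃ Y₁ Y₂ Y₃ Q Yhat : Type*}
  [Fintype X₁] [Fintype X₂] [Fintype X₃] [Fintype Y₁] [Fintype Y₂] [Fintype Y₃]
  [Fintype Q] [Fintype Yhat]

/-- The joint mass function `p(q) p(x₁|q) p(x₂|q) p(x₃|q) p(ŷ₃|y₃,x₃,q) p(y₁,y₂,y₃|x₁,x₂,x₃)`
of `(Q, X₁, X₂, X₃, Y₁, Y₂, Y₃, Ŷ₃)`. -/
def joint (D : CFDist X₁ X₂ X₃ Y₃ Q Yhat) (W : CMACr X₁ X₂ X₃ Y₁ Y₂ Y₃) :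
    Q × X₁ × X₂ × X₃ × Y₁ × Y₂ × Y₃ × Yhat → ℝ :=
  fun (q, x₁, x₂, x₃, y₁, y₂, y₃, yh) =>
    D.pQ q * D.pX₁ q x₁ * D.pX₂ q x₂ * D.pX₃ q x₃ * D.pYhat y₃ x₃ q yh *
      W x₁ x₂ x₃ (y₁, y₂, y₃)

/-- The conditions on `(R₁, R₂, R₃)`, with `rel` in the place of the inequality sign:
they are used with `rel` equal to `≤` and to `<`. -/
def Conditions (rel : ℝ → ℝ → Prop) (D : CFDist X₁ X₂ X₃ Y₃ Q Yhat)
    (W : CMACr X₁ X₂ X₃ Y₁ Y₂ Y₃) (R₁ R₂ R₃ : ℝ) : Prop :=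
  let p := D.joint W
  let q : Q × X₁ × X₂ × X₃ × Y₁ × Y₂ × Y₃ × Yhat → Q := fun ω => ω.1
  let x₁ : Q × X₁ × X₂ × X₃ × Y₁ × Y₂ × Y₃ × Yhat → X₁ := fun ω => ω.2.1
  let x₂ : Q × X₁ × X₂ × X₃ × Y₁ × Y₂ × Y₃ × Yhat → X₂ := fun ω => ω.2.2.1
  let x₃ : Q × X₁ × X₂ × X₃ × Y₁ × Y₂ × Y₃ × Yhat → X₃ := fun ω => ω.2.2.2.1
  let y₁ : Q × X₁ × X₂ × X₃ × Y₁ × Y₂ × Y₃ × Yhat → Y₁ := fun ω => ω.2.2.2.2.1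
  let y₂ : Q × X₁ × X₂ × X₃ × Y₁ × Y₂ × Y₃ × Yhat → Y₂ := fun ω => ω.2.2.2.2.2.1
  let y₃ : Q × X₁ × X₂ × X₃ × Y₁ × Y₂ × Y₃ × Yhat → Y₃ := fun ω => ω.2.2.2.2.2.2.1
  let yh : Q × X₁ × X₂ × X₃ × Y₁ × Y₂ × Y₃ × Yhat → Yhat := fun ω => ω.2.2.2.2.2.2.2
  rel R₁ (min
    (condMutualInfo p x₁ (fun ω => (y₁ ω, yh ω)) (fun ω => (x₂ ω, x₃ ω, q ω)))
    (condMutualInfo p x₁ (fun ω => (y₂ ω, yh ω)) (fun ω => (x₂ ω, x₃ ω, q ω)))) ∧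
  rel R₂ (min
    (condMutualInfo p x₂ (fun ω => (y₂ ω, yh ω)) (fun ω => (x₁ ω, x₃ ω, q ω)))
    (condMutualInfo p x₂ (fun ω => (y₁ ω, yh ω)) (fun ω => (x₁ ω, x₃ ω, q ω)))) ∧
  rel (R₁ + R₂) (min
    (condMutualInfo p (fun ω => (x₁ ω, x₂ ω)) (fun ω => (y₁ ω, yh ω)) (fun ω => (x₃ ω, q ω)))
    (condMutualInfo p (fun ω => (x₁ ω, x₂ ω)) (fun ω => (y₂ ω, yh ω)) (fun ω => (x₃ ω, q ω)))) ∧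
  rel (R₃ + condMutualInfo p y₃ yh (fun ω => (x₃ ω, y₁ ω, q ω))) (condMutualInfo p x₃ y₁ q) ∧
  rel (R₃ + condMutualInfo p y₃ yh (fun ω => (x₃ ω, y₂ ω, q ω))) (condMutualInfo p x₃ y₂ q)

end CFDist

set_option linter.unusedSectionVars false
set_option linter.unusedSimpArgs false

section

open scoped Classical

/-! Compress-and-forward over many blocks of `m` letters. In each block the transmitters send fresh
messages, and the relay sends a codeword indexed by its own message and by a compression index that
describes its output of the previous block. From the relay codeword of block `b + 1` a receiver
learns the compression index of block `b`; it then decodes the transmitters' messages of block `b`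
as in a multiple access channel whose output is the pair (own output, compressed relay output).
Errors are averaged over codebooks drawn independently for each block. Typicality is expressed by
thresholds on information densities, so Chebyshev's inequality bounds the chance of missing a true
codeword and a change of measure bounds the chance of accepting a false one.

There is no binning. The relay uses slightly more than `2 ^ (m I(Y₃; Ŷ₃ | X₃, Q))` compression
codewords, and a receiver with output `Y` lists those that are dense with its own output. Since `Ŷ₃`
is drawn from `(Y₃, X₃, Q)` alone, `I(Y₃; Ŷ₃ | X₃, Q) = I(Ŷ₃; Y | X₃, Q) + I(Y₃; Ŷ₃ | X₃, Y, Q)`, so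
the list has about `2 ^ (m I(Y₃; Ŷ₃ | X₃, Y, Q))` entries. The next relay codeword has to be found
only among the relay messages combined with this list, which is what the last two conditions allow.
One compression codebook serves both receivers, each with its own list. The relay picks the index by
a likelihood encoder: by soft covering (`soft_covering`, `likelihood_random_coding`) the picked
codeword behaves like a draw from `p(ŷ₃|y₃,x₃,q)`. `CFLaw.relay_receiver` treats one block, and
`wsum_pathW_bad_le` chains the blocks under the invariant that the list is short and contains the
true index.

For the closed conditions it is not enough to shrink the rates, because the relay conditions can be
tight with `R₃ = 0`. Instead the law is time-shared with a probe, in which the transmitters send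
shared constants, the relay input is uniform and the compressed output is pure noise. If the relay's
input influences a receiver's output, the probe gives slack in that receiver's relay condition. If
not, `I(X₃; Y | Q) = 0` forces `R₃ = 0` and `I(Y₃; Ŷ₃ | X₃, Y, Q) = 0`; the compressed output is
then useless to this receiver, which may ignore the relay (`CFLaw.condMutualInfo_le_direct`). The
two receivers may fall into different cases and still share the same code.

For the cardinality bound, fix `(q, x₃)`. Every information quantity that involves `Ŷ₃` is a sum
over `ŷ₃` of terms that scale linearly with the vector `p(ŷ₃|·,x₃,q)`. Carathéodory's theorem
selects few symbols, with weights that keep the normalization for each `y₃` and the four sums for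
each receiver. -/

/-- `P` is a probability mass function with real values. -/
structure IsPMF {A : Type*} [Fintype A] (P : A → ℝ) : Prop where
  nonneg : ∀ a, 0 ≤ P a
  sum_one : ∑ a, P a = 1

/-! ### Independent draws: product weights, second moments, soft covering -/

section ProductWeights

variable {ι A B : Type*} [Fintype ι] [DecidableEq ι] [Fintype A] [Fintype B]

theorem sum_pi_prod (f : ι → A → ℝ) :
    ∑ c : ι → A, ∏ i, f i (c i) = ∏ i, ∑ a, f i a := by
  rw [Finset.prod_univ_sum, Fintype.piFinset_univ]

theorem IsPMF.pi {P : ι → A → ℝ} (hP : ∀ i, IsPMF (P i)) :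
    IsPMF fun c : ι → A => ∏ i, P i (c i) where
  nonneg c := Finset.prod_nonneg fun i _ => (hP i).nonneg _
  sum_one := by
    rw [sum_pi_prod]
    exact Finset.prod_eq_one fun i _ => (hP i).sum_one

theorem IsPMF.nonempty {P : A → ℝ} (hP : IsPMF P) : Nonempty A := by
  by_contra h
  rw [not_nonempty_iff] at h
  simpa using hP.sum_one

theorem sum_pi_one {P : ι → A → ℝ} (hP : ∀ i, IsPMF (P i)) (i₀ : ι) (f : A → ℝ) :
    ∑ c : ι → A, (∏ i, P i (c i)) * f (c i₀) = ∑ a, P i₀ a * f a := by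
  have h (c : ι → A) : (∏ i, P i (c i)) * f (c i₀)
      = ∏ i, P i (c i) * (if i = i₀ then f (c i) else 1) := by
    rw [Finset.prod_mul_distrib, Finset.prod_ite_eq' Finset.univ i₀ fun i => f (c i)]
    simp
  simp_rw [h]
  rw [sum_pi_prod fun i a => P i a * (if i = i₀ then f a else 1)]
  rw [Finset.prod_eq_single i₀]
  · simp
  · intro i _ hi
    simpa [hi] using (hP i).sum_one
  · simp

theorem sum_pi_two {P : ι → A → ℝ} (hP : ∀ i, IsPMF (P i)) {i₀ j₀ : ι} (hij : i₀ ≠ j₀)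
    (f : A → A → ℝ) :
    ∑ c : ι → A, (∏ i, P i (c i)) * f (c i₀) (c j₀) =
      ∑ a, P i₀ a * ∑ b, P j₀ b * f a b := by
  -- Freezing the value of `c i₀` to `a` by an indicator makes the summand factor over the
  -- coordinates.
  have h (c : ι → A) : (∏ i, P i (c i)) * f (c i₀) (c j₀)
      = ∑ a, ∏ i, P i (c i) * ((if i = i₀ then if c i = a then 1 else 0 else 1) *
          (if i = j₀ then f a (c i) else 1)) := by
    simp_rw [Finset.prod_mul_distrib]
    have e1 (a : A) := Finset.prod_ite_eq' Finset.univ i₀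
      fun i => (if c i = a then (1 : ℝ) else 0)
    have e2 (a : A) := Finset.prod_ite_eq' Finset.univ j₀ fun i => f a (c i)
    simp_rw [e1, e2]
    simp
  simp_rw [h]
  rw [Finset.sum_comm]
  refine Finset.sum_congr rfl fun a _ => ?_
  rw [sum_pi_prod fun i x => P i x * ((if i = i₀ then if x = a then 1 else 0 else 1) *
    (if i = j₀ then f a x else 1))]
  rw [Finset.prod_eq_mul i₀ j₀ hij]
  · simp [hij, hij.symm]
  · intro i _ hi
    simpa [hi.1, hi.2] using (hP i).sum_one
  · simp
  · simp

/-- Variances of independent variables add: each cross term factors and contains a mean, which is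
zero. This is the only second moment computation, used both for soft covering and for the law of
large numbers. -/
theorem sum_pi_sq {P : A → ℝ} (hP : IsPMF P) {g : A → ℝ} (hg : ∑ a, P a * g a = 0) :
    ∑ c : ι → A, (∏ i, P (c i)) * (∑ i, g (c i)) ^ 2 =
      Fintype.card ι * ∑ a, P a * g a ^ 2 := by
  have h (c : ι → A) : (∏ i, P (c i)) * (∑ i, g (c i)) ^ 2 =
      ∑ i, ∑ j, (∏ i, P (c i)) * (g (c i) * g (c j)) := by
    rw [sq, Finset.sum_mul_sum, Finset.mul_sum]
    simp_rw [Finset.mul_sum]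
  simp_rw [h]
  rw [Finset.sum_comm]
  have h2 (i : ι) : ∑ c : ι → A, ∑ j, (∏ i, P (c i)) * (g (c i) * g (c j)) =
      ∑ a, P a * g a ^ 2 := by
    rw [Finset.sum_comm, Finset.sum_eq_single i]
    · rw [sum_pi_one (P := fun _ => P) (fun _ => hP) i fun a => g a * g a]
      simp_rw [sq]
    · intro j _ hj
      rw [sum_pi_two (P := fun _ => P) (fun _ => hP) hj.symm fun a b => g a * g b]
      refine Finset.sum_eq_zero fun a _ => ?_
      have : ∑ b, P b * (g a * g b) = g a * ∑ b, P b * g b := by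
        rw [Finset.mul_sum]
        exact Finset.sum_congr rfl fun b _ => by ring
      rw [this, hg]
      simp
    · simp
  simp_rw [h2]
  simp

/-- Cauchy-Schwarz: the mean of the absolute value is at most the root of the mean square. -/
theorem sum_mul_abs_le_sqrt {P : A → ℝ} (hP : IsPMF P) (f : A → ℝ) :
    ∑ a, P a * |f a| ≤ √(∑ a, P a * f a ^ 2) := by
  apply Real.le_sqrt_of_sq_le
  have := Finset.sum_mul_sq_le_sq_mul_sq Finset.univ (fun a => √(P a)) (fun a => √(P a) * |f a|)
  have e1 : ∑ a, √(P a) * (√(P a) * |f a|) = ∑ a, P a * |f a| :=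
    Finset.sum_congr rfl fun a _ => by
      rw [← mul_assoc, Real.mul_self_sqrt (hP.nonneg a)]
  have e2 : ∑ a, √(P a) ^ 2 = 1 := by
    rw [← hP.sum_one]
    exact Finset.sum_congr rfl fun a _ => Real.sq_sqrt (hP.nonneg a)
  have e3 : ∑ a, (√(P a) * |f a|) ^ 2 = ∑ a, P a * f a ^ 2 :=
    Finset.sum_congr rfl fun a _ => by
      rw [mul_pow, Real.sq_sqrt (hP.nonneg a), sq_abs]
  rwa [e1, e2, e3, one_mul] at this

/-- The probabilistic method: if all values exceeded `r`, so would the mean, because some weight is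
positive. It turns a bound for random codebooks into one good code. -/
theorem IsPMF.exists_le {P : A → ℝ} (hP : IsPMF P) {f : A → ℝ} {r : ℝ}
    (h : ∑ a, P a * f a ≤ r) : ∃ a, f a ≤ r := by
  by_contra! hc
  have h1 : ∑ a, P a * r < ∑ a, P a * f a := by
    obtain ⟨a, -, ha⟩ : ∃ a ∈ Finset.univ, 0 < P a := by
      by_contra! h0
      have := Finset.sum_nonpos h0
      rw [hP.sum_one] at this
      linarith
    refine Finset.sum_lt_sum (fun a _ => mul_le_mul_of_nonneg_left (hc a).le (hP.nonneg a))
      ⟨a, Finset.mem_univ a, mul_lt_mul_of_pos_left (hc a) ha⟩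
  rw [← Finset.sum_mul, hP.sum_one] at h1
  linarith

theorem IsPMF.sum_le {P : A → ℝ} (hP : IsPMF P) {f : A → ℝ} {r : ℝ} (h : ∀ a, f a ≤ r) :
    ∑ a, P a * f a ≤ r :=
  calc ∑ a, P a * f a ≤ ∑ a, P a * r :=
        Finset.sum_le_sum fun a _ => mul_le_mul_of_nonneg_left (h a) (hP.nonneg a)
    _ = r := by rw [← Finset.sum_mul, hP.sum_one, one_mul]

theorem IsPMF.sum_const {P : A → ℝ} (hP : IsPMF P) (r : ℝ) : ∑ a, P a * r = r := by
  rw [← Finset.sum_mul, hP.sum_one, one_mul]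

/-- Soft covering for the likelihood ratios of the output `a` with respect to the codeword
distribution `P`. -/
theorem soft_covering {P a : A → ℝ} (hP : IsPMF P) (ha : IsPMF a) {γ : ℝ} (hγ : 0 ≤ γ)
    {K : Type*} [Fintype K] [DecidableEq K] [Nonempty K] :
    ∑ c : K → A, (∏ k, P (c k)) *
        max (1 - (1 / Fintype.card K : ℝ) * ∑ k, a (c k) / P (c k)) 0 ≤
      ∑ u, a u * (if γ * P u < a u then 1 else 0) + √(γ / Fintype.card K) := by
  set N : ℝ := (Fintype.card K : ℝ) with hN
  have hNpos : 0 < N := by rw [hN]; exact_mod_cast Fintype.card_pos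
  set r : A → ℝ := fun u => a u / P u with hr
  -- Large ratios are discarded. This can only increase the deficit below 1; the mean drops exactly
  -- by the `a`-mass of the discarded points, and the ratios that remain are at most `γ` on the
  -- support of `P`, so that their variance is at most `γ`.
  set rA : A → ℝ := fun u => if γ * P u < a u then 0 else r u with hrA
  have hr0 (u) : 0 ≤ r u := div_nonneg (ha.nonneg u) (hP.nonneg u)
  have hrA_le (u) : rA u ≤ r u := by
    simp only [hrA]; split_ifs
    · exact hr0 u
    · exact le_rfl
  have hrA0 (u) : 0 ≤ rA u := by
    simp only [hrA]; split_ifs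
    · exact le_rfl
    · exact hr0 u
  set μ : ℝ := ∑ u, P u * rA u with hμ
  have hPrA (u) : P u * rA u = a u * (1 - if γ * P u < a u then 1 else 0) := by
    simp only [hrA]; split_ifs with h
    · simp
    · rcases (hP.nonneg u).eq_or_lt with h0 | h0
      · have : a u = 0 := le_antisymm (by rw [← h0] at h; simpa using h) (ha.nonneg u)
        simp [this, hr]
      · simp only [hr]; field_simp; simp
  have hμ1 : 1 - μ = ∑ u, a u * (if γ * P u < a u then 1 else 0) := by
    simp_rw [hμ, hPrA, mul_sub, Finset.sum_sub_distrib, mul_one, ha.sum_one]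
    ring
  have hμ0 : μ ≤ 1 := by
    have : 0 ≤ 1 - μ := by
      rw [hμ1]
      exact Finset.sum_nonneg fun u _ => mul_nonneg (ha.nonneg u) (by split_ifs <;> simp)
    linarith
  have hrAγ (u) (hu : 0 < P u) : rA u ≤ γ := by
    simp only [hrA]; split_ifs with h
    · exact hγ
    · simp only [hr]; rw [div_le_iff₀ hu]; exact not_lt.1 h
  have hmean : ∑ u, P u * (rA u - μ) = 0 := by
    simp_rw [mul_sub, Finset.sum_sub_distrib]
    rw [← Finset.sum_mul, hP.sum_one]; ring
  have hvar : ∑ u, P u * (rA u - μ) ^ 2 ≤ γ := by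
    have h1 : ∑ u, P u * (rA u - μ) ^ 2 = ∑ u, P u * rA u ^ 2 - μ ^ 2 := by
      have hu (u) : P u * (rA u - μ) ^ 2 = P u * rA u ^ 2 - 2 * μ * (P u * rA u) + P u * μ ^ 2 := by
        ring
      simp_rw [hu, Finset.sum_add_distrib, Finset.sum_sub_distrib, ← Finset.mul_sum, ← hμ]
      rw [← Finset.sum_mul, hP.sum_one]; ring
    have h2 : ∑ u, P u * rA u ^ 2 ≤ γ * μ := by
      rw [hμ, Finset.mul_sum]
      refine Finset.sum_le_sum fun u _ => ?_
      rcases (hP.nonneg u).eq_or_lt with h0 | h0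
      · simp [← h0]
      · have := mul_le_mul_of_nonneg_right (hrAγ u h0) (mul_nonneg (hP.nonneg u) (hrA0 u))
        nlinarith
    nlinarith [sq_nonneg μ]
  have hpi : IsPMF fun c : K → A => ∏ k, P (c k) := IsPMF.pi fun _ => hP
  -- The deficit is at most the lost mean plus the fluctuation of the truncated empirical mean;
  -- Cauchy-Schwarz bounds the latter by `√(γ / N)` on average.
  have hpoint (c : K → A) : max (1 - (1 / N) * ∑ k, r (c k)) 0 ≤
      (1 - μ) + |(1 / N) * ∑ k, (rA (c k) - μ)| := by
    have h1 : (1 / N) * ∑ k, (rA (c k) - μ) = (1 / N) * ∑ k, rA (c k) - μ := by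
      rw [Finset.sum_sub_distrib]
      simp only [Finset.sum_const, Finset.card_univ, nsmul_eq_mul, ← hN]
      field_simp
    have h2 : (1 / N) * ∑ k, rA (c k) ≤ (1 / N) * ∑ k, r (c k) :=
      mul_le_mul_of_nonneg_left (Finset.sum_le_sum fun k _ => hrA_le _) (by positivity)
    have h3 := neg_abs_le ((1 / N) * ∑ k, (rA (c k) - μ))
    refine max_le (by rw [h1] at *; linarith) (add_nonneg (by linarith) (abs_nonneg _))
  calc _ ≤ ∑ c : K → A, (∏ k, P (c k)) * ((1 - μ) + |(1 / N) * ∑ k, (rA (c k) - μ)|) :=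
        Finset.sum_le_sum fun c _ => mul_le_mul_of_nonneg_left (hpoint c) (hpi.nonneg c)
    _ = (1 - μ) + ∑ c : K → A, (∏ k, P (c k)) * |(1 / N) * ∑ k, (rA (c k) - μ)| := by
        simp_rw [mul_add, Finset.sum_add_distrib]
        rw [hpi.sum_const]
    _ ≤ (1 - μ) + √(γ / N) := by
        gcongr
        refine (sum_mul_abs_le_sqrt hpi _).trans (Real.sqrt_le_sqrt ?_)
        have hc (c : K → A) : (∏ k, P (c k)) * ((1 / N) * ∑ k, (rA (c k) - μ)) ^ 2 =
            (1 / N) ^ 2 * ((∏ k, P (c k)) * (∑ k, (rA (c k) - μ)) ^ 2) := by ring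
        simp_rw [hc]
        rw [← Finset.mul_sum, sum_pi_sq hP hmean, ← hN]
        have : (1 / N) ^ 2 * (N * ∑ u, P u * (rA u - μ) ^ 2) =
            (∑ u, P u * (rA u - μ) ^ 2) / N := by field_simp
        rw [this]
        gcongr
    _ = _ := by rw [hμ1]

end ProductWeights

/-! ### Marginals, entropy and conditional mutual information -/

theorem marginal_eq {Ω A : Type*} [Fintype Ω] (p : Ω → ℝ) (X : Ω → A) (a : A) :
    marginal p X a = ∑ ω, if X ω = a then p ω else 0 := by
  unfold marginal
  exact Finset.sum_congr rfl fun _ _ => by congr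

section Information

variable {Ω A B C D : Type*} [Fintype Ω] [Fintype A] [Fintype B] [Fintype C] [Fintype D]

theorem marginal_nonneg {p : Ω → ℝ} (hp : ∀ ω, 0 ≤ p ω) (X : Ω → A) (a : A) :
    0 ≤ marginal p X a := by
  rw [marginal_eq]
  exact Finset.sum_nonneg fun ω _ => by split_ifs <;> simp [hp]

theorem sum_marginal_mul (p : Ω → ℝ) (X : Ω → A) (g : A → ℝ) :
    ∑ a, marginal p X a * g a = ∑ ω, p ω * g (X ω) := by
  simp_rw [marginal_eq, Finset.sum_mul]
  rw [Finset.sum_comm]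
  refine Finset.sum_congr rfl fun ω _ => ?_
  simp

theorem sum_marginal (p : Ω → ℝ) (X : Ω → A) : ∑ a, marginal p X a = ∑ ω, p ω := by
  simpa using sum_marginal_mul p X fun _ => 1

theorem le_marginal {p : Ω → ℝ} (hp : ∀ ω, 0 ≤ p ω) (X : Ω → A) (ω : Ω) :
    p ω ≤ marginal p X (X ω) := by
  rw [marginal_eq]
  have := Finset.single_le_sum (f := fun ω' => if X ω' = X ω then p ω' else 0)
    (fun ω' _ => by split_ifs <;> simp [hp]) (Finset.mem_univ ω)
  simpa using this

theorem marginal_congr_val (p : Ω → ℝ) {X : Ω → A} {Y : Ω → B} {a : A} {b : B}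
    (h : ∀ ω, X ω = a ↔ Y ω = b) : marginal p X a = marginal p Y b := by
  simp only [marginal_eq, h]

theorem sum_marginal_triple_mid (p : Ω → ℝ) (X : Ω → A) (Y : Ω → B) (Z : Ω → C) (a : A) (c : C) :
    ∑ b, marginal p (fun ω => (X ω, Y ω, Z ω)) (a, b, c) =
      marginal p (fun ω => (X ω, Z ω)) (a, c) := by
  simp_rw [marginal_eq]
  rw [Finset.sum_comm]
  refine Finset.sum_congr rfl fun ω _ => ?_
  simp [Prod.ext_iff, ite_and]

theorem sum_marginal_pair_left (p : Ω → ℝ) (X : Ω → A) (Z : Ω → C) (c : C) :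
    ∑ a, marginal p (fun ω => (X ω, Z ω)) (a, c) = marginal p Z c := by
  simp_rw [marginal_eq]
  rw [Finset.sum_comm]
  refine Finset.sum_congr rfl fun ω _ => ?_
  simp [Prod.ext_iff, ite_and]

theorem marginal_equiv {Ω' : Type*} [Fintype Ω'] (e : Ω ≃ Ω') (p : Ω' → ℝ) (X : Ω' → A) (a : A) :
    marginal p X a = marginal (fun ω => p (e ω)) (fun ω => X (e ω)) a := by
  simp_rw [marginal_eq]
  exact (Equiv.sum_comp e fun ω => if X ω = a then p ω else 0).symm

/-- The entropy in bits of the random variable `X` under the mass function `p`. -/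
noncomputable def ent (p : Ω → ℝ) (X : Ω → A) : ℝ :=
  -∑ ω, p ω * Real.logb 2 (marginal p X (X ω))

/-- Entropy depends on a variable only through its partition into level sets. Tuples can therefore
be permuted and regrouped freely. -/
theorem ent_congr (p : Ω → ℝ) {X : Ω → A} {Y : Ω → B}
    (h : ∀ ω ω', X ω' = X ω ↔ Y ω' = Y ω) : ent p X = ent p Y := by
  unfold ent
  congr 1
  refine Finset.sum_congr rfl fun ω _ => ?_
  simp only [marginal_eq, h]

theorem condMutualInfo_eq_sum (p : Ω → ℝ) (X : Ω → A) (Y : Ω → B) (Z : Ω → C) :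
    condMutualInfo p X Y Z = ∑ ω, p ω * Real.logb 2
      (marginal p (fun ω => (X ω, Y ω, Z ω)) (X ω, Y ω, Z ω) * marginal p Z (Z ω) /
        (marginal p (fun ω => (X ω, Z ω)) (X ω, Z ω) *
          marginal p (fun ω => (Y ω, Z ω)) (Y ω, Z ω))) := by
  unfold condMutualInfo
  rw [← sum_marginal_mul p (fun ω => (X ω, Y ω, Z ω)) fun t => Real.logb 2
      (marginal p (fun ω => (X ω, Y ω, Z ω)) t * marginal p Z t.2.2 /
        (marginal p (fun ω => (X ω, Z ω)) (t.1, t.2.2) *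
          marginal p (fun ω => (Y ω, Z ω)) t.2))]
  simp_rw [Fintype.sum_prod_type]

/-- At points of positive mass all four marginals are positive and the logarithm splits; the other
points contribute nothing. Symmetry and the chain rule become linear identities between entropies.
-/
theorem condMutualInfo_eq_ent {p : Ω → ℝ} (hp : ∀ ω, 0 ≤ p ω)
    (X : Ω → A) (Y : Ω → B) (Z : Ω → C) :
    condMutualInfo p X Y Z = ent p (fun ω => (X ω, Z ω)) + ent p (fun ω => (Y ω, Z ω)) -
      ent p (fun ω => (X ω, Y ω, Z ω)) - ent p Z := by
  rw [condMutualInfo_eq_sum]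
  unfold ent
  have key (a b c d : ℝ) : -a + -b - -c - -d = c + d - a - b := by ring
  rw [key, ← Finset.sum_add_distrib, ← Finset.sum_sub_distrib, ← Finset.sum_sub_distrib]
  refine Finset.sum_congr rfl fun ω _ => ?_
  rcases (hp ω).eq_or_lt with h0 | h0
  · simp [← h0]
  · have h1 := h0.trans_le (le_marginal hp (fun ω => (X ω, Y ω, Z ω)) ω)
    have h2 := h0.trans_le (le_marginal hp Z ω)
    have h3 := h0.trans_le (le_marginal hp (fun ω => (X ω, Z ω)) ω)
    have h4 := h0.trans_le (le_marginal hp (fun ω => (Y ω, Z ω)) ω)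
    rw [Real.logb_div (by positivity) (by positivity), Real.logb_mul h1.ne' h2.ne',
      Real.logb_mul h3.ne' h4.ne']
    ring

theorem condMutualInfo_congr {p : Ω → ℝ} (hp : ∀ ω, 0 ≤ p ω)
    {A' B' C' : Type*} [Fintype A'] [Fintype B'] [Fintype C']
    {X : Ω → A} {Y : Ω → B} {Z : Ω → C} {X' : Ω → A'} {Y' : Ω → B'} {Z' : Ω → C'}
    (hX : ∀ ω ω', X ω' = X ω ↔ X' ω' = X' ω) (hY : ∀ ω ω', Y ω' = Y ω ↔ Y' ω' = Y' ω)
    (hZ : ∀ ω ω', Z ω' = Z ω ↔ Z' ω' = Z' ω) :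
    condMutualInfo p X Y Z = condMutualInfo p X' Y' Z' := by
  rw [condMutualInfo_eq_ent hp, condMutualInfo_eq_ent hp]
  congr 1
  · congr 1
    · congr 1 <;> exact ent_congr p fun ω ω' => by simp [Prod.ext_iff, hX ω, hY ω, hZ ω]
    · exact ent_congr p fun ω ω' => by simp [Prod.ext_iff, hX ω, hY ω, hZ ω]
  · exact ent_congr p hZ

/-- The law of the triple determines the conditional mutual information. -/
theorem condMutualInfo_of_law {Ω' : Type*} [Fintype Ω'] {p : Ω → ℝ} {p' : Ω' → ℝ}
    {X : Ω → A} {Y : Ω → B} {Z : Ω → C} {X' : Ω' → A} {Y' : Ω' → B} {Z' : Ω' → C}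
    (h : ∀ t, marginal p (fun ω => (X ω, Y ω, Z ω)) t =
      marginal p' (fun ω => (X' ω, Y' ω, Z' ω)) t) :
    condMutualInfo p X Y Z = condMutualInfo p' X' Y' Z' := by
  have hYZ (b : B) (c : C) : marginal p (fun ω => (Y ω, Z ω)) (b, c) =
      marginal p' (fun ω => (Y' ω, Z' ω)) (b, c) := by
    rw [← sum_marginal_pair_left p X, ← sum_marginal_pair_left p' X']
    exact Finset.sum_congr rfl fun a _ => h _
  have hZ (c : C) : marginal p Z c = marginal p' Z' c := by
    rw [← sum_marginal_pair_left p Y, ← sum_marginal_pair_left p' Y']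
    exact Finset.sum_congr rfl fun b _ => hYZ _ _
  have hXZ (a : A) (c : C) : marginal p (fun ω => (X ω, Z ω)) (a, c) =
      marginal p' (fun ω => (X' ω, Z' ω)) (a, c) := by
    rw [← sum_marginal_triple_mid p X Y Z, ← sum_marginal_triple_mid p' X' Y' Z']
    exact Finset.sum_congr rfl fun b _ => h _
  unfold condMutualInfo
  simp_rw [h, hYZ, hXZ, hZ]

/-- This is `log t ≤ t - 1` at `t = y / x`, strict for `t ≠ 1`; `hxy` is absolute continuity. -/
theorem gibbs_term {x y : ℝ} (hx : 0 ≤ x) (hy : 0 ≤ y) (hxy : y = 0 → x = 0) :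
    (x - y) / Real.log 2 ≤ x * Real.logb 2 (x / y) ∧
      (x ≠ y → (x - y) / Real.log 2 < x * Real.logb 2 (x / y)) := by
  have hl : 0 < Real.log 2 := Real.log_pos one_lt_two
  rcases hx.eq_or_lt with rfl | hx
  · simp only [zero_sub, zero_mul]
    refine ⟨div_nonpos_of_nonpos_of_nonneg (by linarith) hl.le, fun h => ?_⟩
    have : 0 < y := lt_of_le_of_ne hy h
    exact div_neg_of_neg_of_pos (by linarith) hl
  · have hy' : 0 < y := lt_of_le_of_ne hy fun h => hx.ne' (hxy h.symm)
    have hlog : x * Real.logb 2 (x / y) = -(x * Real.log (y / x)) / Real.log 2 := by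
      rw [Real.logb, Real.log_div hx.ne' hy'.ne', Real.log_div hy'.ne' hx.ne']
      ring
    have hy2 : x * (y / x - 1) = y - x := by field_simp
    rw [hlog]
    constructor
    · gcongr
      have := mul_le_mul_of_nonneg_left (Real.log_le_sub_one_of_pos (div_pos hy' hx)) hx.le
      linarith
    · intro hne
      gcongr
      have := mul_lt_mul_of_pos_left
        (Real.log_lt_sub_one_of_pos (div_pos hy' hx)
          (fun h => hne ((div_eq_one_iff_eq hx.ne').1 h).symm)) hx
      linarith

/-- Gibbs' inequality with its equality case, for conditional mutual information. -/
theorem condMutualInfo_gibbs {p : Ω → ℝ} (hp : ∀ ω, 0 ≤ p ω)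
    (X : Ω → A) (Y : Ω → B) (Z : Ω → C) :
    0 ≤ condMutualInfo p X Y Z ∧
      ((∃ a b c, marginal p (fun ω => (X ω, Y ω, Z ω)) (a, b, c) * marginal p Z c ≠
        marginal p (fun ω => (X ω, Z ω)) (a, c) * marginal p (fun ω => (Y ω, Z ω)) (b, c)) →
          0 < condMutualInfo p X Y Z) := by
  set P : A × B × C → ℝ := marginal p (fun ω => (X ω, Y ω, Z ω)) with hP
  set PC : C → ℝ := marginal p Z with hPC
  set PA : A × C → ℝ := marginal p (fun ω => (X ω, Z ω)) with hPA
  set PB : B × C → ℝ := marginal p (fun ω => (Y ω, Z ω)) with hPB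
  have hP0 (t) : 0 ≤ P t := marginal_nonneg hp _ t
  have hPC0 (t) : 0 ≤ PC t := marginal_nonneg hp _ t
  have hPA0 (t) : 0 ≤ PA t := marginal_nonneg hp _ t
  have hPB0 (t) : 0 ≤ PB t := marginal_nonneg hp _ t
  have hA (a : A) (c : C) : ∑ b, P (a, b, c) = PA (a, c) := sum_marginal_triple_mid p X Y Z a c
  have hB (b : B) (c : C) : ∑ a, P (a, b, c) = PB (b, c) := sum_marginal_pair_left p X _ _
  have hC (c : C) : ∑ b, PB (b, c) = PC c := sum_marginal_pair_left p Y _ _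
  have hC' (c : C) : ∑ a, PA (a, c) = PC c := sum_marginal_pair_left p X _ _
  have hPPA (a b c) : P (a, b, c) ≤ PA (a, c) := by
    rw [← hA]
    exact Finset.single_le_sum (f := fun b => P (a, b, c)) (fun b _ => hP0 _) (Finset.mem_univ b)
  have hPPB (a b c) : P (a, b, c) ≤ PB (b, c) := by
    rw [← hB]
    exact Finset.single_le_sum (f := fun a => P (a, b, c)) (fun b _ => hP0 _) (Finset.mem_univ a)
  have hPPC (a c) : PA (a, c) ≤ PC c := by
    rw [← hC']
    exact Finset.single_le_sum (f := fun a => PA (a, c)) (fun b _ => hPA0 _) (Finset.mem_univ a)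
  -- The comparison law makes `X` and `Y` independent given `Z`. It has the same total mass as the
  -- true law, so the linear terms in Gibbs' inequality cancel.
  set y : A × B × C → ℝ := fun t => PA (t.1, t.2.2) * PB t.2 / PC t.2.2 with hy
  have hy0 (t) : 0 ≤ y t := div_nonneg (mul_nonneg (hPA0 _) (hPB0 _)) (hPC0 _)
  have hyP (t : A × B × C) : y t = 0 → P t = 0 := by
    obtain ⟨a, b, c⟩ := t
    intro h
    refine le_antisymm ?_ (hP0 _)
    simp only [hy, div_eq_zero_iff, mul_eq_zero] at h
    rcases h with (h | h) | h
    · exact (hPPA a b c).trans h.le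
    · exact (hPPB a b c).trans h.le
    · exact (hPPA a b c).trans ((hPPC a c).trans h.le)
  have hsum : ∑ t, (P t - y t) = 0 := by
    have e1 : ∑ t, P t = ∑ c, PC c := by
      rw [hP, hPC, sum_marginal, sum_marginal]
    have e2 : ∑ t, y t = ∑ c, PC c := by
      simp_rw [Fintype.sum_prod_type, hy]
      have (a : A) : ∑ b, ∑ c, PA (a, c) * PB (b, c) / PC c =
          ∑ c, ∑ b, PA (a, c) * PB (b, c) / PC c := Finset.sum_comm
      simp_rw [this]
      rw [Finset.sum_comm]
      refine Finset.sum_congr rfl fun c _ => ?_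
      simp_rw [← Finset.sum_div, ← Finset.mul_sum, hC, ← Finset.sum_mul, hC']
      rcases eq_or_ne (PC c) 0 with h | h
      · simp [h]
      · field_simp
    rw [Finset.sum_sub_distrib, e1, e2, sub_self]
  have hI : condMutualInfo p X Y Z = ∑ t, P t * Real.logb 2 (P t / y t) := by
    simp_rw [Fintype.sum_prod_type]
    unfold condMutualInfo
    refine Finset.sum_congr rfl fun a _ => Finset.sum_congr rfl fun b _ =>
      Finset.sum_congr rfl fun c _ => ?_
    simp only [← hP, ← hPC, ← hPA, ← hPB, hy]
    rw [div_div_eq_mul_div]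
  have hlin : ∑ t, (P t - y t) / Real.log 2 = 0 := by
    rw [← Finset.sum_div, hsum, zero_div]
  rw [hI]
  constructor
  · rw [← hlin]
    exact Finset.sum_le_sum fun t _ => (gibbs_term (hP0 t) (hy0 t) (hyP t)).1
  · rintro ⟨a, b, c, hne⟩
    rw [← hlin]
    refine Finset.sum_lt_sum (fun t _ => (gibbs_term (hP0 t) (hy0 t) (hyP t)).1)
      ⟨(a, b, c), Finset.mem_univ _, (gibbs_term (hP0 _) (hy0 _) (hyP _)).2 fun h => hne ?_⟩
    rw [h]
    simp only [hy]
    rcases eq_or_ne (PC c) 0 with h0 | h0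
    · have : PA (a, c) = 0 := le_antisymm ((hPPC a c).trans h0.le) (hPA0 _)
      simp [this]
    · field_simp

theorem condMutualInfo_nonneg {p : Ω → ℝ} (hp : ∀ ω, 0 ≤ p ω)
    (X : Ω → A) (Y : Ω → B) (Z : Ω → C) : 0 ≤ condMutualInfo p X Y Z :=
  (condMutualInfo_gibbs hp X Y Z).1

/-- Conditional independence, in the form of a factorization of the law. -/
theorem condMutualInfo_eq_zero (p : Ω → ℝ) {X : Ω → A} {Y : Ω → B} {Z : Ω → C}
    {g : A → C → ℝ} {h : B → C → ℝ}
    (hf : ∀ a b c, marginal p (fun ω => (X ω, Y ω, Z ω)) (a, b, c) = g a c * h b c) :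
    condMutualInfo p X Y Z = 0 := by
  have hA (a : A) (c : C) : marginal p (fun ω => (X ω, Z ω)) (a, c) = g a c * ∑ b, h b c := by
    rw [← sum_marginal_triple_mid p X Y Z]
    simp_rw [hf, Finset.mul_sum]
  have hB (b : B) (c : C) : marginal p (fun ω => (Y ω, Z ω)) (b, c) = (∑ a, g a c) * h b c := by
    rw [← sum_marginal_pair_left p X]
    simp_rw [hf, Finset.sum_mul]
  have hC (c : C) : marginal p Z c = (∑ a, g a c) * ∑ b, h b c := by
    rw [← sum_marginal_pair_left p Y]
    simp_rw [hB, Finset.mul_sum]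
  unfold condMutualInfo
  refine Finset.sum_eq_zero fun a _ => Finset.sum_eq_zero fun b _ => Finset.sum_eq_zero fun c _ => ?_
  rw [hf, hA, hB, hC]
  -- Numerator and denominator coincide, so the argument of the logarithm is 1, or 0 by division by
  -- zero; `Real.logb` vanishes in both cases.
  have : g a c * h b c * ((∑ a, g a c) * ∑ b, h b c) /
      (g a c * (∑ b, h b c) * ((∑ a, g a c) * h b c)) = 0 ∨
      g a c * h b c * ((∑ a, g a c) * ∑ b, h b c) /
      (g a c * (∑ b, h b c) * ((∑ a, g a c) * h b c)) = 1 := by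
    rw [show g a c * (∑ b, h b c) * ((∑ a, g a c) * h b c) =
      g a c * h b c * ((∑ a, g a c) * ∑ b, h b c) by ring]
    rcases eq_or_ne (g a c * h b c * ((∑ a, g a c) * ∑ b, h b c)) 0 with h0 | h0
    · left; rw [h0]; simp
    · right; exact div_self h0
  rcases this with h0 | h0 <;> simp [h0]

theorem condMutualInfo_comm {p : Ω → ℝ} (hp : ∀ ω, 0 ≤ p ω)
    (X : Ω → A) (Y : Ω → B) (Z : Ω → C) :
    condMutualInfo p X Y Z = condMutualInfo p Y X Z := by
  rw [condMutualInfo_eq_ent hp, condMutualInfo_eq_ent hp,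
    ent_congr p (X := fun ω => (X ω, Y ω, Z ω)) (Y := fun ω => (Y ω, X ω, Z ω))
      fun ω ω' => by simp only [Prod.mk.injEq]; tauto]
  ring

/-- Chain rule. -/
theorem condMutualInfo_chain {p : Ω → ℝ} (hp : ∀ ω, 0 ≤ p ω)
    (X : Ω → A) (Y : Ω → B) (Y' : Ω → D) (Z : Ω → C) :
    condMutualInfo p X (fun ω => (Y ω, Y' ω)) Z =
      condMutualInfo p X Y Z + condMutualInfo p X Y' (fun ω => (Y ω, Z ω)) := by
  simp only [condMutualInfo_eq_ent hp]
  rw [ent_congr p (X := fun ω => (X ω, Y' ω, Y ω, Z ω)) (Y := fun ω => (X ω, (Y ω, Y' ω), Z ω))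
      fun ω ω' => by simp only [Prod.mk.injEq]; tauto,
    ent_congr p (X := fun ω => (Y' ω, Y ω, Z ω)) (Y := fun ω => ((Y ω, Y' ω), Z ω))
      fun ω ω' => by simp only [Prod.mk.injEq]; tauto]
  ring

end Information

/-! ### Information density and its concentration for memoryless sequences -/

section Typicality

variable {Ω A B C : Type*} [Fintype Ω] [Fintype A] [Fintype B] [Fintype C]

/-- The value `(a, b, c)` has information density `p(a,b|c) / (p(a|c) p(b|c))` above `γ`. -/
def InfoDense (p : Ω → ℝ) (X : Ω → A) (Y : Ω → B) (Z : Ω → C) (γ : ℝ) (a : A) (b : B) (c : C) : Prop :=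
  γ * (marginal p (fun ω => (X ω, Z ω)) (a, c) * marginal p (fun ω => (Y ω, Z ω)) (b, c)) <
    marginal p (fun ω => (X ω, Y ω, Z ω)) (a, b, c) * marginal p Z c

/-- The probability that `(X, Y, Z)` is not dense. -/
noncomputable def missProb (p : Ω → ℝ) (X : Ω → A) (Y : Ω → B) (Z : Ω → C) (γ : ℝ) : ℝ :=
  ∑ ω, p ω * if InfoDense p X Y Z γ (X ω) (Y ω) (Z ω) then 0 else 1

/-- The probability that `(X, Y, Z)` is dense. -/
noncomputable def denseProb (p : Ω → ℝ) (X : Ω → A) (Y : Ω → B) (Z : Ω → C) (γ : ℝ) : ℝ :=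
  ∑ ω, p ω * if InfoDense p X Y Z γ (X ω) (Y ω) (Z ω) then 1 else 0

/-- An `X` drawn independently of `Y` given `Z` is unlikely to be dense with `(Y, Z)`. -/
theorem sum_dense_le {p : Ω → ℝ} (hp : IsPMF p) {X : Ω → A} {Y : Ω → B} {Z : Ω → C} {γ : ℝ}
    (hγ : 0 < γ) {g : A → C → ℝ}
    (hg : ∀ a c, marginal p (fun ω => (X ω, Z ω)) (a, c) = g a c * marginal p Z c) :
    ∑ ω, p ω * ∑ a, g a (Z ω) * (if InfoDense p X Y Z γ a (Y ω) (Z ω) then 1 else 0) ≤ 1 / γ := by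
  rw [← sum_marginal_mul p (fun ω => (Y ω, Z ω))
    fun t => ∑ a, g a t.2 * (if InfoDense p X Y Z γ a t.1 t.2 then 1 else 0)]
  -- Change of measure: on dense triples the conditionally independent law is at most `1 / γ` times
  -- the true law, whose total mass is one.
  have key (a : A) (b : B) (c : C) : marginal p (fun ω => (Y ω, Z ω)) (b, c) *
      (g a c * (if InfoDense p X Y Z γ a b c then 1 else 0)) ≤
        marginal p (fun ω => (X ω, Y ω, Z ω)) (a, b, c) / γ := by
    split_ifs with h
    · rw [InfoDense, hg] at h
      have h0 : 0 ≤ marginal p Z c := marginal_nonneg hp.nonneg _ _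
      rcases h0.eq_or_lt with h0 | h0
      · rw [← h0] at h; simp at h
      · rw [le_div_iff₀ hγ]
        by_contra! hc
        have := mul_lt_mul_of_pos_right hc h0
        linarith
    · simp only [mul_zero]
      exact div_nonneg (marginal_nonneg hp.nonneg _ _) hγ.le
  calc _ = ∑ t : B × C, ∑ a, marginal p (fun ω => (Y ω, Z ω)) t *
        (g a t.2 * (if InfoDense p X Y Z γ a t.1 t.2 then 1 else 0)) := by simp_rw [Finset.mul_sum]
    _ ≤ ∑ t : B × C, ∑ a, marginal p (fun ω => (X ω, Y ω, Z ω)) (a, t) / γ :=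
        Finset.sum_le_sum fun t _ => Finset.sum_le_sum fun a _ => key a t.1 t.2
    _ = 1 / γ := by
        simp_rw [← Finset.sum_div]
        have (t : B × C) : ∑ a, marginal p (fun ω => (X ω, Y ω, Z ω)) (a, t) =
          marginal p (fun ω => (Y ω, Z ω)) t := sum_marginal_pair_left p X _ t
        simp_rw [this]
        rw [sum_marginal, hp.sum_one]

/-- The information density in bits at `ω`. -/
noncomputable def infoDensity (p : Ω → ℝ) (X : Ω → A) (Y : Ω → B) (Z : Ω → C) (ω : Ω) : ℝ :=
  Real.logb 2
    (marginal p (fun ω => (X ω, Y ω, Z ω)) (X ω, Y ω, Z ω) * marginal p Z (Z ω) /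
      (marginal p (fun ω => (X ω, Z ω)) (X ω, Z ω) *
        marginal p (fun ω => (Y ω, Z ω)) (Y ω, Z ω)))

/-- The variance of the information density. -/
noncomputable def infoVariance (p : Ω → ℝ) (X : Ω → A) (Y : Ω → B) (Z : Ω → C) : ℝ :=
  ∑ ω, p ω * (infoDensity p X Y Z ω - condMutualInfo p X Y Z) ^ 2

variable {Ω' A' B' C' : Type*} [Fintype Ω'] [Fintype A'] [Fintype B'] [Fintype C']

/-- The event that a sequence has prescribed values of `X'` is a product of letterwise events. The
equivalence `Φ` passes from sequences of tuples to tuples of sequences, which is the form the block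
laws have. -/
theorem marginal_power {m : ℕ} {p : Ω → ℝ} {p' : Ω' → ℝ} (Φ : (Fin m → Ω) ≃ Ω')
    (hΦ : ∀ ω, p' (Φ ω) = ∏ j, p (ω j)) {X : Ω → A} {X' : Ω' → A'}
    (hX : ∀ ω ω', X' (Φ ω') = X' (Φ ω) ↔ ∀ j, X (ω' j) = X (ω j)) (ω : Fin m → Ω) :
    marginal p' X' (X' (Φ ω)) = ∏ j, marginal p X (X (ω j)) := by
  rw [marginal_equiv Φ, marginal_eq]
  simp_rw [hX, hΦ, marginal_eq]
  rw [← sum_pi_prod fun j ω' => if X ω' = X (ω j) then p ω' else 0]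
  refine Finset.sum_congr rfl fun ω' _ => ?_
  split_ifs with h
  · exact Finset.prod_congr rfl fun j _ => by rw [if_pos (h j)]
  · push Not at h
    obtain ⟨j, hj⟩ := h
    exact (Finset.prod_eq_zero (Finset.mem_univ j) (if_neg hj)).symm

/-- Weak law of large numbers for a product mass function. -/
theorem sum_prod_deviation_le {p : Ω → ℝ} (hp : IsPMF p) {f : Ω → ℝ} {I : ℝ}
    (hI : ∑ ω, p ω * f ω = I) {δ : ℝ} (hδ : 0 < δ) {m : ℕ} (hm : 0 < m) :
    ∑ ω : Fin m → Ω, (∏ j, p (ω j)) * (if m * δ ≤ |∑ j, (f (ω j) - I)| then 1 else 0) ≤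
      (∑ ω, p ω * (f ω - I) ^ 2) / (m * δ ^ 2) := by
  have hmean : ∑ ω, p ω * (f ω - I) = 0 := by
    simp_rw [mul_sub, Finset.sum_sub_distrib, hI, hp.sum_const, sub_self]
  have hmR : (0 : ℝ) < m := by exact_mod_cast hm
  have hb : 0 < (m * δ) ^ 2 := by positivity
  calc _ ≤ ∑ ω : Fin m → Ω, (∏ j, p (ω j)) * ((∑ j, (f (ω j) - I)) ^ 2 / (m * δ) ^ 2) := by
        refine Finset.sum_le_sum fun ω _ => mul_le_mul_of_nonneg_left ?_
          (Finset.prod_nonneg fun j _ => hp.nonneg _)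
        split_ifs with h
        · rw [one_le_div hb, ← sq_abs (∑ j, (f (ω j) - I))]
          gcongr
        · positivity
    _ = _ := by
        simp_rw [mul_div_assoc', ← Finset.sum_div]
        rw [sum_pi_sq hp hmean, Fintype.card_fin]
        field_simp

/-- The four marginals of a sequence are products, so its log-likelihood ratio is the sum of the
letterwise densities. Positive mass is needed to take logarithms. -/
theorem dense_power {m : ℕ} {p : Ω → ℝ} (hp : IsPMF p) {p' : Ω' → ℝ} (Φ : (Fin m → Ω) ≃ Ω')
    (hΦ : ∀ ω, p' (Φ ω) = ∏ j, p (ω j)) {X : Ω → A} {X' : Ω' → A'} {Y : Ω → B} {Y' : Ω' → B'}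
    {Z : Ω → C} {Z' : Ω' → C'}
    (hX : ∀ ω ω', X' (Φ ω') = X' (Φ ω) ↔ ∀ j, X (ω' j) = X (ω j))
    (hY : ∀ ω ω', Y' (Φ ω') = Y' (Φ ω) ↔ ∀ j, Y (ω' j) = Y (ω j))
    (hZ : ∀ ω ω', Z' (Φ ω') = Z' (Φ ω) ↔ ∀ j, Z (ω' j) = Z (ω j))
    (t : ℝ) (ω : Fin m → Ω) (hω : (∏ j, p (ω j)) ≠ 0) :
    InfoDense p' X' Y' Z' ((2 : ℝ) ^ t) (X' (Φ ω)) (Y' (Φ ω)) (Z' (Φ ω)) ↔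
      t < ∑ j, infoDensity p X Y Z (ω j) := by
  have hpos (j : Fin m) : 0 < p (ω j) :=
    lt_of_le_of_ne (hp.nonneg _) (Ne.symm (Finset.prod_ne_zero_iff.1 hω j (Finset.mem_univ j)))
  have m1 (j) := (hpos j).trans_le (le_marginal hp.nonneg (fun ω => (X ω, Y ω, Z ω)) (ω j))
  have m2 (j) := (hpos j).trans_le (le_marginal hp.nonneg Z (ω j))
  have m3 (j) := (hpos j).trans_le (le_marginal hp.nonneg (fun ω => (X ω, Z ω)) (ω j))
  have m4 (j) := (hpos j).trans_le (le_marginal hp.nonneg (fun ω => (Y ω, Z ω)) (ω j))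
  unfold InfoDense
  rw [marginal_power Φ hΦ hZ,
    marginal_power (X := fun ω => (X ω, Z ω)) (X' := fun ω => (X' ω, Z' ω)) Φ hΦ
      fun ω ω' => by simp [hX, hZ, forall_and],
    marginal_power (X := fun ω => (Y ω, Z ω)) (X' := fun ω => (Y' ω, Z' ω)) Φ hΦ
      fun ω ω' => by simp [hY, hZ, forall_and],
    marginal_power (X := fun ω => (X ω, Y ω, Z ω)) (X' := fun ω => (X' ω, Y' ω, Z' ω)) Φ hΦ
      fun ω ω' => by simp [hX, hY, hZ, forall_and]]
  have h1 := Finset.prod_pos fun j (_ : j ∈ Finset.univ) => m1 j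
  have h2 := Finset.prod_pos fun j (_ : j ∈ Finset.univ) => m2 j
  have h3 := Finset.prod_pos fun j (_ : j ∈ Finset.univ) => m3 j
  have h4 := Finset.prod_pos fun j (_ : j ∈ Finset.univ) => m4 j
  rw [← lt_div_iff₀ (mul_pos h3 h4), ← Real.lt_logb_iff_rpow_lt one_lt_two (by positivity)]
  rw [← Finset.prod_mul_distrib, ← Finset.prod_mul_distrib, ← Finset.prod_div_distrib,
    Real.logb_prod]
  · rfl
  · intro j _
    have := m1 j; have := m2 j; have := m3 j; have := m4 j
    positivity

/-- Missing the threshold means that the sum of the densities falls short of its mean by at least `m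
δ`, which Chebyshev's inequality bounds. -/
theorem missProb_power_le {m : ℕ} (hm : 0 < m) {p : Ω → ℝ} (hp : IsPMF p) {p' : Ω' → ℝ}
    (Φ : (Fin m → Ω) ≃ Ω')
    (hΦ : ∀ ω, p' (Φ ω) = ∏ j, p (ω j)) {X : Ω → A} {X' : Ω' → A'} {Y : Ω → B} {Y' : Ω' → B'}
    {Z : Ω → C} {Z' : Ω' → C'}
    (hX : ∀ ω ω', X' (Φ ω') = X' (Φ ω) ↔ ∀ j, X (ω' j) = X (ω j))
    (hY : ∀ ω ω', Y' (Φ ω') = Y' (Φ ω) ↔ ∀ j, Y (ω' j) = Y (ω j))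
    (hZ : ∀ ω ω', Z' (Φ ω') = Z' (Φ ω) ↔ ∀ j, Z (ω' j) = Z (ω j))
    {δ : ℝ} (hδ : 0 < δ) :
    missProb p' X' Y' Z' ((2 : ℝ) ^ (m * (condMutualInfo p X Y Z - δ))) ≤
      infoVariance p X Y Z / (m * δ ^ 2) := by
  refine le_trans ?_ (sum_prod_deviation_le hp (f := infoDensity p X Y Z)
    (condMutualInfo_eq_sum p X Y Z).symm hδ hm)
  unfold missProb
  rw [← Equiv.sum_comp Φ]
  refine Finset.sum_le_sum fun ω _ => ?_
  rw [hΦ]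
  rcases eq_or_ne (∏ j, p (ω j)) 0 with h0 | h0
  · simp [h0]
  · refine mul_le_mul_of_nonneg_left ?_ (Finset.prod_nonneg fun j _ => hp.nonneg _)
    rw [dense_power hp Φ hΦ hX hY hZ _ ω h0]
    split_ifs with h1 h2 h2
    · simp
    · simp
    · simp
    · refine absurd ?_ h2
      rw [not_lt] at h1
      rw [Finset.sum_sub_distrib]
      simp only [Finset.sum_const, Finset.card_univ, Fintype.card_fin, nsmul_eq_mul]
      refine le_trans ?_ (neg_le_abs _)
      linarith

theorem denseProb_power_le {m : ℕ} (hm : 0 < m) {p : Ω → ℝ} (hp : IsPMF p) {p' : Ω' → ℝ}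
    (Φ : (Fin m → Ω) ≃ Ω')
    (hΦ : ∀ ω, p' (Φ ω) = ∏ j, p (ω j)) {X : Ω → A} {X' : Ω' → A'} {Y : Ω → B} {Y' : Ω' → B'}
    {Z : Ω → C} {Z' : Ω' → C'}
    (hX : ∀ ω ω', X' (Φ ω') = X' (Φ ω) ↔ ∀ j, X (ω' j) = X (ω j))
    (hY : ∀ ω ω', Y' (Φ ω') = Y' (Φ ω) ↔ ∀ j, Y (ω' j) = Y (ω j))
    (hZ : ∀ ω ω', Z' (Φ ω') = Z' (Φ ω) ↔ ∀ j, Z (ω' j) = Z (ω j))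
    {δ : ℝ} (hδ : 0 < δ) :
    denseProb p' X' Y' Z' ((2 : ℝ) ^ (m * (condMutualInfo p X Y Z + δ))) ≤
      infoVariance p X Y Z / (m * δ ^ 2) := by
  refine le_trans ?_ (sum_prod_deviation_le hp (f := infoDensity p X Y Z)
    (condMutualInfo_eq_sum p X Y Z).symm hδ hm)
  unfold denseProb
  rw [← Equiv.sum_comp Φ]
  refine Finset.sum_le_sum fun ω _ => ?_
  rw [hΦ]
  rcases eq_or_ne (∏ j, p (ω j)) 0 with h0 | h0
  · simp [h0]
  · refine mul_le_mul_of_nonneg_left ?_ (Finset.prod_nonneg fun j _ => hp.nonneg _)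
    rw [dense_power hp Φ hΦ hX hY hZ _ ω h0]
    split_ifs with h1 h2 h2
    · simp
    · refine absurd ?_ h2
      rw [Finset.sum_sub_distrib]
      simp only [Finset.sum_const, Finset.card_univ, Fintype.card_fin, nsmul_eq_mul]
      refine le_trans ?_ (le_abs_self _)
      linarith
    · simp
    · simp

end Typicality

/-! ### Indicators and weighted sums -/

/-- The indicator of a proposition. -/
noncomputable def ind (p : Prop) : ℝ := if p then 1 else 0

theorem ind_nonneg (p : Prop) : 0 ≤ ind p := by unfold ind; split_ifs <;> simp

theorem ind_le_one (p : Prop) : ind p ≤ 1 := by unfold ind; split_ifs <;> simp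

theorem ind_true {p : Prop} (h : p) : ind p = 1 := by simp [ind, h]

theorem ind_false {p : Prop} (h : ¬p) : ind p = 0 := by simp [ind, h]

theorem ind_mono {p q : Prop} (h : p → q) : ind p ≤ ind q := by
  by_cases hp : p
  · rw [ind_true hp, ind_true (h hp)]
  · rw [ind_false hp]; exact ind_nonneg q

theorem ind_or_le (p q : Prop) : ind (p ∨ q) ≤ ind p + ind q := by
  by_cases hp : p
  · rw [ind_true hp, ind_true (Or.inl hp)]; linarith [ind_nonneg q]
  · rw [ind_mono (fun h => h.resolve_left hp) |>.antisymm (ind_mono Or.inr)]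
    linarith [ind_nonneg p]

theorem ind_exists_le {ι : Type*} (s : Finset ι) (p : ι → Prop) :
    ind (∃ i ∈ s, p i) ≤ ∑ i ∈ s, ind (p i) := by
  by_cases h : ∃ i ∈ s, p i
  · obtain ⟨i, hi, hp⟩ := h
    rw [ind_true ⟨i, hi, hp⟩, ← ind_true hp]
    exact Finset.single_le_sum (f := fun i => ind (p i)) (fun i _ => ind_nonneg _) hi
  · rw [ind_false h]; exact Finset.sum_nonneg fun i _ => ind_nonneg _

/-- The weighted sum of `f` with weights `P`. -/
noncomputable def wsum {A : Type*} [Fintype A] (P f : A → ℝ) : ℝ := ∑ a, P a * f a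

/-- Product weights. -/
noncomputable def piW {ι A : Type*} [Fintype ι] (P : ι → A → ℝ) : (ι → A) → ℝ :=
  fun c => ∏ i, P i (c i)

section WeightedSums

variable {ι A B : Type*} [Fintype ι] [DecidableEq ι] [Fintype A] [Fintype B]

theorem IsPMF.piW {P : ι → A → ℝ} (hP : ∀ i, IsPMF (P i)) : IsPMF (piW P) := IsPMF.pi hP

theorem wsum_add (P f g : A → ℝ) : wsum P (fun a => f a + g a) = wsum P f + wsum P g := by
  simp only [wsum, mul_add, Finset.sum_add_distrib]

theorem wsum_sum {κ : Type*} (s : Finset κ) (P : A → ℝ) (f : κ → A → ℝ) :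
    wsum P (fun a => ∑ i ∈ s, f i a) = ∑ i ∈ s, wsum P (f i) := by
  simp only [wsum, Finset.mul_sum]
  exact Finset.sum_comm

theorem wsum_const_mul (r : ℝ) (P f : A → ℝ) : wsum P (fun a => r * f a) = r * wsum P f := by
  simp only [wsum, Finset.mul_sum]
  exact Finset.sum_congr rfl fun a _ => by ring

theorem IsPMF.wsum_const {P : A → ℝ} (hP : IsPMF P) (r : ℝ) : wsum P (fun _ => r) = r :=
  hP.sum_const r

theorem IsPMF.wsum_le {P : A → ℝ} (hP : IsPMF P) {f : A → ℝ} {r : ℝ} (h : ∀ a, f a ≤ r) :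
    wsum P f ≤ r := hP.sum_le h

theorem wsum_mono {P f g : A → ℝ} (hP : ∀ a, 0 ≤ P a) (h : ∀ a, f a ≤ g a) :
    wsum P f ≤ wsum P g :=
  Finset.sum_le_sum fun a _ => mul_le_mul_of_nonneg_left (h a) (hP a)

theorem IsPMF.mono {P f g : A → ℝ} (hP : IsPMF P) (h : ∀ a, f a ≤ g a) :
    wsum P f ≤ wsum P g := wsum_mono hP.nonneg h

theorem wsum_nonneg {P f : A → ℝ} (hP : ∀ a, 0 ≤ P a) (h : ∀ a, 0 ≤ f a) : 0 ≤ wsum P f :=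
  Finset.sum_nonneg fun a _ => mul_nonneg (hP a) (h a)

theorem wsum_comm (P : A → ℝ) (Q : B → ℝ) (f : A → B → ℝ) :
    wsum P (fun a => wsum Q fun b => f a b) = wsum Q fun b => wsum P fun a => f a b := by
  simp only [wsum, Finset.mul_sum]
  rw [Finset.sum_comm]
  exact Finset.sum_congr rfl fun b _ => Finset.sum_congr rfl fun a _ => by ring

theorem wsum_piW_one {P : ι → A → ℝ} (hP : ∀ i, IsPMF (P i)) (i₀ : ι) (f : A → ℝ) :
    wsum (piW P) (fun c => f (c i₀)) = wsum (P i₀) f := sum_pi_one hP i₀ f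

theorem wsum_piW_two {P : ι → A → ℝ} (hP : ∀ i, IsPMF (P i)) {i₀ j₀ : ι} (hij : i₀ ≠ j₀)
    (f : A → A → ℝ) :
    wsum (piW P) (fun c => f (c i₀) (c j₀)) = wsum (P i₀) fun a => wsum (P j₀) fun b => f a b :=
  sum_pi_two hP hij f

end WeightedSums

/-! ### Random coding for the multiple access channel -/

section MultipleAccess

variable {K₁ K₂ X₁ X₂ O : Type*} [Fintype K₁] [DecidableEq K₁] [Fintype K₂] [DecidableEq K₂]
  [Fintype X₁] [Fintype X₂] [Fintype O]

/-- The tests passed by the message pair `w`. -/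
def MacTest (ta tb tc : X₁ → X₂ → O → Prop) (c₁ : K₁ → X₁) (c₂ : K₂ → X₂) (o : O)
    (w : K₁ × K₂) : Prop :=
  ta (c₁ w.1) (c₂ w.2) o ∧ tb (c₁ w.1) (c₂ w.2) o ∧ tc (c₁ w.1) (c₂ w.2) o

/-- Random coding for the multiple access channel, with a decoder that looks for a message pair
that passes three tests. -/
theorem mac_random_coding [Nonempty K₁] [Nonempty K₂] {P₁ : X₁ → ℝ} {P₂ : X₂ → ℝ} (h₁ : IsPMF P₁)
    (h₂ : IsPMF P₂) {T : X₁ → X₂ → O → ℝ} (hT : ∀ x₁ x₂ o, 0 ≤ T x₁ x₂ o)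
    (ta tb tc : X₁ → X₂ → O → Prop) (w₁ : K₁) (w₂ : K₂) :
    wsum (piW fun _ : K₁ => P₁) (fun c₁ => wsum (piW fun _ : K₂ => P₂) fun c₂ =>
        wsum (T (c₁ w₁) (c₂ w₂)) fun o =>
          ind (Classical.epsilon (MacTest ta tb tc c₁ c₂ o) ≠ (w₁, w₂))) ≤
      wsum P₁ fun x₁ => wsum P₂ fun x₂ => wsum (T x₁ x₂) fun o =>
        ind (¬(ta x₁ x₂ o ∧ tb x₁ x₂ o ∧ tc x₁ x₂ o)) +
          (Fintype.card K₁ - 1 : ℝ) * wsum P₁ (fun x₁' => ind (ta x₁' x₂ o)) +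
          (Fintype.card K₂ - 1 : ℝ) * wsum P₂ (fun x₂' => ind (tb x₁ x₂' o)) +
          (Fintype.card K₁ - 1 : ℝ) * (Fintype.card K₂ - 1 : ℝ) *
            wsum P₁ (fun x₁' => wsum P₂ fun x₂' => ind (tc x₁' x₂' o)) := by
  have hp₁ : IsPMF (piW fun _ : K₁ => P₁) := IsPMF.piW fun _ => h₁
  have hp₂ : IsPMF (piW fun _ : K₂ => P₂) := IsPMF.piW fun _ => h₂
  have hpoint (c₁ : K₁ → X₁) (c₂ : K₂ → X₂) (o : O) :
      ind (Classical.epsilon (MacTest ta tb tc c₁ c₂ o) ≠ (w₁, w₂)) ≤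
        ind (¬(ta (c₁ w₁) (c₂ w₂) o ∧ tb (c₁ w₁) (c₂ w₂) o ∧ tc (c₁ w₁) (c₂ w₂) o)) +
        ∑ i ∈ Finset.univ.erase w₁, ind (ta (c₁ i) (c₂ w₂) o) +
        ∑ j ∈ Finset.univ.erase w₂, ind (tb (c₁ w₁) (c₂ j) o) +
        ∑ i ∈ Finset.univ.erase w₁, ∑ j ∈ Finset.univ.erase w₂, ind (tc (c₁ i) (c₂ j) o) := by
    have h4 := ind_exists_le ((Finset.univ.erase w₁) ×ˢ (Finset.univ.erase w₂))
      fun t : K₁ × K₂ => tc (c₁ t.1) (c₂ t.2) o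
    rw [Finset.sum_product] at h4
    refine le_trans (ind_mono ?_) ((ind_or_le _ _).trans (add_le_add ((ind_or_le _ _).trans
      (add_le_add ((ind_or_le _ _).trans (add_le_add le_rfl (ind_exists_le _ _)))
        (ind_exists_le _ _))) h4))
    intro h
    by_contra! hc
    obtain ⟨⟨⟨hc0, hc1⟩, hc2⟩, hc3⟩ := hc
    have h1 : MacTest ta tb tc c₁ c₂ o (Classical.epsilon (MacTest ta tb tc c₁ c₂ o)) :=
      Classical.epsilon_spec ⟨(w₁, w₂), hc0⟩
    set w := Classical.epsilon (MacTest ta tb tc c₁ c₂ o)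
    -- The chosen pair passes all three tests. Which of its messages are wrong decides which test is
    -- charged: `ta` if only the first, `tb` if only the second, `tc` if both.
    by_cases e1 : w.1 = w₁
    · by_cases e2 : w.2 = w₂
      · exact h (Prod.ext e1 e2)
      · refine hc2 w.2 (by simp [e2]) ?_
        rw [← e1]; exact h1.2.1
    · by_cases e2 : w.2 = w₂
      · refine hc1 w.1 (by simp [e1]) ?_
        rw [← e2]; exact h1.1
      · exact hc3 w (by simp [e1, e2]) h1.2.2
  have hcard₁ : ((Finset.univ.erase w₁).card : ℝ) = Fintype.card K₁ - 1 := by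
    rw [Finset.card_erase_of_mem (Finset.mem_univ _), Finset.card_univ,
      Nat.cast_sub Fintype.card_pos, Nat.cast_one]
  have hcard₂ : ((Finset.univ.erase w₂).card : ℝ) = Fintype.card K₂ - 1 := by
    rw [Finset.card_erase_of_mem (Finset.mem_univ _), Finset.card_univ,
      Nat.cast_sub Fintype.card_pos, Nat.cast_one]
  refine le_trans (hp₁.mono fun c₁ => hp₂.mono fun c₂ => wsum_mono (hT _ _) fun o =>
    hpoint c₁ c₂ o) ?_
  simp only [wsum_add, wsum_sum, wsum_const_mul]
  refine le_of_eq (congrArg₂ _ (congrArg₂ _ (congrArg₂ _ ?_ ?_) ?_) ?_)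
  · rw [← wsum_piW_one (fun _ => h₁) w₁]
    congr 1
    ext c₁
    rw [← wsum_piW_one (fun _ => h₂) w₂]
  -- A wrong codeword is independent of the sent ones, hence of the output, so it can be replaced by
  -- a fresh draw; the same reason serves the next two cases.
  · rw [← hcard₁, ← nsmul_eq_mul]
    refine Finset.sum_eq_card_nsmul fun i hi => ?_
    have hi : w₁ ≠ i := (Finset.ne_of_mem_erase hi).symm
    have e (c₁ : K₁ → X₁) := wsum_piW_one (fun _ : K₂ => h₂) w₂ fun x₂ =>
      wsum (T (c₁ w₁) x₂) fun o => ind (ta (c₁ i) x₂ o)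
    simp only [e]
    rw [wsum_piW_two (fun _ : K₁ => h₁) hi fun x₁ x₁' => wsum P₂ fun x₂ =>
      wsum (T x₁ x₂) fun o => ind (ta x₁' x₂ o)]
    simp only [wsum_comm P₁ P₂, wsum_comm P₁ (T _ _)]
  · rw [← hcard₂, ← nsmul_eq_mul]
    refine Finset.sum_eq_card_nsmul fun j hj => ?_
    have hj : w₂ ≠ j := (Finset.ne_of_mem_erase hj).symm
    have e (c₁ : K₁ → X₁) := wsum_piW_two (fun _ : K₂ => h₂) hj fun x₂ x₂' =>
      wsum (T (c₁ w₁) x₂) fun o => ind (tb (c₁ w₁) x₂' o)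
    simp only [e]
    rw [wsum_piW_one (fun _ : K₁ => h₁) w₁ fun x₁ => wsum P₂ fun x₂ => wsum P₂ fun x₂' =>
      wsum (T x₁ x₂) fun o => ind (tb x₁ x₂' o)]
    simp only [wsum_comm P₂ (T _ _)]
  · rw [← hcard₁, ← hcard₂, mul_assoc, ← nsmul_eq_mul, ← nsmul_eq_mul]
    refine Finset.sum_eq_card_nsmul fun i hi => Finset.sum_eq_card_nsmul fun j hj => ?_
    have hi : w₁ ≠ i := (Finset.ne_of_mem_erase hi).symm
    have hj : w₂ ≠ j := (Finset.ne_of_mem_erase hj).symm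
    have e (c₁ : K₁ → X₁) := wsum_piW_two (fun _ : K₂ => h₂) hj fun x₂ x₂' =>
      wsum (T (c₁ w₁) x₂) fun o => ind (tc (c₁ i) x₂' o)
    simp only [e]
    rw [wsum_piW_two (fun _ : K₁ => h₁) hi fun x₁ x₁' => wsum P₂ fun x₂ => wsum P₂ fun x₂' =>
      wsum (T x₁ x₂) fun o => ind (tc x₁' x₂' o)]
    simp only [wsum_comm P₁ P₂, wsum_comm P₁ (T _ _), wsum_comm P₂ (T _ _)]

end MultipleAccess

/-! ### The likelihood encoder -/

section LikelihoodEncoder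

variable {K U : Type*} [Fintype K] [DecidableEq K] [Nonempty K] [Fintype U]

/-- The weights with which a likelihood encoder chooses the index of a codeword: proportional to
the likelihood ratios `a / P` of the codewords. -/
noncomputable def likelihoodW (P a : U → ℝ) (c : K → U) (k : K) : ℝ :=
  -- The uniform fallback keeps the weights a mass function when all ratios vanish.
  if ∑ k, a (c k) / P (c k) = 0 then 1 / Fintype.card K
  else (a (c k) / P (c k)) / ∑ k, a (c k) / P (c k)

theorem likelihoodW_isPMF {P a : U → ℝ} (hP : IsPMF P) (ha : IsPMF a) (c : K → U) :
    IsPMF (likelihoodW P a c) where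
  nonneg k := by
    unfold likelihoodW
    split_ifs
    · positivity
    · exact div_nonneg (div_nonneg (ha.nonneg _) (hP.nonneg _))
        (Finset.sum_nonneg fun k _ => div_nonneg (ha.nonneg _) (hP.nonneg _))
  sum_one := by
    unfold likelihoodW
    split_ifs with h
    · simp
    · rw [← Finset.sum_div, div_self h]

/-- The random normalizer `S` is replaced by its ideal value `N`. If `S ≥ N` this only enlarges the
sum; otherwise it costs at most `(1 / S - 1 / N) S = 1 - S / N`, since `G ≤ 1`. That is the deficit
bounded by soft covering. -/
theorem wsum_likelihoodW_le {P a : U → ℝ} (hP : IsPMF P) (ha : IsPMF a) (c : K → U)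
    {G : K → ℝ} (hG0 : ∀ k, 0 ≤ G k) (hG1 : ∀ k, G k ≤ 1) :
    wsum (likelihoodW P a c) G ≤ (1 / Fintype.card K : ℝ) * ∑ k, a (c k) / P (c k) * G k +
      max (1 - (1 / Fintype.card K : ℝ) * ∑ k, a (c k) / P (c k)) 0 := by
  have hr (k) : 0 ≤ a (c k) / P (c k) := div_nonneg (ha.nonneg _) (hP.nonneg _)
  set r : K → ℝ := fun k => a (c k) / P (c k) with hrdef
  set S := ∑ k, r k with hS
  set N : ℝ := (Fintype.card K : ℝ) with hN
  have hNpos : 0 < N := by rw [hN]; exact_mod_cast Fintype.card_pos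
  have hS0 : 0 ≤ S := Finset.sum_nonneg fun k _ => hr k
  have hrG : 0 ≤ ∑ k, r k * G k := Finset.sum_nonneg fun k _ => mul_nonneg (hr k) (hG0 k)
  have hrGS : ∑ k, r k * G k ≤ S :=
    Finset.sum_le_sum fun k _ => mul_le_of_le_one_right (hr k) (hG1 k)
  change _ ≤ (1 / N) * ∑ k, r k * G k + max (1 - (1 / N) * S) 0
  by_cases h0 : S = 0
  · have h1 := (likelihoodW_isPMF hP ha c).wsum_le hG1
    rw [h0]
    have : 0 ≤ (1 / N) * ∑ k, r k * G k := by positivity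
    have h2 := le_max_left (1 - (1 / N) * 0) 0
    linarith
  · have hSpos : 0 < S := lt_of_le_of_ne hS0 (Ne.symm h0)
    have e : wsum (likelihoodW P a c) G = (∑ k, r k * G k) / S := by
      unfold wsum likelihoodW
      change ∑ k, (if S = 0 then _ else r k / S) * G k = _
      simp_rw [if_neg h0]
      rw [Finset.sum_div]
      exact Finset.sum_congr rfl fun k _ => by ring
    rw [e]
    rcases le_total N S with h | h
    · have h1 := le_max_right (1 - (1 / N) * S) 0
      have : (∑ k, r k * G k) / S ≤ (1 / N) * ∑ k, r k * G k := by
        rw [one_div_mul_eq_div]; gcongr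
      linarith
    · have h1 := le_max_left (1 - (1 / N) * S) 0
      have h2 : 0 ≤ (1 / S - 1 / N) := sub_nonneg.2 (one_div_le_one_div_of_le hSpos h)
      have h3 := mul_le_mul_of_nonneg_left hrGS h2
      have h4 : (1 / S - 1 / N) * S = 1 - (1 / N) * S := by field_simp
      have h5 : (∑ k, r k * G k) / S = (1 / S) * ∑ k, r k * G k := by ring
      rw [h5]
      linarith

/-- Weighting by `a / P` changes the law from `P` to `a`. Only an inequality holds, because `a` may
charge points that `P` does not. -/
theorem wsum_div_mul_le {P a : U → ℝ} (hP : IsPMF P) (ha : IsPMF a) {f : U → ℝ}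
    (hf : ∀ u, 0 ≤ f u) : wsum P (fun u => a u / P u * f u) ≤ wsum a f := by
  refine Finset.sum_le_sum fun u _ => ?_
  rcases (hP.nonneg u).eq_or_lt with h | h
  · rw [← h, zero_mul]; exact mul_nonneg (ha.nonneg u) (hf u)
  · rw [← mul_assoc, mul_div_cancel₀ _ h.ne']

/-- Random coding for the likelihood encoder: the chosen codeword behaves as if it had law `a`,
and the other codewords as if they were independent with law `P`, up to the soft covering
error. -/
theorem likelihood_random_coding {P a : U → ℝ} (hP : IsPMF P) (ha : IsPMF a) {γ : ℝ} (hγ : 0 ≤ γ)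
    {F : (K → U) → K → ℝ} (hF0 : ∀ c k, 0 ≤ F c k) (hF1 : ∀ c k, F c k ≤ 1)
    {A b : U → ℝ} (hA : ∀ u, 0 ≤ A u) (hb : ∀ u, 0 ≤ b u)
    (hF : ∀ c k, F c k ≤ A (c k) + ∑ k' ∈ Finset.univ.erase k, b (c k')) :
    wsum (piW fun _ : K => P) (fun c => wsum (likelihoodW P a c) (F c)) ≤
      wsum a A + Fintype.card K * wsum P b + wsum a (fun u => ind (γ * P u < a u)) +
        √(γ / Fintype.card K) := by
  have hpi : IsPMF (piW fun _ : K => P) := IsPMF.piW fun _ => hP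
  have hr (u) : 0 ≤ a u / P u := div_nonneg (ha.nonneg _) (hP.nonneg _)
  set N : ℝ := (Fintype.card K : ℝ) with hN
  have hNpos : 0 < N := by rw [hN]; exact_mod_cast Fintype.card_pos
  have hb0 : 0 ≤ wsum P b := wsum_nonneg hP.nonneg hb
  have hr1 : wsum P (fun u => a u / P u) ≤ 1 := by
    have := wsum_div_mul_le hP ha (f := fun _ => 1) fun _ => zero_le_one
    simpa [ha.wsum_const] using this
  calc _ ≤ wsum (piW fun _ : K => P) (fun c =>
        (1 / N) * ∑ k, (a (c k) / P (c k) * A (c k) +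
          ∑ k' ∈ Finset.univ.erase k, a (c k) / P (c k) * b (c k')) +
            max (1 - (1 / N) * ∑ k, a (c k) / P (c k)) 0) := by
        refine hpi.mono fun c => (wsum_likelihoodW_le hP ha c (hF0 c) (hF1 c)).trans ?_
        gcongr with k _
        rw [← Finset.mul_sum, ← mul_add]
        exact mul_le_mul_of_nonneg_left (hF c k) (hr _)
    _ = (1 / N) * ∑ k, (wsum (piW fun _ : K => P) (fun c => a (c k) / P (c k) * A (c k)) +
          ∑ k' ∈ Finset.univ.erase k,
            wsum (piW fun _ : K => P) (fun c => a (c k) / P (c k) * b (c k'))) +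
          wsum (piW fun _ : K => P) (fun c =>
            max (1 - (1 / N) * ∑ k, a (c k) / P (c k)) 0) := by
        rw [wsum_add, wsum_const_mul, wsum_sum]
        simp only [wsum_add, wsum_sum]
    _ ≤ (1 / N) * ∑ k : K, (wsum a A + N * wsum P b) +
          (wsum a (fun u => ind (γ * P u < a u)) + √(γ / N)) := by
        refine add_le_add (mul_le_mul_of_nonneg_left (Finset.sum_le_sum fun k _ =>
          add_le_add ?_ ?_) (by positivity)) ?_
        -- The ratio tilts the codeword `k` to the law `a`; the other codewords are independent of
        -- it and keep the law `P`.
        · rw [wsum_piW_one (fun _ : K => hP) k fun u => a u / P u * A u]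
          exact wsum_div_mul_le hP ha hA
        · calc _ ≤ ∑ k' ∈ Finset.univ.erase k, wsum P b := by
                refine Finset.sum_le_sum fun k' hk' => ?_
                rw [wsum_piW_two (fun _ : K => hP) (Finset.ne_of_mem_erase hk').symm
                  fun u u' => a u / P u * b u']
                simp only [wsum_const_mul]
                have : wsum P (fun u => a u / P u * wsum P b) =
                    wsum P b * wsum P (fun u => a u / P u) := by
                  rw [← wsum_const_mul]
                  simp only [mul_comm]
                rw [this]
                exact mul_le_of_le_one_right hb0 hr1
            _ ≤ N * wsum P b := by
                rw [Finset.sum_const, nsmul_eq_mul]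
                refine mul_le_mul_of_nonneg_right ?_ hb0
                rw [hN]
                exact_mod_cast (Finset.card_le_univ _)
        · exact soft_covering hP ha hγ
    _ = _ := by
        rw [Finset.sum_const, Finset.card_univ, nsmul_eq_mul, ← hN]
        field_simp
        ring

end LikelihoodEncoder

/-! ### The compress-and-forward law for one receiver, and its marginals -/

/-- The factors of the joint law used by compress-and-forward: `p(q)`, `p(xᵢ|q)` and
`p(u|q,x₃,y₃)`, where `u` is the compressed version of the relay output `y₃`. -/
structure CFLaw (Q X₁ X₂ X₃ Y₃ U : Type*)
    [Fintype Q] [Fintype X₁] [Fintype X₂] [Fintype X₃] [Fintype U] where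
  pQ : Q → ℝ
  p₁ : Q → X₁ → ℝ
  p₂ : Q → X₂ → ℝ
  p₃ : Q → X₃ → ℝ
  pU : Q → X₃ → Y₃ → U → ℝ
  hQ : IsPMF pQ
  h₁ : ∀ q, IsPMF (p₁ q)
  h₂ : ∀ q, IsPMF (p₂ q)
  h₃ : ∀ q, IsPMF (p₃ q)
  hU : ∀ q x₃ y₃, IsPMF (pU q x₃ y₃)

theorem wsum_ind_eq {A : Type*} [Fintype A] (P : A → ℝ) (a₀ : A) :
    wsum P (fun a => ind (a = a₀)) = P a₀ := by
  simp [wsum, ind]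

theorem wsum_mul_ind {A : Type*} [Fintype A] (P f : A → ℝ) (a₀ : A) :
    wsum P (fun a => f a * ind (a = a₀)) = P a₀ * f a₀ := by
  simp [wsum, ind]

theorem ind_and (p q : Prop) : ind (p ∧ q) = ind p * ind q := by
  by_cases hp : p <;> by_cases hq : q <;> simp [ind, hp, hq]

theorem wsum_const_mul' {A : Type*} [Fintype A] (r : ℝ) (P f : A → ℝ) :
    wsum P (fun a => f a * r) = wsum P f * r := by
  simp only [wsum, Finset.sum_mul]
  exact Finset.sum_congr rfl fun a _ => by ring

theorem wsum_congr {A : Type*} [Fintype A] {P f g : A → ℝ} (h : ∀ a, f a = g a) :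
    wsum P f = wsum P g := by
  unfold wsum; exact Finset.sum_congr rfl fun a _ => by rw [h]

theorem marginal_eq_wsum {Ω A : Type*} [Fintype Ω] (p : Ω → ℝ) (X : Ω → A) (a : A) :
    marginal p X a = wsum p fun ω => ind (X ω = a) := by
  rw [marginal_eq, wsum]
  exact Finset.sum_congr rfl fun ω _ => by simp [ind]

namespace CFLaw

variable {Q X₁ X₂ X₃ Y Y₃ U : Type*}
  [Fintype Q] [Fintype X₁] [Fintype X₂] [Fintype X₃] [Fintype Y] [Fintype Y₃] [Fintype U]

/-- The joint law of `(Q, X₁, X₂, X₃, Y, Y₃, U)` for the channel `W` from `(x₁, x₂, x₃)` to the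
output `y` of one receiver and the output `y₃` of the relay. -/
def joint (D : CFLaw Q X₁ X₂ X₃ Y₃ U) (W : X₁ → X₂ → X₃ → Y × Y₃ → ℝ) :
    Q × X₁ × X₂ × X₃ × Y × Y₃ × U → ℝ :=
  fun (q, x₁, x₂, x₃, y, y₃, u) =>
    D.pQ q * (D.p₁ q x₁ * (D.p₂ q x₂ * (D.p₃ q x₃ * (W x₁ x₂ x₃ (y, y₃) * D.pU q x₃ y₃ u))))

variable (D : CFLaw Q X₁ X₂ X₃ Y₃ U) {W : X₁ → X₂ → X₃ → Y × Y₃ → ℝ}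

theorem wsum_joint (W : X₁ → X₂ → X₃ → Y × Y₃ → ℝ) (F : Q × X₁ × X₂ × X₃ × Y × Y₃ × U → ℝ) :
    wsum (D.joint W) F = wsum D.pQ fun q => wsum (D.p₁ q) fun x₁ => wsum (D.p₂ q) fun x₂ =>
      wsum (D.p₃ q) fun x₃ => wsum (W x₁ x₂ x₃) fun t => wsum (D.pU q x₃ t.2) fun u =>
        F (q, x₁, x₂, x₃, t.1, t.2, u) := by
  simp only [wsum, Fintype.sum_prod_type, joint, Finset.mul_sum, mul_assoc]

theorem joint_isPMF (hW : ∀ x₁ x₂ x₃, IsPMF (W x₁ x₂ x₃)) : IsPMF (D.joint W) where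
  nonneg := fun (q, x₁, x₂, x₃, y, y₃, u) =>
    mul_nonneg (D.hQ.nonneg _) (mul_nonneg ((D.h₁ _).nonneg _) (mul_nonneg ((D.h₂ _).nonneg _)
      (mul_nonneg ((D.h₃ _).nonneg _) (mul_nonneg ((hW _ _ _).nonneg _) ((D.hU _ _ _).nonneg _)))))
  sum_one := by
    have := D.wsum_joint W fun _ => 1
    simp only [(D.hU _ _ _).wsum_const, (hW _ _ _).wsum_const, (D.h₁ _).wsum_const,
      (D.h₂ _).wsum_const, (D.h₃ _).wsum_const, D.hQ.wsum_const] at this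
    simpa [wsum] using this

/-- The law `p(u|q,x₃)`. -/
noncomputable def pUX (W : X₁ → X₂ → X₃ → Y × Y₃ → ℝ) (q : Q) (x₃ : X₃) (u : U) : ℝ :=
  wsum (D.p₁ q) fun x₁ => wsum (D.p₂ q) fun x₂ => wsum (W x₁ x₂ x₃) fun t => D.pU q x₃ t.2 u

theorem wsum_pUX (W : X₁ → X₂ → X₃ → Y × Y₃ → ℝ) (q : Q) (x₃ : X₃) (f : U → ℝ) :
    wsum (D.pUX W q x₃) f = wsum (D.p₁ q) fun x₁ => wsum (D.p₂ q) fun x₂ =>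
      wsum (W x₁ x₂ x₃) fun t => wsum (D.pU q x₃ t.2) f := by
  have h : wsum (D.pUX W q x₃) f = ∑ u, f u * D.pUX W q x₃ u := by
    simp only [wsum, mul_comm]
  rw [h]
  simp only [pUX, ← wsum_const_mul, ← wsum_sum]
  simp only [wsum, mul_comm]

theorem pUX_isPMF (hW : ∀ x₁ x₂ x₃, IsPMF (W x₁ x₂ x₃)) (q : Q) (x₃ : X₃) :
    IsPMF (D.pUX W q x₃) where
  nonneg u := wsum_nonneg (D.h₁ _).nonneg fun _ => wsum_nonneg (D.h₂ _).nonneg fun _ =>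
    wsum_nonneg (hW _ _ _).nonneg fun _ => (D.hU _ _ _).nonneg _
  sum_one := by
    have := D.wsum_pUX W q x₃ fun _ => 1
    simp only [(D.hU _ _ _).wsum_const, (hW _ _ _).wsum_const, (D.h₁ _).wsum_const,
      (D.h₂ _).wsum_const] at this
    simpa [wsum] using this

section Coordinates

/-- The coordinates of the joint law. -/
abbrev cQ (ω : Q × X₁ × X₂ × X₃ × Y × Y₃ × U) : Q := ω.1
abbrev c₁ (ω : Q × X₁ × X₂ × X₃ × Y × Y₃ × U) : X₁ := ω.2.1
abbrev c₂ (ω : Q × X₁ × X₂ × X₃ × Y × Y₃ × U) : X₂ := ω.2.2.1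
abbrev c₃ (ω : Q × X₁ × X₂ × X₃ × Y × Y₃ × U) : X₃ := ω.2.2.2.1
abbrev cY (ω : Q × X₁ × X₂ × X₃ × Y × Y₃ × U) : Y := ω.2.2.2.2.1
abbrev cY₃ (ω : Q × X₁ × X₂ × X₃ × Y × Y₃ × U) : Y₃ := ω.2.2.2.2.2.1
abbrev cU (ω : Q × X₁ × X₂ × X₃ × Y × Y₃ × U) : U := ω.2.2.2.2.2.2

end Coordinates

section Marginals


theorem marginal_q (hW : ∀ x₁ x₂ x₃, IsPMF (W x₁ x₂ x₃)) (q : Q) : marginal (D.joint W) cQ q = D.pQ q := by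
  rw [marginal_eq_wsum, wsum_joint]
  simp only [cQ, (D.hU _ _ _).wsum_const, (hW _ _ _).wsum_const, (D.h₁ _).wsum_const,
      (D.h₂ _).wsum_const, (D.h₃ _).wsum_const, wsum_ind_eq]

theorem marginal_x₃q (hW : ∀ x₁ x₂ x₃, IsPMF (W x₁ x₂ x₃)) (x₃ : X₃) (q : Q) :
    marginal (D.joint W) (fun ω => (c₃ ω, cQ ω)) (x₃, q) = D.p₃ q x₃ * D.pQ q := by
  rw [marginal_eq_wsum, wsum_joint]
  simp only [cQ, c₁, c₂, c₃, cY, cY₃, cU, Prod.mk.injEq, ind_and]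
  simp only [cQ, (D.hU _ _ _).wsum_const, (hW _ _ _).wsum_const, (D.h₁ _).wsum_const,
      (D.h₂ _).wsum_const, wsum_const_mul', wsum_ind_eq]
  simp [wsum, ind, mul_comm]

theorem marginal_x₂x₃q (hW : ∀ x₁ x₂ x₃, IsPMF (W x₁ x₂ x₃)) (x₂ : X₂) (x₃ : X₃) (q : Q) :
    marginal (D.joint W) (fun ω => (c₂ ω, c₃ ω, cQ ω)) (x₂, x₃, q) =
      D.p₂ q x₂ * D.p₃ q x₃ * D.pQ q := by
  rw [marginal_eq_wsum, wsum_joint]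
  simp only [cQ, c₁, c₂, c₃, cY, cY₃, cU, Prod.mk.injEq, ind_and]
  simp only [cQ, (D.hU _ _ _).wsum_const, (hW _ _ _).wsum_const, (D.h₁ _).wsum_const,
      wsum_const_mul', wsum_const_mul, wsum_ind_eq]
  simp [wsum, ind]
  ring

theorem marginal_x₁x₃q (hW : ∀ x₁ x₂ x₃, IsPMF (W x₁ x₂ x₃)) (x₁ : X₁) (x₃ : X₃) (q : Q) :
    marginal (D.joint W) (fun ω => (c₁ ω, c₃ ω, cQ ω)) (x₁, x₃, q) =
      D.p₁ q x₁ * D.p₃ q x₃ * D.pQ q := by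
  rw [marginal_eq_wsum, wsum_joint]
  simp only [cQ, c₁, c₂, c₃, cY, cY₃, cU, Prod.mk.injEq, ind_and]
  simp only [(D.hU _ _ _).wsum_const, (hW _ _ _).wsum_const, (D.h₂ _).wsum_const,
      wsum_const_mul', wsum_const_mul, wsum_ind_eq]
  simp [wsum, ind]
  ring

theorem marginal_x₁x₂x₃q (hW : ∀ x₁ x₂ x₃, IsPMF (W x₁ x₂ x₃)) (x₁ : X₁) (x₂ : X₂) (x₃ : X₃) (q : Q) :
    marginal (D.joint W) (fun ω => (c₁ ω, c₂ ω, c₃ ω, cQ ω)) (x₁, x₂, x₃, q) =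
      D.p₁ q x₁ * D.p₂ q x₂ * D.p₃ q x₃ * D.pQ q := by
  rw [marginal_eq_wsum, wsum_joint]
  simp only [cQ, c₁, c₂, c₃, cY, cY₃, cU, Prod.mk.injEq, ind_and]
  simp only [(D.hU _ _ _).wsum_const, (hW _ _ _).wsum_const,
      wsum_const_mul', wsum_const_mul, wsum_ind_eq]
  simp [wsum, ind]
  ring

theorem marginal_x₂q (hW : ∀ x₁ x₂ x₃, IsPMF (W x₁ x₂ x₃)) (x₂ : X₂) (q : Q) :
    marginal (D.joint W) (fun ω => (c₂ ω, cQ ω)) (x₂, q) = D.p₂ q x₂ * D.pQ q := by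
  rw [marginal_eq_wsum, wsum_joint]
  simp only [cQ, c₁, c₂, c₃, cY, cY₃, cU, Prod.mk.injEq, ind_and]
  simp only [cQ, (D.hU _ _ _).wsum_const, (hW _ _ _).wsum_const, (D.h₁ _).wsum_const,
      (D.h₃ _).wsum_const, wsum_const_mul', wsum_const_mul, wsum_ind_eq]
  simp [wsum, ind]
  ring

theorem marginal_x₁q (hW : ∀ x₁ x₂ x₃, IsPMF (W x₁ x₂ x₃)) (x₁ : X₁) (q : Q) :
    marginal (D.joint W) (fun ω => (c₁ ω, cQ ω)) (x₁, q) = D.p₁ q x₁ * D.pQ q := by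
  rw [marginal_eq_wsum, wsum_joint]
  simp only [cQ, c₁, c₂, c₃, cY, cY₃, cU, Prod.mk.injEq, ind_and]
  simp only [(D.hU _ _ _).wsum_const, (hW _ _ _).wsum_const, (D.h₂ _).wsum_const,
      (D.h₃ _).wsum_const, wsum_const_mul', wsum_const_mul, wsum_ind_eq]
  simp [wsum, ind]
  ring

theorem marginal_x₁x₂q (hW : ∀ x₁ x₂ x₃, IsPMF (W x₁ x₂ x₃)) (x₁ : X₁) (x₂ : X₂) (q : Q) :
    marginal (D.joint W) (fun ω => (c₁ ω, c₂ ω, cQ ω)) (x₁, x₂, q) =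
      D.p₁ q x₁ * D.p₂ q x₂ * D.pQ q := by
  rw [marginal_eq_wsum, wsum_joint]
  simp only [cQ, c₁, c₂, c₃, cY, cY₃, cU, Prod.mk.injEq, ind_and]
  simp only [(D.hU _ _ _).wsum_const, (hW _ _ _).wsum_const,
      (D.h₃ _).wsum_const, wsum_const_mul', wsum_const_mul, wsum_ind_eq]
  simp [wsum, ind]
  ring

theorem marginal_ux₃q (u : U) (x₃ : X₃) (q : Q) :
    marginal (D.joint W) (fun ω => (cU ω, c₃ ω, cQ ω)) (u, x₃, q) =
      D.pUX W q x₃ u * (D.p₃ q x₃ * D.pQ q) := by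
  rw [marginal_eq_wsum, wsum_joint]
  simp only [cQ, c₁, c₂, c₃, cY, cY₃, cU, Prod.mk.injEq, ind_and]
  simp only [wsum_const_mul', wsum_ind_eq, ← mul_assoc, wsum_mul_ind, wsum_const_mul]
  rw [pUX]
  ring

end Marginals

end CFLaw

theorem wsum_rotate {A B C : Type*} [Fintype A] [Fintype B] [Fintype C] (P : A → ℝ)
    (Q : A → B → ℝ) (R : C → ℝ) (F : A → B → C → ℝ) :
    (wsum P fun a => wsum (Q a) fun b => wsum R fun c => F a b c) =
      wsum R fun c => wsum P fun a => wsum (Q a) fun b => F a b c :=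
  (wsum_congr fun a => wsum_comm (Q a) R (F a)).trans
    (wsum_comm P R fun a c => wsum (Q a) fun b => F a b c)

theorem missProb_eq_wsum {Ω A B C : Type*} [Fintype Ω] [Fintype A] [Fintype B] [Fintype C]
    (p : Ω → ℝ) (X : Ω → A) (Y : Ω → B) (Z : Ω → C) (γ : ℝ) :
    missProb p X Y Z γ = wsum p fun ω => ind (¬InfoDense p X Y Z γ (X ω) (Y ω) (Z ω)) := by
  unfold missProb wsum
  refine Finset.sum_congr rfl fun ω _ => ?_
  by_cases h : InfoDense p X Y Z γ (X ω) (Y ω) (Z ω) <;> simp [h, ind]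

theorem denseProb_eq_wsum {Ω A B C : Type*} [Fintype Ω] [Fintype A] [Fintype B] [Fintype C]
    (p : Ω → ℝ) (X : Ω → A) (Y : Ω → B) (Z : Ω → C) (γ : ℝ) :
    denseProb p X Y Z γ = wsum p fun ω => ind (InfoDense p X Y Z γ (X ω) (Y ω) (Z ω)) := by
  unfold denseProb wsum
  refine Finset.sum_congr rfl fun ω _ => ?_
  by_cases h : InfoDense p X Y Z γ (X ω) (Y ω) (Z ω) <;> simp [h, ind]

theorem wsum_dense_le {Ω A B C : Type*} [Fintype Ω] [Fintype A] [Fintype B] [Fintype C]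
    {p : Ω → ℝ} (hp : IsPMF p) {X : Ω → A} {Y : Ω → B} {Z : Ω → C} {γ : ℝ}
    (hγ : 0 < γ) {g : C → A → ℝ}
    (hg : ∀ a c, marginal p (fun ω => (X ω, Z ω)) (a, c) = g c a * marginal p Z c) :
    wsum p (fun ω => wsum (g (Z ω)) fun a => ind (InfoDense p X Y Z γ a (Y ω) (Z ω))) ≤ 1 / γ :=
  sum_dense_le hp hγ (g := fun a c => g c a) hg

/-! ### Random codebooks of one block and the decoding tests -/

/-- Codebooks for one block: a time-sharing sequence, codebooks for the two transmitters, and for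
each relay message a relay codeword, a compression codebook and a choice of the compression
index. -/
abbrev BlockCodebook (Q X₁ X₂ X₃ Y₃ U K₁ K₂ S K : Type*) :=
  Q × (K₁ → X₁) × (K₂ → X₂) × (S → X₃ × (K → U) × (Y₃ → K))

namespace CFLaw

variable {Q X₁ X₂ X₃ Y Y₃ U K₁ K₂ S V K : Type*}
  [Fintype Q] [Fintype X₁] [Fintype X₂] [Fintype X₃] [Fintype Y] [Fintype Y₃] [Fintype U]
  [Fintype K₁] [Fintype K₂] [Fintype S] [Fintype V] [Fintype K]
  [DecidableEq Y₃] [DecidableEq K₁] [DecidableEq K₂] [DecidableEq S] [DecidableEq V]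
  [DecidableEq K] [Nonempty K]
  (D : CFLaw Q X₁ X₂ X₃ Y₃ U) {W : X₁ → X₂ → X₃ → Y × Y₃ → ℝ}

/-- The weights of the random codebook of the relay for one of its messages. -/
noncomputable def relayW (P : Q → X₃ → U → ℝ) (q : Q) : X₃ × (K → U) × (Y₃ → K) → ℝ :=
  fun e => D.p₃ q e.1 * (piW (fun _ : K => P q e.1) e.2.1 *
    -- The random choice of the index is drawn in advance for every possible relay output. It thus
    -- belongs to the codebook, and a fixed codebook gives a deterministic relay.
    piW (fun y₃ => likelihoodW (P q e.1) (D.pU q e.1 y₃) e.2.1) e.2.2)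

/-- The weights of the random codebook of a block. -/
noncomputable def codebookW (P : Q → X₃ → U → ℝ) :
    BlockCodebook Q X₁ X₂ X₃ Y₃ U K₁ K₂ S K → ℝ :=
  fun ω => D.pQ ω.1 * (piW (fun _ : K₁ => D.p₁ ω.1) ω.2.1 * (piW (fun _ : K₂ => D.p₂ ω.1) ω.2.2.1 *
    piW (fun _ : S => D.relayW P ω.1) ω.2.2.2))

theorem wsum_relayW (P : Q → X₃ → U → ℝ) (q : Q) (F : X₃ × (K → U) × (Y₃ → K) → ℝ) :
    wsum (D.relayW P q) F = wsum (D.p₃ q) fun x₃ => wsum (piW fun _ : K => P q x₃) fun c =>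
      wsum (piW fun y₃ => likelihoodW (P q x₃) (D.pU q x₃ y₃) c) fun κ => F (x₃, c, κ) := by
  simp only [wsum, Fintype.sum_prod_type, relayW, Finset.mul_sum, mul_assoc]

theorem wsum_codebookW (P : Q → X₃ → U → ℝ) (F : BlockCodebook Q X₁ X₂ X₃ Y₃ U K₁ K₂ S K → ℝ) :
    wsum (D.codebookW P) F = wsum D.pQ fun q => wsum (piW fun _ : K₁ => D.p₁ q) fun c₁ =>
      wsum (piW fun _ : K₂ => D.p₂ q) fun c₂ => wsum (piW fun _ : S => D.relayW P q) fun c₃ =>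
        F (q, c₁, c₂, c₃) := by
  simp only [wsum, Fintype.sum_prod_type, codebookW, Finset.mul_sum, mul_assoc]

theorem relayW_isPMF {P : Q → X₃ → U → ℝ} (hP : ∀ q x₃, IsPMF (P q x₃)) (q : Q) :
    IsPMF (D.relayW (K := K) P q) where
  nonneg e := mul_nonneg ((D.h₃ q).nonneg _) (mul_nonneg ((IsPMF.piW fun _ => hP _ _).nonneg _)
    ((IsPMF.piW fun _ => likelihoodW_isPMF (hP _ _) (D.hU _ _ _) _).nonneg _))
  sum_one := by
    have := D.wsum_relayW (K := K) P q fun _ => 1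
    have h1 (x₃ : X₃) (c : K → U) := IsPMF.piW fun y₃ =>
      likelihoodW_isPMF (hP q x₃) (D.hU q x₃ y₃) c
    have h2 (x₃ : X₃) := IsPMF.piW fun _ : K => hP q x₃
    simp only [(h1 _ _).wsum_const, (h2 _).wsum_const, (D.h₃ _).wsum_const] at this
    simpa [wsum] using this

theorem codebookW_isPMF {P : Q → X₃ → U → ℝ} (hP : ∀ q x₃, IsPMF (P q x₃)) :
    IsPMF (D.codebookW (K₁ := K₁) (K₂ := K₂) (S := S) (K := K) P) where
  nonneg ω := mul_nonneg (D.hQ.nonneg _) (mul_nonneg ((IsPMF.piW fun _ => D.h₁ _).nonneg _)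
    (mul_nonneg ((IsPMF.piW fun _ => D.h₂ _).nonneg _)
      ((IsPMF.piW fun _ => D.relayW_isPMF hP _).nonneg _)))
  sum_one := by
    have := D.wsum_codebookW (K₁ := K₁) (K₂ := K₂) (S := S) (K := K) P fun _ => 1
    have h1 (q : Q) := IsPMF.piW fun _ : K₁ => D.h₁ q
    have h2 (q : Q) := IsPMF.piW fun _ : K₂ => D.h₂ q
    have h3 (q : Q) := IsPMF.piW fun _ : S => D.relayW_isPMF (K := K) hP q
    simp only [(h1 _).wsum_const, (h2 _).wsum_const, (h3 _).wsum_const, D.hQ.wsum_const] at this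
    simpa [wsum] using this

theorem wsum_relayW_fst {P : Q → X₃ → U → ℝ} (hP : ∀ q x₃, IsPMF (P q x₃)) (q : Q) (f : X₃ → ℝ) :
    wsum (D.relayW (K := K) P q) (fun e => f e.1) = wsum (D.p₃ q) f := by
  rw [wsum_relayW]
  have h1 (x₃ : X₃) (c : K → U) := IsPMF.piW fun y₃ =>
    likelihoodW_isPMF (hP q x₃) (D.hU q x₃ y₃) c
  have h2 (x₃ : X₃) := IsPMF.piW fun _ : K => hP q x₃
  simp only [(h1 _ _).wsum_const, (h2 _).wsum_const]

section Tests

/-- The relay codeword `x₃` passes the test of the receiver. -/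
def RelayTest (W : X₁ → X₂ → X₃ → Y × Y₃ → ℝ) (γ : ℝ) (q : Q) (x₃ : X₃) (y : Y) : Prop :=
  InfoDense (D.joint W) c₃ cY cQ γ x₃ y q

/-- The compression codeword `u` passes the test of the receiver. -/
def CompressionTest (W : X₁ → X₂ → X₃ → Y × Y₃ → ℝ) (γ : ℝ) (q : Q) (x₃ : X₃) (y : Y) (u : U) :
    Prop :=
  InfoDense (D.joint W) cU cY (fun ω => (c₃ ω, cQ ω)) γ u y (x₃, q)

/-- The test for the message of the first transmitter. -/
def TestA (W : X₁ → X₂ → X₃ → Y × Y₃ → ℝ) (γ : ℝ) (q : Q) (x₃ : X₃) (x₁ : X₁) (x₂ : X₂)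
    (o : Y × U) : Prop :=
  InfoDense (D.joint W) c₁ (fun ω => (cY ω, cU ω)) (fun ω => (c₂ ω, c₃ ω, cQ ω)) γ x₁ o (x₂, x₃, q)

/-- The test for the message of the second transmitter. -/
def TestB (W : X₁ → X₂ → X₃ → Y × Y₃ → ℝ) (γ : ℝ) (q : Q) (x₃ : X₃) (x₁ : X₁) (x₂ : X₂)
    (o : Y × U) : Prop :=
  InfoDense (D.joint W) c₂ (fun ω => (cY ω, cU ω)) (fun ω => (c₁ ω, c₃ ω, cQ ω)) γ x₂ o (x₁, x₃, q)

/-- The test for the messages of both transmitters. -/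
def TestC (W : X₁ → X₂ → X₃ → Y × Y₃ → ℝ) (γ : ℝ) (q : Q) (x₃ : X₃) (x₁ : X₁) (x₂ : X₂)
    (o : Y × U) : Prop :=
  InfoDense (D.joint W) (fun ω => (c₁ ω, c₂ ω)) (fun ω => (cY ω, cU ω)) (fun ω => (c₃ ω, cQ ω)) γ
    (x₁, x₂) o (x₃, q)

end Tests

/-- Given the time sharing, a fresh relay codeword is independent of the receiver's output, so the
change of measure in `wsum_dense_le` applies. The following bounds for the other four tests have the
same reason. -/
theorem relay_false_le (hW : ∀ x₁ x₂ x₃, IsPMF (W x₁ x₂ x₃)) {γ : ℝ} (hγ : 0 < γ) :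
    wsum D.pQ (fun q => wsum (D.p₁ q) fun x₁ => wsum (D.p₂ q) fun x₂ => wsum (D.p₃ q) fun x₃ =>
      wsum (D.p₃ q) fun x₃' => wsum (W x₁ x₂ x₃) fun t => ind (D.RelayTest W γ q x₃' t.1)) ≤
      1 / γ := by
  have h := wsum_dense_le (D.joint_isPMF hW) (X := c₃) (Y := cY) (Z := cQ) hγ (g := D.p₃)
    fun x₃ q => by rw [D.marginal_x₃q hW, D.marginal_q hW]
  refine le_trans (le_of_eq ?_) h
  rw [wsum_joint]
  simp only [cQ, cY, (D.hU _ _ _).wsum_const, RelayTest]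
  refine wsum_congr fun q => wsum_congr fun x₁ => wsum_congr fun x₂ => wsum_congr fun x₃ => ?_
  rw [wsum_comm]

theorem compression_false_le (hW : ∀ x₁ x₂ x₃, IsPMF (W x₁ x₂ x₃)) {γ : ℝ} (hγ : 0 < γ) :
    wsum (D.joint W) (fun ω => wsum (D.pUX W (cQ ω) (c₃ ω)) fun u =>
      ind (D.CompressionTest W γ (cQ ω) (c₃ ω) (cY ω) u)) ≤ 1 / γ :=
  wsum_dense_le (D.joint_isPMF hW) (X := cU) (Y := cY) (Z := fun ω => (c₃ ω, cQ ω)) hγ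
    (g := fun t => D.pUX W t.2 t.1) fun u t => by
      rw [D.marginal_ux₃q, D.marginal_x₃q hW]

theorem testA_false_le (hW : ∀ x₁ x₂ x₃, IsPMF (W x₁ x₂ x₃)) {γ : ℝ} (hγ : 0 < γ) :
    wsum (D.joint W) (fun ω => wsum (D.p₁ (cQ ω)) fun x₁ =>
      ind (D.TestA W γ (cQ ω) (c₃ ω) x₁ (c₂ ω) (cY ω, cU ω))) ≤ 1 / γ :=
  wsum_dense_le (D.joint_isPMF hW) (X := c₁) (Y := fun ω => (cY ω, cU ω))
    (Z := fun ω => (c₂ ω, c₃ ω, cQ ω)) hγ (g := fun t => D.p₁ t.2.2) fun x t => by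
      rw [D.marginal_x₁x₂x₃q hW, D.marginal_x₂x₃q hW]; ring

theorem testB_false_le (hW : ∀ x₁ x₂ x₃, IsPMF (W x₁ x₂ x₃)) {γ : ℝ} (hγ : 0 < γ) :
    wsum (D.joint W) (fun ω => wsum (D.p₂ (cQ ω)) fun x₂ =>
      ind (D.TestB W γ (cQ ω) (c₃ ω) (c₁ ω) x₂ (cY ω, cU ω))) ≤ 1 / γ :=
  wsum_dense_le (D.joint_isPMF hW) (X := c₂) (Y := fun ω => (cY ω, cU ω))
    (Z := fun ω => (c₁ ω, c₃ ω, cQ ω)) hγ (g := fun t => D.p₂ t.2.2) fun x t => by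
      rw [marginal_congr_val (Y := fun ω => (c₁ ω, c₂ ω, c₃ ω, cQ ω)) (b := (t.1, x, t.2)) (D.joint W)
        (fun ω => by simp only [Prod.ext_iff]; tauto), D.marginal_x₁x₂x₃q hW, D.marginal_x₁x₃q hW]
      ring

theorem testC_false_le (hW : ∀ x₁ x₂ x₃, IsPMF (W x₁ x₂ x₃)) {γ : ℝ} (hγ : 0 < γ) :
    wsum (D.joint W) (fun ω => wsum (D.p₁ (cQ ω)) fun x₁ => wsum (D.p₂ (cQ ω)) fun x₂ =>
      ind (D.TestC W γ (cQ ω) (c₃ ω) x₁ x₂ (cY ω, cU ω))) ≤ 1 / γ := by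
  have h := wsum_dense_le (D.joint_isPMF hW) (X := fun ω => (c₁ ω, c₂ ω))
    (Y := fun ω => (cY ω, cU ω)) (Z := fun ω => (c₃ ω, cQ ω)) hγ
    (g := fun t x => D.p₁ t.2 x.1 * D.p₂ t.2 x.2) fun x t => by
      rw [marginal_congr_val (Y := fun ω => (c₁ ω, c₂ ω, c₃ ω, cQ ω)) (b := (x.1, x.2, t)) (D.joint W)
        (fun ω => by simp only [Prod.ext_iff]; tauto), D.marginal_x₁x₂x₃q hW, D.marginal_x₃q hW]
      ring
  refine le_trans (le_of_eq (wsum_congr fun ω => ?_)) h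
  simp only [wsum, Fintype.sum_prod_type, Finset.mul_sum, mul_assoc, TestC]

/-- The compressed output is drawn from `(q, x₃, y₃)` alone. -/
theorem marginal_y₃ux₃q (W : X₁ → X₂ → X₃ → Y × Y₃ → ℝ) (y₃ : Y₃) (u : U) (x₃ : X₃) (q : Q) :
    marginal (D.joint W) (fun ω => (cY₃ ω, cU ω, c₃ ω, cQ ω)) (y₃, u, x₃, q) =
      D.pU q x₃ y₃ u * marginal (D.joint W) (fun ω => (cY₃ ω, c₃ ω, cQ ω)) (y₃, x₃, q) := by
  rw [marginal_eq_wsum, wsum_joint, marginal_eq_wsum, wsum_joint]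
  simp only [← wsum_const_mul]
  refine wsum_congr fun q' => wsum_congr fun x₁ => wsum_congr fun x₂ => wsum_congr fun x₃' =>
    wsum_congr fun t => ?_
  simp only [cQ, c₁, c₂, c₃, cY, cY₃, cU, Prod.mk.injEq, (D.hU _ _ _).wsum_const]
  by_cases h : t.2 = y₃ ∧ x₃' = x₃ ∧ q' = q
  · obtain ⟨h1, h2, h3⟩ := h
    simp [h1, h2, h3, wsum_ind_eq, ind_true]
  · rw [ind_false h, mul_zero]
    refine Finset.sum_eq_zero fun u' _ => ?_
    beta_reduce
    rw [ind_false (by tauto), mul_zero]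

/-- The likelihood ratio `p(u|q,x₃,y₃) / p(u|q,x₃)` used by the encoder is the density ratio of
`(Y₃, U)` given `(X₃, Q)`. The tail term of soft covering is therefore a density probability,
controlled by the law of large numbers. -/
theorem covering_le (hW : ∀ x₁ x₂ x₃, IsPMF (W x₁ x₂ x₃)) (γ : ℝ) :
    wsum (D.joint W) (fun ω =>
      ind (γ * D.pUX W (cQ ω) (c₃ ω) (cU ω) < D.pU (cQ ω) (c₃ ω) (cY₃ ω) (cU ω))) ≤
      denseProb (D.joint W) cY₃ cU (fun ω => (c₃ ω, cQ ω)) γ := by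
  have hJ := D.joint_isPMF hW
  rw [denseProb_eq_wsum]
  refine Finset.sum_le_sum fun ω _ => ?_
  rcases (hJ.nonneg ω).eq_or_lt with h0 | h0
  · simp [← h0]
  refine mul_le_mul_of_nonneg_left (ind_mono fun h => ?_) h0.le
  have h1 := h0.trans_le (le_marginal hJ.nonneg (fun ω => (cY₃ ω, c₃ ω, cQ ω)) ω)
  have h2 := h0.trans_le (le_marginal hJ.nonneg (fun ω => (c₃ ω, cQ ω)) ω)
  unfold InfoDense
  rw [D.marginal_y₃ux₃q, D.marginal_ux₃q, ← D.marginal_x₃q hW]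
  have := mul_lt_mul_of_pos_right h (mul_pos h1 h2)
  linarith

variable [Nonempty K₁] [Nonempty K₂]

/-- The chance that a receiver that knows the time-sharing, relay and compression codewords fails
to decode the messages of the transmitters. -/
theorem mac_error_le (hW : ∀ x₁ x₂ x₃, IsPMF (W x₁ x₂ x₃)) {γa γb γc : ℝ} (hγa : 0 < γa)
    (hγb : 0 < γb) (hγc : 0 < γc) (w₁ : K₁) (w₂ : K₂) :
    (wsum D.pQ fun q => wsum (piW fun _ : K₁ => D.p₁ q) fun c₁ =>
      wsum (piW fun _ : K₂ => D.p₂ q) fun c₂ => wsum (D.p₃ q) fun x₃ =>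
      wsum (W (c₁ w₁) (c₂ w₂) x₃) fun t => wsum (D.pU q x₃ t.2) fun u =>
        ind (Classical.epsilon (MacTest (D.TestA W γa q x₃) (D.TestB W γb q x₃)
          (D.TestC W γc q x₃) c₁ c₂ (t.1, u)) ≠ (w₁, w₂))) ≤
      missProb (D.joint W) c₁ (fun ω => (cY ω, cU ω)) (fun ω => (c₂ ω, c₃ ω, cQ ω)) γa +
      missProb (D.joint W) c₂ (fun ω => (cY ω, cU ω)) (fun ω => (c₁ ω, c₃ ω, cQ ω)) γb +
      missProb (D.joint W) (fun ω => (c₁ ω, c₂ ω)) (fun ω => (cY ω, cU ω))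
        (fun ω => (c₃ ω, cQ ω)) γc +
      (Fintype.card K₁ - 1 : ℝ) / γa + (Fintype.card K₂ - 1 : ℝ) / γb +
      (Fintype.card K₁ - 1 : ℝ) * (Fintype.card K₂ - 1 : ℝ) / γc := by
  have hk₁ : (0 : ℝ) ≤ Fintype.card K₁ - 1 :=
    sub_nonneg.2 (by exact_mod_cast Fintype.card_pos)
  have hk₂ : (0 : ℝ) ≤ Fintype.card K₂ - 1 :=
    sub_nonneg.2 (by exact_mod_cast Fintype.card_pos)
  -- With the relay output summed out, `(y, u)` is the output of a multiple access channel for fixed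
  -- `q` and `x₃`.
  set T : Q → X₃ → X₁ → X₂ → Y × U → ℝ := fun q x₃ x₁ x₂ o =>
    ∑ y₃, W x₁ x₂ x₃ (o.1, y₃) * D.pU q x₃ y₃ o.2 with hT
  have hT0 (q x₃ x₁ x₂ o) : 0 ≤ T q x₃ x₁ x₂ o :=
    Finset.sum_nonneg fun y₃ _ => mul_nonneg ((hW _ _ _).nonneg _) ((D.hU _ _ _).nonneg _)
  have hTsum (q x₃ x₁ x₂) (f : Y × U → ℝ) : (wsum (W x₁ x₂ x₃) fun t =>
      wsum (D.pU q x₃ t.2) fun u => f (t.1, u)) = wsum (T q x₃ x₁ x₂) f := by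
    simp only [wsum, Fintype.sum_prod_type, hT, Finset.sum_mul, Finset.mul_sum]
    refine Finset.sum_congr rfl fun y _ => ?_
    rw [Finset.sum_comm]
    exact Finset.sum_congr rfl fun y _ => Finset.sum_congr rfl fun y _ => by ring
  have hstep : (wsum D.pQ fun q => wsum (piW fun _ : K₁ => D.p₁ q) fun c₁ =>
      wsum (piW fun _ : K₂ => D.p₂ q) fun c₂ => wsum (D.p₃ q) fun x₃ =>
      wsum (W (c₁ w₁) (c₂ w₂) x₃) fun t => wsum (D.pU q x₃ t.2) fun u =>
        ind (Classical.epsilon (MacTest (D.TestA W γa q x₃) (D.TestB W γb q x₃)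
          (D.TestC W γc q x₃) c₁ c₂ (t.1, u)) ≠ (w₁, w₂))) ≤
      wsum (D.joint W) fun ω =>
        ind (¬(D.TestA W γa (cQ ω) (c₃ ω) (c₁ ω) (c₂ ω) (cY ω, cU ω) ∧
          D.TestB W γb (cQ ω) (c₃ ω) (c₁ ω) (c₂ ω) (cY ω, cU ω) ∧
          D.TestC W γc (cQ ω) (c₃ ω) (c₁ ω) (c₂ ω) (cY ω, cU ω))) +
        (Fintype.card K₁ - 1 : ℝ) * wsum (D.p₁ (cQ ω)) (fun x₁ =>
          ind (D.TestA W γa (cQ ω) (c₃ ω) x₁ (c₂ ω) (cY ω, cU ω))) +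
        (Fintype.card K₂ - 1 : ℝ) * wsum (D.p₂ (cQ ω)) (fun x₂ =>
          ind (D.TestB W γb (cQ ω) (c₃ ω) (c₁ ω) x₂ (cY ω, cU ω))) +
        (Fintype.card K₁ - 1 : ℝ) * (Fintype.card K₂ - 1 : ℝ) *
          wsum (D.p₁ (cQ ω)) (fun x₁ => wsum (D.p₂ (cQ ω)) fun x₂ =>
            ind (D.TestC W γc (cQ ω) (c₃ ω) x₁ x₂ (cY ω, cU ω))) := by
    rw [wsum_joint]
    refine D.hQ.mono fun q => ?_
    rw [wsum_rotate (piW fun _ : K₁ => D.p₁ q) (fun _ => piW fun _ : K₂ => D.p₂ q) (D.p₃ q),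
      wsum_rotate (D.p₁ q) (fun _ => D.p₂ q) (D.p₃ q)]
    refine (D.h₃ q).mono fun x₃ => ?_
    simp only [cQ, CFLaw.c₁, CFLaw.c₂, c₃, cY, cU]
    have e (c₁ : K₁ → X₁) (c₂ : K₂ → X₂) := hTsum q x₃ (c₁ w₁) (c₂ w₂) fun o =>
      ind (Classical.epsilon (MacTest (D.TestA W γa q x₃) (D.TestB W γb q x₃)
          (D.TestC W γc q x₃) c₁ c₂ o) ≠ (w₁, w₂))
    simp only [e]
    refine (mac_random_coding (D.h₁ q) (D.h₂ q) (hT0 q x₃) (D.TestA W γa q x₃)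
      (D.TestB W γb q x₃) (D.TestC W γc q x₃) w₁ w₂).trans (le_of_eq ?_)
    refine wsum_congr fun x₁ => wsum_congr fun x₂ => ?_
    rw [← hTsum]
  refine hstep.trans ?_
  simp only [wsum_add, wsum_const_mul]
  have hJ := D.joint_isPMF hW
  have h0 : (wsum (D.joint W) fun ω =>
        ind (¬(D.TestA W γa (cQ ω) (c₃ ω) (c₁ ω) (c₂ ω) (cY ω, cU ω) ∧
          D.TestB W γb (cQ ω) (c₃ ω) (c₁ ω) (c₂ ω) (cY ω, cU ω) ∧
          D.TestC W γc (cQ ω) (c₃ ω) (c₁ ω) (c₂ ω) (cY ω, cU ω)))) ≤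
      missProb (D.joint W) c₁ (fun ω => (cY ω, cU ω)) (fun ω => (c₂ ω, c₃ ω, cQ ω)) γa +
      missProb (D.joint W) c₂ (fun ω => (cY ω, cU ω)) (fun ω => (c₁ ω, c₃ ω, cQ ω)) γb +
      missProb (D.joint W) (fun ω => (c₁ ω, c₂ ω)) (fun ω => (cY ω, cU ω))
        (fun ω => (c₃ ω, cQ ω)) γc := by
    simp only [missProb_eq_wsum, ← wsum_add]
    refine hJ.mono fun ω => ?_
    simp only [not_and_or]
    refine (ind_or_le _ _).trans ?_
    rw [add_assoc]
    exact add_le_add le_rfl (ind_or_le _ _)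
  have ha := mul_le_mul_of_nonneg_left (D.testA_false_le hW hγa) hk₁
  have hb := mul_le_mul_of_nonneg_left (D.testB_false_le hW hγb) hk₂
  have hc := mul_le_mul_of_nonneg_left (D.testC_false_le hW hγc) (mul_nonneg hk₁ hk₂)
  rw [mul_one_div] at ha hb hc
  linarith

end CFLaw

/-! ### One block at a receiver that uses the relay -/

namespace CFLaw

variable {Q X₁ X₂ X₃ Y Y₃ U K₁ K₂ S V K : Type*}
  [Fintype Q] [Fintype X₁] [Fintype X₂] [Fintype X₃] [Fintype Y] [Fintype Y₃] [Fintype U]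
  [Fintype K₁] [Fintype K₂] [Fintype S] [Fintype V] [Fintype K]
  [DecidableEq Y₃] [DecidableEq K₁] [DecidableEq K₂] [DecidableEq S] [DecidableEq V]
  [DecidableEq K] [Nonempty K] [Nonempty K₁] [Nonempty K₂] [Nonempty V]
  (D : CFLaw Q X₁ X₂ X₃ Y₃ U) {W : X₁ → X₂ → X₃ → Y × Y₃ → ℝ}

/-- The receiver's choice of the relay message, given the list of the possible compression
indices of the previous block. -/
noncomputable def decodeRelay (W : X₁ → X₂ → X₃ → Y × Y₃ → ℝ) (γ : ℝ)
    (ω : BlockCodebook Q X₁ X₂ X₃ Y₃ U K₁ K₂ (V × K) K) (l : Finset K) (y : Y) : V × K :=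
  Classical.epsilon fun s : V × K => s.2 ∈ l ∧ D.RelayTest W γ ω.1 (ω.2.2.2 s).1 y

/-- The receiver's list of the possible compression indices. -/
noncomputable def compressionList (W : X₁ → X₂ → X₃ → Y × Y₃ → ℝ) (γ : ℝ)
    (ω : BlockCodebook Q X₁ X₂ X₃ Y₃ U K₁ K₂ S K) (s : S) (y : Y) : Finset K :=
  Finset.univ.filter fun k =>
    D.CompressionTest W γ ω.1 (ω.2.2.2 s).1 y ((ω.2.2.2 s).2.1 k)

/-- The receiver's choice of the messages of the transmitters. -/
noncomputable def decodePair (W : X₁ → X₂ → X₃ → Y × Y₃ → ℝ) (γa γb γc : ℝ)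
    (ω : BlockCodebook Q X₁ X₂ X₃ Y₃ U K₁ K₂ S K) (s : S) (k : K) (y : Y) : K₁ × K₂ :=
  Classical.epsilon (MacTest (D.TestA W γa ω.1 (ω.2.2.2 s).1) (D.TestB W γb ω.1 (ω.2.2.2 s).1)
    (D.TestC W γc ω.1 (ω.2.2.2 s).1) ω.2.1 ω.2.2.1 (y, (ω.2.2.2 s).2.1 k))

/-- For `s ≠ s'` the tested relay codeword is independent of the one sent, and the compression
codebooks and choices integrate out. -/
theorem relay_union_le (hW : ∀ x₁ x₂ x₃, IsPMF (W x₁ x₂ x₃)) {γ : ℝ} (hγ : 0 < γ)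
    (w₁ : K₁) (w₂ : K₂) {s s' : S} (hs : s ≠ s') :
    wsum (D.codebookW (D.pUX W)) (fun ω : BlockCodebook Q X₁ X₂ X₃ Y₃ U K₁ K₂ S K =>
      wsum (W (ω.2.1 w₁) (ω.2.2.1 w₂) (ω.2.2.2 s).1) fun t =>
        ind (D.RelayTest W γ ω.1 (ω.2.2.2 s').1 t.1)) ≤ 1 / γ := by
  have hP := D.pUX_isPMF hW
  refine le_trans (le_of_eq ?_) (D.relay_false_le hW hγ)
  rw [wsum_codebookW]
  refine wsum_congr fun q => ?_
  rw [← wsum_piW_one (fun _ => D.h₁ q) w₁]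
  refine wsum_congr fun c₁ => ?_
  rw [← wsum_piW_one (fun _ => D.h₂ q) w₂]
  refine wsum_congr fun c₂ => ?_
  rw [wsum_piW_two (fun _ : S => D.relayW_isPMF hP q) hs fun e e' =>
    wsum (W (c₁ w₁) (c₂ w₂) e.1) fun t => ind (D.RelayTest W γ q e'.1 t.1)]
  rw [← D.wsum_relayW_fst (K := K) hP]
  refine wsum_congr fun e => ?_
  rw [← D.wsum_relayW_fst (K := K) hP]

/-- One block of compress-and-forward with random codebooks, for a receiver that uses the
relay. -/
theorem relay_receiver (hW : ∀ x₁ x₂ x₃, IsPMF (W x₁ x₂ x₃))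
    {γ₀ γ₁ γ₂ γa γb γc : ℝ} (hγ₀ : 0 < γ₀) (hγ₁ : 0 < γ₁) (hγ₂ : 0 < γ₂) (hγa : 0 < γa)
    (hγb : 0 < γb) (hγc : 0 < γc) {l₀ : ℕ} (hl₀ : 0 < l₀) (w₁ : K₁) (w₂ : K₂) (s : V × K)
    {l : Finset K} (hsl : s.2 ∈ l) (hl : l.card ≤ l₀) :
    wsum (D.codebookW (D.pUX W)) (fun ω : BlockCodebook Q X₁ X₂ X₃ Y₃ U K₁ K₂ (V × K) K =>
      wsum (W (ω.2.1 w₁) (ω.2.2.1 w₂) (ω.2.2.2 s).1) fun t =>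
        ind (D.decodeRelay W γ₁ ω l t.1 ≠ s ∨
          (ω.2.2.2 s).2.2 t.2 ∉ D.compressionList W γ₂ ω s t.1 ∨
          l₀ < (D.compressionList W γ₂ ω s t.1).card ∨
          D.decodePair W γa γb γc ω s ((ω.2.2.2 s).2.2 t.2) t.1 ≠ (w₁, w₂))) ≤
      missProb (D.joint W) c₃ cY cQ γ₁ +
      missProb (D.joint W) cU cY (fun ω => (c₃ ω, cQ ω)) γ₂ +
      (missProb (D.joint W) c₁ (fun ω => (cY ω, cU ω)) (fun ω => (c₂ ω, c₃ ω, cQ ω)) γa +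
      missProb (D.joint W) c₂ (fun ω => (cY ω, cU ω)) (fun ω => (c₁ ω, c₃ ω, cQ ω)) γb +
      missProb (D.joint W) (fun ω => (c₁ ω, c₂ ω)) (fun ω => (cY ω, cU ω))
        (fun ω => (c₃ ω, cQ ω)) γc +
      (Fintype.card K₁ - 1 : ℝ) / γa + (Fintype.card K₂ - 1 : ℝ) / γb +
      (Fintype.card K₁ - 1 : ℝ) * (Fintype.card K₂ - 1 : ℝ) / γc) +
      (denseProb (D.joint W) cY₃ cU (fun ω => (c₃ ω, cQ ω)) γ₀ + √(γ₀ / Fintype.card K)) +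
      Fintype.card V * l₀ / γ₁ + Fintype.card K / (l₀ * γ₂) := by
  have hP := D.pUX_isPMF hW
  have hJ := D.joint_isPMF hW
  have hl₀' : (0 : ℝ) < l₀ := by exact_mod_cast hl₀
  -- the error event, apart from false relay codewords
  set F : Q → (K₁ → X₁) → (K₂ → X₂) → X₃ → Y → (K → U) → K → ℝ := fun q c₁ c₂ x₃ y c k =>
    ind (¬D.RelayTest W γ₁ q x₃ y ∨ ¬D.CompressionTest W γ₂ q x₃ y (c k) ∨
      Classical.epsilon (MacTest (D.TestA W γa q x₃) (D.TestB W γb q x₃)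
          (D.TestC W γc q x₃) c₁ c₂ (y, c k)) ≠ (w₁, w₂) ∨
      l₀ ≤ ((Finset.univ.erase k).filter fun k' => D.CompressionTest W γ₂ q x₃ y (c k')).card)
    with hF
  set A : Q → (K₁ → X₁) → (K₂ → X₂) → X₃ → Y → U → ℝ := fun q c₁ c₂ x₃ y u =>
    ind (¬D.RelayTest W γ₁ q x₃ y) + ind (¬D.CompressionTest W γ₂ q x₃ y u) +
      ind (Classical.epsilon (MacTest (D.TestA W γa q x₃) (D.TestB W γb q x₃)
          (D.TestC W γc q x₃) c₁ c₂ (y, u)) ≠ (w₁, w₂)) with hA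
  -- Markov's inequality: the event that the list holds `l₀` false indices is charged `1 / l₀` for
  -- each of them.
  set b : Q → X₃ → Y → U → ℝ := fun q x₃ y u =>
    (1 / l₀ : ℝ) * ind (D.CompressionTest W γ₂ q x₃ y u) with hb
  have hA0 (q c₁ c₂ x₃ y u) : 0 ≤ A q c₁ c₂ x₃ y u :=
    add_nonneg (add_nonneg (ind_nonneg _) (ind_nonneg _)) (ind_nonneg _)
  have hb0 (q x₃ y u) : 0 ≤ b q x₃ y u := mul_nonneg (by positivity) (ind_nonneg _)
  have hFAb (q c₁ c₂ x₃ y c k) : F q c₁ c₂ x₃ y c k ≤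
      A q c₁ c₂ x₃ y (c k) + ∑ k' ∈ Finset.univ.erase k, b q x₃ y (c k') := by
    simp only [hF, hA, hb]
    refine (ind_or_le _ _).trans ?_
    rw [add_assoc, add_assoc]
    refine add_le_add le_rfl ((ind_or_le _ _).trans (add_le_add le_rfl ((ind_or_le _ _).trans
      (add_le_add le_rfl ?_))))
    rw [← Finset.mul_sum]
    have e : ∑ k' ∈ Finset.univ.erase k, ind (D.CompressionTest W γ₂ q x₃ y (c k')) =
        ((Finset.univ.erase k).filter fun k' => D.CompressionTest W γ₂ q x₃ y (c k')).card := by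
      simp only [ind, Finset.sum_boole]
    rw [e, one_div_mul_eq_div]
    unfold ind
    split_ifs with h
    · rw [one_le_div hl₀']
      exact_mod_cast h
    · positivity
  have hpoint (ω : BlockCodebook Q X₁ X₂ X₃ Y₃ U K₁ K₂ (V × K) K) (t : Y × Y₃) :
      ind (D.decodeRelay W γ₁ ω l t.1 ≠ s ∨
          (ω.2.2.2 s).2.2 t.2 ∉ D.compressionList W γ₂ ω s t.1 ∨
          l₀ < (D.compressionList W γ₂ ω s t.1).card ∨
          D.decodePair W γa γb γc ω s ((ω.2.2.2 s).2.2 t.2) t.1 ≠ (w₁, w₂)) ≤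
        ∑ s' ∈ (Finset.univ ×ˢ l).erase s, ind (D.RelayTest W γ₁ ω.1 (ω.2.2.2 s').1 t.1) +
        F ω.1 ω.2.1 ω.2.2.1 (ω.2.2.2 s).1 t.1 (ω.2.2.2 s).2.1 ((ω.2.2.2 s).2.2 t.2) := by
    refine le_trans (ind_mono ?_) ((ind_or_le _ _).trans (add_le_add (ind_exists_le _ _) le_rfl))
    intro h
    by_contra! hc
    obtain ⟨hc1, hc2, hc3, hc4, hc5⟩ := hc
    rcases h with h | h | h | h
    · have h1 := Classical.epsilon_spec
        (p := fun s : V × K => s.2 ∈ l ∧ D.RelayTest W γ₁ ω.1 (ω.2.2.2 s).1 t.1) ⟨s, hsl, hc2⟩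
      refine hc1 (D.decodeRelay W γ₁ ω l t.1) ?_ h1.2
      rw [Finset.mem_erase, Finset.mem_product]
      exact ⟨h, Finset.mem_univ _, h1.1⟩
    · exact h (Finset.mem_filter.2 ⟨Finset.mem_univ _, hc3⟩)
    -- A list longer than `l₀` that contains the true index has at least `l₀` false entries.
    · have hmem : (ω.2.2.2 s).2.2 t.2 ∈ D.compressionList W γ₂ ω s t.1 :=
        Finset.mem_filter.2 ⟨Finset.mem_univ _, hc3⟩
      have h2 := Finset.card_erase_of_mem hmem
      have h3 : (Finset.univ.erase ((ω.2.2.2 s).2.2 t.2)).filter (fun k' =>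
          D.CompressionTest W γ₂ ω.1 (ω.2.2.2 s).1 t.1 ((ω.2.2.2 s).2.1 k')) =
          (D.compressionList W γ₂ ω s t.1).erase ((ω.2.2.2 s).2.2 t.2) := by
        ext k'
        simp [compressionList, and_comm]
      rw [h3, h2] at hc5
      omega
    · exact h hc4
  have h1 : wsum (D.codebookW (D.pUX W))
      (fun ω : BlockCodebook Q X₁ X₂ X₃ Y₃ U K₁ K₂ (V × K) K =>
      wsum (W (ω.2.1 w₁) (ω.2.2.1 w₂) (ω.2.2.2 s).1) fun t =>
        ∑ s' ∈ (Finset.univ ×ˢ l).erase s, ind (D.RelayTest W γ₁ ω.1 (ω.2.2.2 s').1 t.1)) ≤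
      Fintype.card V * l₀ / γ₁ := by
    simp only [wsum_sum]
    -- Only indices on the list compete, so there are at most `card V * l₀` false relay codewords;
    -- this is the gain of list decoding.
    calc _ ≤ ∑ s' ∈ ((Finset.univ : Finset V) ×ˢ l).erase s, 1 / γ₁ :=
          Finset.sum_le_sum fun s' hs' =>
            D.relay_union_le hW hγ₁ w₁ w₂ (Finset.ne_of_mem_erase hs').symm
      _ ≤ _ := by
          rw [Finset.sum_const, nsmul_eq_mul, mul_one_div]
          gcongr
          have : (((Finset.univ : Finset V) ×ˢ l).erase s).card ≤ Fintype.card V * l₀ :=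
            Finset.card_erase_le.trans (by
              rw [Finset.card_product, Finset.card_univ]; exact Nat.mul_le_mul_left _ hl)
          exact_mod_cast this
  have h2 : wsum (D.codebookW (D.pUX W))
      (fun ω : BlockCodebook Q X₁ X₂ X₃ Y₃ U K₁ K₂ (V × K) K =>
      wsum (W (ω.2.1 w₁) (ω.2.2.1 w₂) (ω.2.2.2 s).1) fun t =>
        F ω.1 ω.2.1 ω.2.2.1 (ω.2.2.2 s).1 t.1 (ω.2.2.2 s).2.1 ((ω.2.2.2 s).2.2 t.2)) ≤
      wsum D.pQ fun q => wsum (piW fun _ : K₁ => D.p₁ q) fun c₁ =>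
        wsum (piW fun _ : K₂ => D.p₂ q) fun c₂ => wsum (D.p₃ q) fun x₃ =>
        wsum (W (c₁ w₁) (c₂ w₂) x₃) fun t =>
          (wsum (D.pU q x₃ t.2) (A q c₁ c₂ x₃ t.1) +
            Fintype.card K * wsum (D.pUX W q x₃) (b q x₃ t.1) +
            wsum (D.pU q x₃ t.2) (fun u => ind (γ₀ * D.pUX W q x₃ u < D.pU q x₃ t.2 u)) +
            √(γ₀ / Fintype.card K)) := by
    rw [wsum_codebookW]
    refine D.hQ.mono fun q => (IsPMF.piW fun _ => D.h₁ q).mono fun c₁ =>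
      (IsPMF.piW fun _ => D.h₂ q).mono fun c₂ => ?_
    dsimp only
    rw [wsum_piW_one (fun _ : V × K => D.relayW_isPMF hP q) s fun e =>
      wsum (W (c₁ w₁) (c₂ w₂) e.1) fun t => F q c₁ c₂ e.1 t.1 e.2.1 (e.2.2 t.2), wsum_relayW]
    refine (D.h₃ q).mono fun x₃ => ?_
    dsimp only
    rw [wsum_rotate]
    refine (hW _ _ _).mono fun t => ?_
    have e (c : K → U) := wsum_piW_one
      (fun y₃ => likelihoodW_isPMF (hP q x₃) (D.hU q x₃ y₃) c) t.2 (F q c₁ c₂ x₃ t.1 c)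
    simp only [e]
    -- With the outputs fixed, only the compression codebook is still random. The picked codeword
    -- counts as a draw from `p(u|q,x₃,y₃)`, the others as draws from `p(u|q,x₃)`.
    exact likelihood_random_coding (hP q x₃) (D.hU q x₃ t.2) hγ₀.le (fun _ _ => ind_nonneg _)
      (fun _ _ => ind_le_one _) (hA0 q c₁ c₂ x₃ t.1) (hb0 q x₃ t.1) (hFAb q c₁ c₂ x₃ t.1)
  have h3 (G : Q × X₁ × X₂ × X₃ × Y × Y₃ × U → ℝ) :
      (wsum D.pQ fun q => wsum (piW fun _ : K₁ => D.p₁ q) fun c₁ =>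
        wsum (piW fun _ : K₂ => D.p₂ q) fun c₂ => wsum (D.p₃ q) fun x₃ =>
        wsum (W (c₁ w₁) (c₂ w₂) x₃) fun t => wsum (D.pU q x₃ t.2) fun u =>
          G (q, c₁ w₁, c₂ w₂, x₃, t.1, t.2, u)) = wsum (D.joint W) G := by
    rw [wsum_joint]
    refine wsum_congr fun q => ?_
    rw [← wsum_piW_one (fun _ => D.h₁ q) w₁]
    refine wsum_congr fun c₁ => ?_
    rw [← wsum_piW_one (fun _ => D.h₂ q) w₂]
  have h1p (q : Q) := IsPMF.piW fun _ : K₁ => D.h₁ q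
  have h2p (q : Q) := IsPMF.piW fun _ : K₂ => D.h₂ q
  have i1 := h3 fun ω => ind (¬D.RelayTest W γ₁ (cQ ω) (c₃ ω) (cY ω))
  have i2 := h3 fun ω => ind (¬D.CompressionTest W γ₂ (cQ ω) (c₃ ω) (cY ω) (cU ω))
  have i3 := h3 fun ω => wsum (D.pUX W (cQ ω) (c₃ ω)) (b (cQ ω) (c₃ ω) (cY ω))
  have i4 := h3 fun ω =>
    ind (γ₀ * D.pUX W (cQ ω) (c₃ ω) (cU ω) < D.pU (cQ ω) (c₃ ω) (cY₃ ω) (cU ω))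
  have i5 := D.mac_error_le hW hγa hγb hγc w₁ w₂
  have i6 := D.covering_le hW γ₀
  have i7 := D.compression_false_le hW hγ₂
  have h4 : wsum (D.codebookW (D.pUX W))
      (fun ω : BlockCodebook Q X₁ X₂ X₃ Y₃ U K₁ K₂ (V × K) K =>
      wsum (W (ω.2.1 w₁) (ω.2.2.1 w₂) (ω.2.2.2 s).1) fun t =>
        F ω.1 ω.2.1 ω.2.2.1 (ω.2.2.2 s).1 t.1 (ω.2.2.2 s).2.1 ((ω.2.2.2 s).2.2 t.2)) ≤
      missProb (D.joint W) c₃ cY cQ γ₁ +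
      missProb (D.joint W) cU cY (fun ω => (c₃ ω, cQ ω)) γ₂ +
      (missProb (D.joint W) CFLaw.c₁ (fun ω => (cY ω, cU ω)) (fun ω => (CFLaw.c₂ ω, c₃ ω, cQ ω)) γa +
      missProb (D.joint W) CFLaw.c₂ (fun ω => (cY ω, cU ω)) (fun ω => (CFLaw.c₁ ω, c₃ ω, cQ ω)) γb +
      missProb (D.joint W) (fun ω => (CFLaw.c₁ ω, CFLaw.c₂ ω)) (fun ω => (cY ω, cU ω))
        (fun ω => (c₃ ω, cQ ω)) γc +
      (Fintype.card K₁ - 1 : ℝ) / γa + (Fintype.card K₂ - 1 : ℝ) / γb +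
      (Fintype.card K₁ - 1 : ℝ) * (Fintype.card K₂ - 1 : ℝ) / γc) +
      (denseProb (D.joint W) cY₃ cU (fun ω => (c₃ ω, cQ ω)) γ₀ + √(γ₀ / Fintype.card K)) +
      Fintype.card K / (l₀ * γ₂) := by
    refine h2.trans ?_
    simp only [hA, wsum_add, wsum_const_mul, (hW _ _ _).wsum_const, (D.h₃ _).wsum_const,
      (h1p _).wsum_const, (h2p _).wsum_const, D.hQ.wsum_const, (D.hU _ _ _).wsum_const]
    simp only [cQ, c₃, cY, cU, cY₃, (D.hU _ _ _).wsum_const] at i1 i2 i3 i4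
    have j1 : missProb (D.joint W) c₃ cY cQ γ₁ = _ := missProb_eq_wsum _ _ _ _ _
    have j2 : missProb (D.joint W) cU cY (fun ω => (c₃ ω, cQ ω)) γ₂ = _ :=
      missProb_eq_wsum _ _ _ _ _
    have j3 : (Fintype.card K : ℝ) * wsum (D.joint W)
        (fun ω => wsum (D.pUX W (cQ ω) (c₃ ω)) (b (cQ ω) (c₃ ω) (cY ω))) ≤
        Fintype.card K / (l₀ * γ₂) := by
      simp only [hb, wsum_const_mul]
      have : (Fintype.card K : ℝ) / (l₀ * γ₂) = Fintype.card K * (1 / l₀ * (1 / γ₂)) := by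
        field_simp
      rw [this]
      gcongr
    rw [i1, i2, i3, i4]
    rw [j1, j2]
    have k1 := add_le_add (add_le_add i5 i6) j3
    simp only [RelayTest, CompressionTest] at *
    linarith
  refine le_trans ((D.codebookW_isPMF hP).mono fun ω => (hW _ _ _).mono fun t => hpoint ω t) ?_
  simp only [wsum_add]
  linarith

end CFLaw

/-! ### One block at a receiver that ignores the relay -/

namespace CFLaw

variable {Q X₁ X₂ X₃ Y Y₃ U K₁ K₂ S K : Type*}
  [Fintype Q] [Fintype X₁] [Fintype X₂] [Fintype X₃] [Fintype Y] [Fintype Y₃] [Fintype U]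
  [Fintype K₁] [Fintype K₂] [Fintype S] [Fintype K]
  [DecidableEq Y₃] [DecidableEq K₁] [DecidableEq K₂] [DecidableEq S]
  [DecidableEq K] [Nonempty K] [Nonempty K₁] [Nonempty K₂]
  (D : CFLaw Q X₁ X₂ X₃ Y₃ U) {W : X₁ → X₂ → X₃ → Y × Y₃ → ℝ}

/-- The test for the message of the first transmitter at a receiver that ignores the relay. -/
def DirectTestA (W : X₁ → X₂ → X₃ → Y × Y₃ → ℝ) (γ : ℝ) (q : Q) (x₁ : X₁) (x₂ : X₂) (y : Y) :
    Prop :=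
  InfoDense (D.joint W) c₁ cY (fun ω => (c₂ ω, cQ ω)) γ x₁ y (x₂, q)

/-- The test for the message of the second transmitter at a receiver that ignores the relay. -/
def DirectTestB (W : X₁ → X₂ → X₃ → Y × Y₃ → ℝ) (γ : ℝ) (q : Q) (x₁ : X₁) (x₂ : X₂) (y : Y) :
    Prop :=
  InfoDense (D.joint W) c₂ cY (fun ω => (c₁ ω, cQ ω)) γ x₂ y (x₁, q)

/-- The test for the messages of both transmitters at a receiver that ignores the relay. -/
def DirectTestC (W : X₁ → X₂ → X₃ → Y × Y₃ → ℝ) (γ : ℝ) (q : Q) (x₁ : X₁) (x₂ : X₂) (y : Y) :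
    Prop :=
  InfoDense (D.joint W) (fun ω => (c₁ ω, c₂ ω)) cY cQ γ (x₁, x₂) y q

theorem directTestA_false_le (hW : ∀ x₁ x₂ x₃, IsPMF (W x₁ x₂ x₃)) {γ : ℝ} (hγ : 0 < γ) :
    wsum (D.joint W) (fun ω => wsum (D.p₁ (cQ ω)) fun x₁ =>
      ind (D.DirectTestA W γ (cQ ω) x₁ (c₂ ω) (cY ω))) ≤ 1 / γ :=
  wsum_dense_le (D.joint_isPMF hW) (X := c₁) (Y := cY)
    (Z := fun ω => (c₂ ω, cQ ω)) hγ (g := fun t => D.p₁ t.2) fun x t => by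
      rw [D.marginal_x₁x₂q hW, D.marginal_x₂q hW]; ring

theorem directTestB_false_le (hW : ∀ x₁ x₂ x₃, IsPMF (W x₁ x₂ x₃)) {γ : ℝ} (hγ : 0 < γ) :
    wsum (D.joint W) (fun ω => wsum (D.p₂ (cQ ω)) fun x₂ =>
      ind (D.DirectTestB W γ (cQ ω) (c₁ ω) x₂ (cY ω))) ≤ 1 / γ :=
  wsum_dense_le (D.joint_isPMF hW) (X := c₂) (Y := cY)
    (Z := fun ω => (c₁ ω, cQ ω)) hγ (g := fun t => D.p₂ t.2) fun x t => by
      rw [marginal_congr_val (Y := fun ω => (c₁ ω, c₂ ω, cQ ω)) (b := (t.1, x, t.2)) (D.joint W)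
        (fun ω => by simp only [Prod.ext_iff]; tauto), D.marginal_x₁x₂q hW, D.marginal_x₁q hW]
      ring

theorem directTestC_false_le (hW : ∀ x₁ x₂ x₃, IsPMF (W x₁ x₂ x₃)) {γ : ℝ} (hγ : 0 < γ) :
    wsum (D.joint W) (fun ω => wsum (D.p₁ (cQ ω)) fun x₁ => wsum (D.p₂ (cQ ω)) fun x₂ =>
      ind (D.DirectTestC W γ (cQ ω) x₁ x₂ (cY ω))) ≤ 1 / γ := by
  have h := wsum_dense_le (D.joint_isPMF hW) (X := fun ω => (c₁ ω, c₂ ω))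
    (Y := cY) (Z := cQ) hγ
    (g := fun t x => D.p₁ t x.1 * D.p₂ t x.2) fun x t => by
      rw [marginal_congr_val (Y := fun ω => (c₁ ω, c₂ ω, cQ ω)) (b := (x.1, x.2, t)) (D.joint W)
        (fun ω => by simp only [Prod.ext_iff]; tauto), D.marginal_x₁x₂q hW, D.marginal_q hW]
  refine le_trans (le_of_eq (wsum_congr fun ω => ?_)) h
  simp only [wsum, Fintype.sum_prod_type, Finset.mul_sum, mul_assoc, DirectTestC]

/-- The choice of the messages of the transmitters by a receiver that ignores the relay. -/
noncomputable def decodePairDirect (W : X₁ → X₂ → X₃ → Y × Y₃ → ℝ) (γa γb γc : ℝ)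
    (ω : BlockCodebook Q X₁ X₂ X₃ Y₃ U K₁ K₂ S K) (y : Y) : K₁ × K₂ :=
  Classical.epsilon (MacTest (D.DirectTestA W γa ω.1) (D.DirectTestB W γb ω.1)
    (D.DirectTestC W γc ω.1) ω.2.1 ω.2.2.1 y)

/-- One block of compress-and-forward with random codebooks, for a receiver that ignores the
relay. -/
theorem direct_receiver (hW : ∀ x₁ x₂ x₃, IsPMF (W x₁ x₂ x₃)) {P : Q → X₃ → U → ℝ}
    (hP : ∀ q x₃, IsPMF (P q x₃)) {γa γb γc : ℝ} (hγa : 0 < γa)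
    (hγb : 0 < γb) (hγc : 0 < γc) (w₁ : K₁) (w₂ : K₂) (s : S) :
    wsum (D.codebookW P) (fun ω : BlockCodebook Q X₁ X₂ X₃ Y₃ U K₁ K₂ S K =>
      wsum (W (ω.2.1 w₁) (ω.2.2.1 w₂) (ω.2.2.2 s).1) fun t =>
        ind (D.decodePairDirect W γa γb γc ω t.1 ≠ (w₁, w₂))) ≤
      missProb (D.joint W) c₁ cY (fun ω => (c₂ ω, cQ ω)) γa +
      missProb (D.joint W) c₂ cY (fun ω => (c₁ ω, cQ ω)) γb +
      missProb (D.joint W) (fun ω => (c₁ ω, c₂ ω)) cY cQ γc +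
      (Fintype.card K₁ - 1 : ℝ) / γa + (Fintype.card K₂ - 1 : ℝ) / γb +
      (Fintype.card K₁ - 1 : ℝ) * (Fintype.card K₂ - 1 : ℝ) / γc := by
  have hk₁ : (0 : ℝ) ≤ Fintype.card K₁ - 1 :=
    sub_nonneg.2 (by exact_mod_cast Fintype.card_pos)
  have hk₂ : (0 : ℝ) ≤ Fintype.card K₂ - 1 :=
    sub_nonneg.2 (by exact_mod_cast Fintype.card_pos)
  have hJ := D.joint_isPMF hW
  -- The relay's input and output are averaged out: for this receiver the relay is part of the
  -- channel noise.
  set T : Q → X₁ → X₂ → Y → ℝ := fun q x₁ x₂ y =>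
    ∑ x₃, D.p₃ q x₃ * ∑ y₃, W x₁ x₂ x₃ (y, y₃) with hT
  have hT0 (q x₁ x₂ o) : 0 ≤ T q x₁ x₂ o :=
    Finset.sum_nonneg fun x₃ _ => mul_nonneg ((D.h₃ _).nonneg _)
      (Finset.sum_nonneg fun y₃ _ => (hW _ _ _).nonneg _)
  have hTsum (q x₁ x₂) (f : Y → ℝ) : (wsum (D.p₃ q) fun x₃ => wsum (W x₁ x₂ x₃) fun t => f t.1) =
      wsum (T q x₁ x₂) f := by
    simp only [wsum, Fintype.sum_prod_type, hT, Finset.sum_mul, Finset.mul_sum]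
    rw [Finset.sum_comm]
    exact Finset.sum_congr rfl fun y _ => Finset.sum_congr rfl fun y _ =>
      Finset.sum_congr rfl fun y _ => by ring
  have hstep : wsum (D.codebookW P) (fun ω : BlockCodebook Q X₁ X₂ X₃ Y₃ U K₁ K₂ S K =>
      wsum (W (ω.2.1 w₁) (ω.2.2.1 w₂) (ω.2.2.2 s).1) fun t =>
        ind (D.decodePairDirect W γa γb γc ω t.1 ≠ (w₁, w₂))) ≤
      wsum (D.joint W) fun ω =>
        ind (¬(D.DirectTestA W γa (cQ ω) (c₁ ω) (c₂ ω) (cY ω) ∧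
          D.DirectTestB W γb (cQ ω) (c₁ ω) (c₂ ω) (cY ω) ∧
          D.DirectTestC W γc (cQ ω) (c₁ ω) (c₂ ω) (cY ω))) +
        (Fintype.card K₁ - 1 : ℝ) * wsum (D.p₁ (cQ ω)) (fun x₁ =>
          ind (D.DirectTestA W γa (cQ ω) x₁ (c₂ ω) (cY ω))) +
        (Fintype.card K₂ - 1 : ℝ) * wsum (D.p₂ (cQ ω)) (fun x₂ =>
          ind (D.DirectTestB W γb (cQ ω) (c₁ ω) x₂ (cY ω))) +
        (Fintype.card K₁ - 1 : ℝ) * (Fintype.card K₂ - 1 : ℝ) *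
          wsum (D.p₁ (cQ ω)) (fun x₁ => wsum (D.p₂ (cQ ω)) fun x₂ =>
            ind (D.DirectTestC W γc (cQ ω) x₁ x₂ (cY ω))) := by
    rw [wsum_joint, wsum_codebookW]
    refine D.hQ.mono fun q => ?_
    simp only [cQ, CFLaw.c₁, CFLaw.c₂, cY, (D.hU _ _ _).wsum_const, decodePairDirect]
    have e (c₁ : K₁ → X₁) (c₂ : K₂ → X₂) := (wsum_piW_one (fun _ : S => D.relayW_isPMF hP q) s
      fun e => wsum (W (c₁ w₁) (c₂ w₂) e.1) fun t =>
        ind (Classical.epsilon (MacTest (D.DirectTestA W γa q) (D.DirectTestB W γb q)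
          (D.DirectTestC W γc q) c₁ c₂ t.1) ≠ (w₁, w₂))).trans
      (D.wsum_relayW_fst (K := K) hP q fun x₃ => wsum (W (c₁ w₁) (c₂ w₂) x₃) fun t =>
        ind (Classical.epsilon (MacTest (D.DirectTestA W γa q) (D.DirectTestB W γb q)
          (D.DirectTestC W γc q) c₁ c₂ t.1) ≠ (w₁, w₂)))
    have e2 (c₁ : K₁ → X₁) (c₂ : K₂ → X₂) := (e c₁ c₂).trans (hTsum q (c₁ w₁) (c₂ w₂) fun y =>
      ind (Classical.epsilon (MacTest (D.DirectTestA W γa q) (D.DirectTestB W γb q)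
          (D.DirectTestC W γc q) c₁ c₂ y) ≠ (w₁, w₂)))
    simp only [e2]
    refine (mac_random_coding (D.h₁ q) (D.h₂ q) (hT0 q) (D.DirectTestA W γa q)
      (D.DirectTestB W γb q) (D.DirectTestC W γc q) w₁ w₂).trans (le_of_eq ?_)
    refine wsum_congr fun x₁ => wsum_congr fun x₂ => ?_
    rw [← hTsum]
  refine hstep.trans ?_
  simp only [wsum_add, wsum_const_mul]
  have h0 : (wsum (D.joint W) fun ω =>
        ind (¬(D.DirectTestA W γa (cQ ω) (c₁ ω) (c₂ ω) (cY ω) ∧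
          D.DirectTestB W γb (cQ ω) (c₁ ω) (c₂ ω) (cY ω) ∧
          D.DirectTestC W γc (cQ ω) (c₁ ω) (c₂ ω) (cY ω)))) ≤
      missProb (D.joint W) c₁ cY (fun ω => (c₂ ω, cQ ω)) γa +
      missProb (D.joint W) c₂ cY (fun ω => (c₁ ω, cQ ω)) γb +
      missProb (D.joint W) (fun ω => (c₁ ω, c₂ ω)) cY cQ γc := by
    simp only [missProb_eq_wsum, ← wsum_add]
    refine hJ.mono fun ω => ?_
    simp only [not_and_or]
    refine (ind_or_le _ _).trans ?_
    rw [add_assoc]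
    exact add_le_add le_rfl (ind_or_le _ _)
  have ha := mul_le_mul_of_nonneg_left (D.directTestA_false_le hW hγa) hk₁
  have hb := mul_le_mul_of_nonneg_left (D.directTestB_false_le hW hγb) hk₂
  have hc := mul_le_mul_of_nonneg_left (D.directTestC_false_le hW hγc) (mul_nonneg hk₁ hk₂)
  rw [mul_one_div] at ha hb hc
  linarith

end CFLaw

/-! ### Processes with state-dependent increments, and a union bound along the path -/

/-- A finite sequence, continued by an arbitrary element. -/
noncomputable def extendSeq {A : Type*} [Nonempty A] {N : ℕ} (a : Fin N → A) (n : ℕ) : A :=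
  if h : n < N then a ⟨n, h⟩ else Classical.arbitrary A

theorem extendSeq_fin {A : Type*} [Nonempty A] {N : ℕ} (a : Fin N → A) (b : Fin N) :
    extendSeq a b = a b := by
  simp [extendSeq]

theorem extendSeq_of_lt {A : Type*} [Nonempty A] {N : ℕ} (a : Fin N → A) {b : ℕ} (hb : b < N) :
    extendSeq a b = a ⟨b, hb⟩ := by
  simp [extendSeq, hb]

section Paths

variable {Ξ Z : Type*}

/-- The states of a process driven by the sequence `ξ`. -/
def trajectory (step : ℕ → Z → Ξ → Z) (z₀ : Z) (ξ : ℕ → Ξ) : ℕ → Z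
  | 0 => z₀
  | b + 1 => step b (trajectory step z₀ ξ b) (ξ b)

theorem trajectory_congr (step : ℕ → Z → Ξ → Z) (z₀ : Z) {ξ ξ' : ℕ → Ξ} {b : ℕ}
    (h : ∀ i < b, ξ i = ξ' i) : trajectory step z₀ ξ b = trajectory step z₀ ξ' b := by
  induction b with
  | zero => rfl
  | succ b ih =>
    simp only [trajectory]
    rw [ih fun i hi => h i (hi.trans (Nat.lt_succ_self b)), h b (Nat.lt_succ_self b)]

variable [Fintype Ξ] [Nonempty Ξ]

/-- The weight of a path of the process whose increments have the law `κ b z` at time `b` in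
state `z`. -/
noncomputable def pathW (κ : ℕ → Z → Ξ → ℝ) (step : ℕ → Z → Ξ → Z) (z₀ : Z) (N : ℕ)
    (ξ : Fin N → Ξ) : ℝ :=
  ∏ b : Fin N, κ b (trajectory step z₀ (extendSeq ξ) b) (ξ b)

theorem trajectory_snoc (step : ℕ → Z → Ξ → Z) (z₀ : Z) {N : ℕ} (ξ : Fin N → Ξ) (x : Ξ) {b : ℕ}
    (hb : b ≤ N) :
    trajectory step z₀ (extendSeq (Fin.snoc (α := fun _ => Ξ) ξ x)) b =
      trajectory step z₀ (extendSeq ξ) b := by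
  refine trajectory_congr step z₀ fun i hi => ?_
  have hiN : i < N := hi.trans_le hb
  rw [extendSeq_of_lt _ hiN, extendSeq_of_lt _ (hiN.trans (Nat.lt_succ_self N))]
  simp [Fin.snoc, hiN]

theorem pathW_snoc (κ : ℕ → Z → Ξ → ℝ) (step : ℕ → Z → Ξ → Z) (z₀ : Z) {N : ℕ} (ξ : Fin N → Ξ)
    (x : Ξ) :
    pathW κ step z₀ (N + 1) (Fin.snoc (α := fun _ => Ξ) ξ x) =
      pathW κ step z₀ N ξ * κ N (trajectory step z₀ (extendSeq ξ) N) x := by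
  unfold pathW
  rw [Fin.prod_univ_castSucc]
  simp only [Fin.snoc_castSucc, Fin.snoc_last, Fin.val_castSucc, Fin.val_last]
  rw [trajectory_snoc step z₀ ξ x le_rfl]
  congr 1
  refine Finset.prod_congr rfl fun b _ => ?_
  rw [trajectory_snoc step z₀ ξ x b.isLt.le]

/-- Conditioning on the past: the last increment is averaged first, with the state fixed by the
earlier ones. All inductions over the blocks rest on this. -/
theorem wsum_pathW_succ (κ : ℕ → Z → Ξ → ℝ) (step : ℕ → Z → Ξ → Z) (z₀ : Z) (N : ℕ)
    (F : (Fin (N + 1) → Ξ) → ℝ) :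
    wsum (pathW κ step z₀ (N + 1)) F = wsum (pathW κ step z₀ N) fun ξ =>
      wsum (κ N (trajectory step z₀ (extendSeq ξ) N)) fun x =>
        F (Fin.snoc (α := fun _ => Ξ) ξ x) := by
  unfold wsum
  rw [← Equiv.sum_comp (Fin.snocEquiv fun _ : Fin (N + 1) => Ξ), Fintype.sum_prod_type,
    Finset.sum_comm]
  refine Finset.sum_congr rfl fun ξ _ => ?_
  rw [Finset.mul_sum]
  refine Finset.sum_congr rfl fun x _ => ?_
  change pathW κ step z₀ (N + 1) (Fin.snoc (α := fun _ => Ξ) ξ x) *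
    F (Fin.snoc (α := fun _ => Ξ) ξ x) = _
  rw [pathW_snoc, mul_assoc]

theorem pathW_isPMF {κ : ℕ → Z → Ξ → ℝ} (hκ : ∀ b z, IsPMF (κ b z)) (step : ℕ → Z → Ξ → Z)
    (z₀ : Z) (N : ℕ) : IsPMF (pathW κ step z₀ N) where
  nonneg ξ := Finset.prod_nonneg fun b _ => (hκ _ _).nonneg _
  sum_one := by
    suffices h : wsum (pathW κ step z₀ N) (fun _ => 1) = 1 by simpa [wsum] using h
    induction N with
    | zero => simp [wsum, pathW]
    | succ N ih => rw [wsum_pathW_succ]; simpa only [(hκ _ _).wsum_const] using ih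

/-- Union bound over the steps of a process, for bad steps that are unlikely from every state that
satisfies an invariant, which is kept by the steps that are not bad. -/
theorem wsum_pathW_bad_le {κ : ℕ → Z → Ξ → ℝ} (hκ : ∀ b z, IsPMF (κ b z)) (step : ℕ → Z → Ξ → Z)
    {z₀ : Z} {Bad : ℕ → Z → Ξ → Prop} {Inv : Z → Prop} (h₀ : Inv z₀)
    (hstep : ∀ b z ξ, Inv z → ¬Bad b z ξ → Inv (step b z ξ)) {ε : ℝ}
    (hε : 0 ≤ ε) (hbad : ∀ b z, Inv z → wsum (κ b z) (fun ξ => ind (Bad b z ξ)) ≤ ε) (N : ℕ) :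
    wsum (pathW κ step z₀ N) (fun ξ =>
      ind (∃ b : Fin N, Bad b (trajectory step z₀ (extendSeq ξ) b) (ξ b))) ≤ N * ε := by
  induction N with
  | zero => simp [wsum, ind]
  | succ N ih =>
    rw [wsum_pathW_succ]
    have hle (ξ : Fin N → Ξ) : wsum (κ N (trajectory step z₀ (extendSeq ξ) N)) (fun x =>
        ind (∃ b : Fin (N + 1), Bad b (trajectory step z₀
          (extendSeq (Fin.snoc (α := fun _ => Ξ) ξ x)) b) (Fin.snoc (α := fun _ => Ξ) ξ x b))) ≤
        ind (∃ b : Fin N, Bad b (trajectory step z₀ (extendSeq ξ) b) (ξ b)) + ε := by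
      -- After an earlier bad step the trivial bound 1 is enough. Otherwise the invariant has
      -- survived up to time `N`, and `hbad` applies to the last step.
      by_cases hex : ∃ b : Fin N, Bad b (trajectory step z₀ (extendSeq ξ) b) (ξ b)
      · rw [ind_true hex]
        have := (hκ N (trajectory step z₀ (extendSeq ξ) N)).wsum_le fun x => ind_le_one
          (∃ b : Fin (N + 1), Bad b (trajectory step z₀
          (extendSeq (Fin.snoc (α := fun _ => Ξ) ξ x)) b) (Fin.snoc (α := fun _ => Ξ) ξ x b))
        linarith
      · have hinv : ∀ b, b ≤ N → Inv (trajectory step z₀ (extendSeq ξ) b) := by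
          intro b
          induction b with
          | zero => exact fun _ => h₀
          | succ b ihb =>
            intro hb
            refine hstep b _ _ (ihb (by omega)) fun hB => hex ⟨⟨b, by omega⟩, ?_⟩
            rwa [extendSeq_of_lt ξ (by omega : b < N)] at hB
        rw [ind_false hex, zero_add]
        refine le_trans ((hκ _ _).mono fun x => ind_mono ?_) (hbad N _ (hinv N le_rfl))
        rintro ⟨b, hb⟩
        rw [trajectory_snoc step z₀ ξ x (Nat.lt_succ_iff.1 b.isLt)] at hb
        refine Fin.lastCases (motive := fun b => Bad b (trajectory step z₀ (extendSeq ξ) b)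
          (Fin.snoc (α := fun _ => Ξ) ξ x b) → Bad N (trajectory step z₀ (extendSeq ξ) N) x)
          ?_ ?_ b hb
        · simp
        · intro b hb
          simp only [Fin.snoc_castSucc, Fin.val_castSucc] at hb
          exact absurd ⟨b, hb⟩ hex
    refine ((pathW_isPMF hκ step z₀ N).mono hle).trans ?_
    rw [wsum_add, (pathW_isPMF hκ step z₀ N).wsum_const]
    push_cast
    linarith

end Paths

/-! ### Many blocks in a row, for one receiver at a time -/

/-- Block codes drawn at random: the codewords of the transmitters and of the relay, and the
relay's compression index as a function of its message and its output. -/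
structure BlockEnsemble (Ω X₁ X₂ X₃ Y₃ K₁ K₂ V K : Type*) [Fintype Ω] where
  ρ : Ω → ℝ
  hρ : IsPMF ρ
  f₁ : Ω → K₁ → X₁
  f₂ : Ω → K₂ → X₂
  f₃ : Ω → V × K → X₃
  κ : Ω → V × K → Y₃ → K
  k₀ : K

namespace BlockEnsemble

variable {Ω X₁ X₂ X₃ Y Y₃ K₁ K₂ V K L : Type*} [Fintype Ω] [Fintype Y] [Fintype Y₃]
  [Nonempty Ω] [Nonempty Y] [Nonempty Y₃]
  (E : BlockEnsemble Ω X₁ X₂ X₃ Y₃ K₁ K₂ V K)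

/-- The compression index that the relay sends in block `b`. -/
def relayIndex (v : ℕ → V) (ω : ℕ → Ω) (y₃ : ℕ → Y₃) : ℕ → K
  | 0 => E.k₀
  | b + 1 => E.κ (ω b) (v b, relayIndex v ω y₃ b) (y₃ b)

theorem relayIndex_congr (v : ℕ → V) {ω ω' : ℕ → Ω} {y₃ y₃' : ℕ → Y₃} {b : ℕ}
    (h : ∀ i < b, ω i = ω' i) (h₃ : ∀ i < b, y₃ i = y₃' i) :
    E.relayIndex v ω y₃ b = E.relayIndex v ω' y₃' b := by
  induction b with
  | zero => rfl
  | succ b ih =>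
    simp only [relayIndex]
    rw [ih (fun i hi => h i (hi.trans (Nat.lt_succ_self b)))
      (fun i hi => h₃ i (hi.trans (Nat.lt_succ_self b))), h b (Nat.lt_succ_self b),
      h₃ b (Nat.lt_succ_self b)]

/-- The weights of the outputs of `N` blocks at a receiver and at the relay. -/
noncomputable def blocksW (W : X₁ → X₂ → X₃ → Y × Y₃ → ℝ) {N : ℕ} (w₁ : ℕ → K₁) (w₂ : ℕ → K₂)
    (v : ℕ → V) (ω : Fin N → Ω) (t : Fin N → Y × Y₃) : ℝ :=
  ∏ b : Fin N, W (E.f₁ (ω b) (w₁ b)) (E.f₂ (ω b) (w₂ b))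
    (E.f₃ (ω b) (v b, E.relayIndex v (extendSeq ω) (extendSeq fun i => (t i).2) b)) (t b)

/-- The chance that a receiver with the decoder `dec` makes an error is at most `δ`, for all
messages; the messages of the last block are not decoded. -/
def ReceiverErrorLE (W : X₁ → X₂ → X₃ → Y × Y₃ → ℝ) (B : ℕ)
    (dec : (Fin (B + 1) → Ω) → (Fin (B + 1) → Y) → (Fin B → K₁) × (Fin B → K₂) × (Fin B → V))
    (δ : ℝ) : Prop :=
  ∀ (w₁ : ℕ → K₁) (w₂ : ℕ → K₂) (v : ℕ → V),
    wsum (piW fun _ : Fin (B + 1) => E.ρ) (fun ω => wsum (E.blocksW W w₁ w₂ v ω) fun t =>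
      ind (dec ω (fun b => (t b).1) ≠ (fun b : Fin B => w₁ b, fun b : Fin B => w₂ b, fun b : Fin B => v b))) ≤ δ

/-- Codebook and outputs of a block form one increment, whose law depends on the past only through
the current compression index. The second component of the state does not influence the law, so its
update `step` is arbitrary and can record a receiver's bookkeeping. -/
theorem wsum_blocksW (W : X₁ → X₂ → X₃ → Y × Y₃ → ℝ) {N : ℕ} (w₁ : ℕ → K₁) (w₂ : ℕ → K₂)
    (v : ℕ → V) (step : ℕ → K × L → Ω × (Y × Y₃) → L) (l₀ : L)
    (F : (Fin N → Ω) → (Fin N → Y × Y₃) → ℝ) :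
    wsum (piW fun _ : Fin N => E.ρ) (fun ω => wsum (E.blocksW W w₁ w₂ v ω) fun t => F ω t) =
      wsum (pathW (fun b (z : K × L) (ξ : Ω × (Y × Y₃)) => E.ρ ξ.1 *
          W (E.f₁ ξ.1 (w₁ b)) (E.f₂ ξ.1 (w₂ b)) (E.f₃ ξ.1 (v b, z.1)) ξ.2)
        (fun b z ξ => (E.κ ξ.1 (v b, z.1) ξ.2.2, step b z ξ)) (E.k₀, l₀) N) fun ξ =>
          F (fun b => (ξ b).1) (fun b => (ξ b).2) := by
  have hidx (ξ : Fin N → Ω × (Y × Y₃)) (b : ℕ) (hb : b ≤ N) :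
      (trajectory (fun b (z : K × L) (ξ : Ω × (Y × Y₃)) =>
        (E.κ ξ.1 (v b, z.1) ξ.2.2, step b z ξ)) (E.k₀, l₀) (extendSeq ξ) b).1 =
      E.relayIndex v (extendSeq fun b => (ξ b).1) (extendSeq fun b => (ξ b).2.2) b := by
    induction b with
    | zero => rfl
    | succ b ih =>
      have hb' : b < N := hb
      simp only [trajectory, relayIndex, ih hb'.le, extendSeq_of_lt _ hb']
  unfold wsum
  rw [← Equiv.sum_comp (Equiv.arrowProdEquivProdArrow (Fin N) (fun _ => Ω)
    (fun _ => Y × Y₃)).symm, Fintype.sum_prod_type]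
  refine Finset.sum_congr rfl fun ω _ => ?_
  rw [Finset.mul_sum]
  refine Finset.sum_congr rfl fun t _ => ?_
  rw [← mul_assoc]
  congr 1
  unfold piW blocksW pathW
  rw [← Finset.prod_mul_distrib]
  refine Finset.prod_congr rfl fun b _ => ?_
  beta_reduce
  rw [hidx _ _ b.isLt.le]
  rfl

theorem kernel_isPMF {W : X₁ → X₂ → X₃ → Y × Y₃ → ℝ} (hW : ∀ x₁ x₂ x₃, IsPMF (W x₁ x₂ x₃))
    (w₁ : K₁) (w₂ : K₂) (s : V × K) :
    IsPMF fun ξ : Ω × (Y × Y₃) => E.ρ ξ.1 * W (E.f₁ ξ.1 w₁) (E.f₂ ξ.1 w₂) (E.f₃ ξ.1 s) ξ.2 where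
  nonneg ξ := mul_nonneg (E.hρ.nonneg _) ((hW _ _ _).nonneg _)
  sum_one := by
    rw [Fintype.sum_prod_type]
    simp only [← Finset.mul_sum, (hW _ _ _).sum_one, mul_one, E.hρ.sum_one]

theorem wsum_kernel (W : X₁ → X₂ → X₃ → Y × Y₃ → ℝ)
    (w₁ : K₁) (w₂ : K₂) (s : V × K) (F : Ω × (Y × Y₃) → ℝ) :
    wsum (fun ξ : Ω × (Y × Y₃) => E.ρ ξ.1 * W (E.f₁ ξ.1 w₁) (E.f₂ ξ.1 w₂) (E.f₃ ξ.1 s) ξ.2) F =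
      wsum E.ρ fun ω => wsum (W (E.f₁ ω w₁) (E.f₂ ω w₂) (E.f₃ ω s)) fun t => F (ω, t) := by
  simp only [wsum, Fintype.sum_prod_type, Finset.mul_sum, mul_assoc]

/-- The side information that a receiver carries from one block to the next. -/
def estimate (ds : Ω → L → Y → V × K) (upd : Ω → V × K → Y → L) (l₀ : L) (ω : ℕ → Ω)
    (y : ℕ → Y) : ℕ → L
  | 0 => l₀
  | b + 1 => upd (ω b) (ds (ω b) (estimate ds upd l₀ ω y b) (y b)) (y b)

/-- A receiver that decodes the relay messages one after the other, carrying side information `l`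
about the compression index, and decodes the messages of the transmitters once it knows the
compression index from the next relay message. -/
theorem exists_decoder_of_relay {W : X₁ → X₂ → X₃ → Y × Y₃ → ℝ}
    (hW : ∀ x₁ x₂ x₃, IsPMF (W x₁ x₂ x₃)) {valid : L → K → Prop} {l₀ : L} (h₀ : valid l₀ E.k₀)
    (ds : Ω → L → Y → V × K) (upd : Ω → V × K → Y → L) (dw : Ω → V × K → K → Y → K₁ × K₂)
    {ε : ℝ} (hε : 0 ≤ ε)
    (h : ∀ w₁ w₂ s l, valid l s.2 →
      wsum E.ρ (fun ω => wsum (W (E.f₁ ω w₁) (E.f₂ ω w₂) (E.f₃ ω s)) fun t =>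
        ind (ds ω l t.1 ≠ s ∨ ¬valid (upd ω s t.1) (E.κ ω s t.2) ∨
          dw ω s (E.κ ω s t.2) t.1 ≠ (w₁, w₂))) ≤ ε) (B : ℕ) :
    ∃ dec, E.ReceiverErrorLE W B dec ((B + 1 : ℕ) * ε) := by
  let sHat : (ℕ → Ω) → (ℕ → Y) → ℕ → V × K := fun ω y b =>
    ds (ω b) (estimate ds upd l₀ ω y b) (y b)
  -- The compression index of block `b` is read from the relay message of block `b + 1`; this is why
  -- one extra block is sent.
  let pHat : (ℕ → Ω) → (ℕ → Y) → ℕ → K₁ × K₂ := fun ω y b =>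
    dw (ω b) (sHat ω y b) (sHat ω y (b + 1)).2 (y b)
  refine ⟨fun ω y => (fun b => (pHat (extendSeq ω) (extendSeq y) b).1,
    fun b => (pHat (extendSeq ω) (extendSeq y) b).2,
    fun b => (sHat (extendSeq ω) (extendSeq y) b).1), fun w₁ w₂ v => ?_⟩
  -- The process updates the side information with the true relay message. As long as no step is
  -- bad, the receiver's own estimates agree with it (`hest`).
  rw [E.wsum_blocksW W w₁ w₂ v (fun b z ξ => upd ξ.1 (v b, z.1) ξ.2.1) l₀]
  set step : ℕ → K × L → Ω × (Y × Y₃) → K × L := fun b z ξ =>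
    (E.κ ξ.1 (v b, z.1) ξ.2.2, upd ξ.1 (v b, z.1) ξ.2.1) with hstep
  set Bad : ℕ → K × L → Ω × (Y × Y₃) → Prop := fun b z ξ =>
    ds ξ.1 z.2 ξ.2.1 ≠ (v b, z.1) ∨
      ¬valid (upd ξ.1 (v b, z.1) ξ.2.1) (E.κ ξ.1 (v b, z.1) ξ.2.2) ∨
      dw ξ.1 (v b, z.1) (E.κ ξ.1 (v b, z.1) ξ.2.2) ξ.2.1 ≠ (w₁ b, w₂ b) with hBad
  have key := wsum_pathW_bad_le (fun b (z : K × L) => E.kernel_isPMF hW (w₁ b) (w₂ b) (v b, z.1))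
    step (z₀ := (E.k₀, l₀)) (Bad := Bad) (Inv := fun z => valid z.2 z.1) h₀
    (fun b z ξ _ hb => by
      simp only [hBad, not_or, not_not] at hb
      exact hb.2.1) hε
    (fun b z hz => by
      rw [wsum_kernel]
      exact h (w₁ b) (w₂ b) (v b, z.1) z.2 hz) (B + 1)
  refine le_trans (wsum_mono (pathW_isPMF (fun b (z : K × L) =>
    E.kernel_isPMF hW (w₁ b) (w₂ b) (v b, z.1)) _ _ _).nonneg fun ξ => ind_mono ?_) key
  contrapose!
  intro hno
  have hest (b : ℕ) (hb : b ≤ B + 1) :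
      estimate ds upd l₀ (extendSeq fun b => (ξ b).1) (extendSeq fun b => (ξ b).2.1) b =
        (trajectory step (E.k₀, l₀) (extendSeq ξ) b).2 := by
    induction b with
    | zero => rfl
    | succ b ih =>
      have hb' : b < B + 1 := hb
      have hn := hno ⟨b, hb'⟩
      simp only [hBad, not_or, not_not] at hn
      simp only [estimate, trajectory, ih hb'.le, extendSeq_of_lt _ hb', hstep]
      rw [hn.1]
  have hsHat (b : ℕ) (hb : b < B + 1) :
      sHat (extendSeq fun b => (ξ b).1) (extendSeq fun b => (ξ b).2.1) b =
        (v b, (trajectory step (E.k₀, l₀) (extendSeq ξ) b).1) := by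
    have hn := hno ⟨b, hb⟩
    simp only [hBad, not_or, not_not] at hn
    simp only [sHat, hest b hb.le, extendSeq_of_lt _ hb]
    exact hn.1
  have hpHat (b : Fin B) :
      pHat (extendSeq fun b => (ξ b).1) (extendSeq fun b => (ξ b).2.1) b = (w₁ b, w₂ b) := by
    have hb : (b : ℕ) < B + 1 := by omega
    have hn := hno ⟨b, hb⟩
    simp only [hBad, not_or, not_not] at hn
    simp only [pHat, hsHat b hb, hsHat (b + 1) (by omega), extendSeq_of_lt _ hb, trajectory, hstep]
    exact hn.2.2
  refine Prod.ext (funext fun b => ?_) (Prod.ext (funext fun b => ?_) (funext fun b => ?_))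
  · exact congrArg Prod.fst (hpHat b)
  · exact congrArg Prod.snd (hpHat b)
  · exact congrArg Prod.fst (hsHat b (by omega))

/-- A receiver that decodes each block separately, when the relay has no messages. -/
theorem exists_decoder_of_direct [Subsingleton V] [Nonempty V] {W : X₁ → X₂ → X₃ → Y × Y₃ → ℝ}
    (hW : ∀ x₁ x₂ x₃, IsPMF (W x₁ x₂ x₃)) (dw : Ω → Y → K₁ × K₂)
    {ε : ℝ} (hε : 0 ≤ ε)
    (h : ∀ w₁ w₂ s, wsum E.ρ (fun ω => wsum (W (E.f₁ ω w₁) (E.f₂ ω w₂) (E.f₃ ω s)) fun t =>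
        ind (dw ω t.1 ≠ (w₁, w₂))) ≤ ε) (B : ℕ) :
    ∃ dec, E.ReceiverErrorLE W B dec ((B + 1 : ℕ) * ε) := by
  refine ⟨fun ω y => (fun b => (dw (ω b.castSucc) (y b.castSucc)).1,
    fun b => (dw (ω b.castSucc) (y b.castSucc)).2, fun _ => Classical.arbitrary V),
    fun w₁ w₂ v => ?_⟩
  rw [E.wsum_blocksW W w₁ w₂ v (fun _ _ _ => ()) ()]
  have key := wsum_pathW_bad_le
    (fun b (z : K × Unit) => E.kernel_isPMF hW (w₁ b) (w₂ b) (v b, z.1))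
    (fun b z ξ => (E.κ ξ.1 (v b, z.1) ξ.2.2, ())) (z₀ := (E.k₀, ()))
    (Bad := fun b z ξ => dw ξ.1 ξ.2.1 ≠ (w₁ b, w₂ b)) (Inv := fun _ => True) trivial
    (fun _ _ _ _ _ => trivial) hε
    (fun b z _ => by
      rw [wsum_kernel]
      exact h (w₁ b) (w₂ b) (v b, z.1)) (B + 1)
  refine le_trans (wsum_mono (pathW_isPMF (fun b (z : K × Unit) =>
    E.kernel_isPMF hW (w₁ b) (w₂ b) (v b, z.1)) _ _ _).nonneg fun ξ => ind_mono ?_) key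
  contrapose!
  intro hno
  have hno' (b : Fin B) := hno b.castSucc
  simp only [Fin.val_castSucc] at hno'
  refine Prod.ext (funext fun b => ?_) (Prod.ext (funext fun b => ?_)
    (funext fun b => Subsingleton.elim _ _))
  · exact congrArg Prod.fst (hno' b)
  · exact congrArg Prod.snd (hno' b)

end BlockEnsemble

/-! ### Codes: error probability, padding, and codes on blocks of letters -/

theorem stdSimplex_isPMF {A : Type*} [Fintype A] (p : stdSimplex ℝ A) : IsPMF (p : A → ℝ) where
  nonneg a := p.2.1 a
  sum_one := p.2.2

section Sequences

variable {ι A B C : Type*} [Fintype ι] [DecidableEq ι] [Fintype A] [Fintype B] [Fintype C]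

theorem sum_pair_seq (F : (ι → A) → (ι → B) → ℝ) :
    ∑ a, ∑ b, F a b = ∑ t : ι → A × B, F (fun i => (t i).1) (fun i => (t i).2) := by
  rw [← Fintype.sum_prod_type',
    ← Equiv.sum_comp (Equiv.arrowProdEquivProdArrow ι (fun _ => A) (fun _ => B))]
  rfl

theorem sum_triple_seq (F : (ι → A) → (ι → B) → (ι → C) → ℝ) :
    ∑ a, ∑ b, ∑ c, F a b c =
      ∑ t : ι → A × B × C, F (fun i => (t i).1) (fun i => (t i).2.1) (fun i => (t i).2.2) := by
  simp_rw [sum_pair_seq]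

end Sequences

namespace CMACrCode

variable {X₁ X₂ X₃ Y₁ Y₂ Y₃ : Type*} [Fintype Y₁] [Fintype Y₂] [Fintype Y₃]
  {W : CMACr X₁ X₂ X₃ Y₁ Y₂ Y₃} {M₁ M₂ M₃ n : ℕ}

theorem errorProb_eq (c : CMACrCode X₁ X₂ X₃ Y₁ Y₂ Y₃ M₁ M₂ M₃ n) :
    c.errorProb W = (1 / ((M₁ : ℝ) * M₂ * M₃)) * ∑ w : Fin M₁ × Fin M₂ × Fin M₃,
      ∑ y : Fin n → Y₁ × Y₂ × Y₃,
        c.outputProb W w (fun j => (y j).1) (fun j => (y j).2.1) (fun j => (y j).2.2) *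
          ind (c.h₁ (fun j => (y j).1) ≠ w ∨ c.h₂ (fun j => (y j).2.1) ≠ w) := by
  unfold errorProb
  congr 1
  refine Finset.sum_congr rfl fun w _ => ?_
  rw [sum_triple_seq fun y₁ y₂ y₃ => if c.h₁ y₁ ≠ w ∨ c.h₂ y₂ ≠ w then
    c.outputProb W w y₁ y₂ y₃ else 0]
  refine Finset.sum_congr rfl fun y _ => ?_
  unfold ind
  split_ifs <;> simp

theorem outputProb_nonneg (c : CMACrCode X₁ X₂ X₃ Y₁ Y₂ Y₃ M₁ M₂ M₃ n)
    (w : Fin M₁ × Fin M₂ × Fin M₃) (y₁ : Fin n → Y₁) (y₂ : Fin n → Y₂) (y₃ : Fin n → Y₃) :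
    0 ≤ c.outputProb W w y₁ y₂ y₃ :=
  Finset.prod_nonneg fun _ _ => (stdSimplex_isPMF _).nonneg _

theorem errorProb_nonneg (c : CMACrCode X₁ X₂ X₃ Y₁ Y₂ Y₃ M₁ M₂ M₃ n) : 0 ≤ c.errorProb W := by
  rw [errorProb_eq]
  exact mul_nonneg (by positivity) (Finset.sum_nonneg fun w _ => Finset.sum_nonneg fun y _ =>
    mul_nonneg (c.outputProb_nonneg _ _ _ _) (ind_nonneg _))

/-- The code with one more letter, which carries no information. -/
def pad (c : CMACrCode X₁ X₂ X₃ Y₁ Y₂ Y₃ M₁ M₂ M₃ n) (x₁ : X₁) (x₂ : X₂) (x₃ : X₃) :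
    CMACrCode X₁ X₂ X₃ Y₁ Y₂ Y₃ M₁ M₂ M₃ (n + 1) where
  f₁ w := Fin.snoc (α := fun _ => X₁) (c.f₁ w) x₁
  f₂ w := Fin.snoc (α := fun _ => X₂) (c.f₂ w) x₂
  g j w past := if h : (j : ℕ) < n then c.g ⟨j, h⟩ w past else x₃
  h₁ y := c.h₁ fun j => y j.castSucc
  h₂ y := c.h₂ fun j => y j.castSucc

/-- The decoders do not look at the last outputs, whose probabilities sum to one. Padding reaches
the block lengths that are not multiples of the number of blocks. -/
theorem errorProb_pad (c : CMACrCode X₁ X₂ X₃ Y₁ Y₂ Y₃ M₁ M₂ M₃ n) (x₁ : X₁) (x₂ : X₂)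
    (x₃ : X₃) : (c.pad x₁ x₂ x₃).errorProb W = c.errorProb W := by
  rw [errorProb_eq, errorProb_eq]
  congr 1
  refine Finset.sum_congr rfl fun w _ => ?_
  rw [← Equiv.sum_comp (Fin.snocEquiv fun _ : Fin (n + 1) => Y₁ × Y₂ × Y₃), Fintype.sum_prod_type,
    Finset.sum_comm]
  refine Finset.sum_congr rfl fun y _ => ?_
  have hout (t : Y₁ × Y₂ × Y₃) : (c.pad x₁ x₂ x₃).outputProb W w
      (fun j => (Fin.snoc (α := fun _ => Y₁ × Y₂ × Y₃) y t j).1)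
      (fun j => (Fin.snoc (α := fun _ => Y₁ × Y₂ × Y₃) y t j).2.1)
      (fun j => (Fin.snoc (α := fun _ => Y₁ × Y₂ × Y₃) y t j).2.2) =
      c.outputProb W w (fun j => (y j).1) (fun j => (y j).2.1) (fun j => (y j).2.2) *
        W x₁ x₂ x₃ t := by
    unfold outputProb
    rw [Fin.prod_univ_castSucc]
    congr 1
    · refine Finset.prod_congr rfl fun j _ => ?_
      simp only [pad, Fin.snoc_castSucc, Fin.val_castSucc, j.isLt, dif_pos]
      congr 3
      refine funext fun i => ?_
      change (Fin.snoc (α := fun _ => Y₁ × Y₂ × Y₃) y t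
        (Fin.castLE (n := j) (m := n) j.isLt.le i).castSucc).2.2 = _
      rw [Fin.snoc_castSucc]
    · simp [pad, Fin.snoc_last]
  change ∑ t : Y₁ × Y₂ × Y₃, (c.pad x₁ x₂ x₃).outputProb W w
      (fun j => (Fin.snoc (α := fun _ => Y₁ × Y₂ × Y₃) y t j).1)
      (fun j => (Fin.snoc (α := fun _ => Y₁ × Y₂ × Y₃) y t j).2.1)
      (fun j => (Fin.snoc (α := fun _ => Y₁ × Y₂ × Y₃) y t j).2.2) *
      ind (c.h₁ (fun j => (Fin.snoc (α := fun _ => Y₁ × Y₂ × Y₃) y t j.castSucc).1) ≠ w ∨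
        c.h₂ (fun j => (Fin.snoc (α := fun _ => Y₁ × Y₂ × Y₃) y t j.castSucc).2.1) ≠ w) = _
  simp only [hout, Fin.snoc_castSucc]
  rw [← Finset.sum_mul, ← Finset.mul_sum, (stdSimplex_isPMF (W x₁ x₂ x₃)).sum_one, mul_one]

theorem exists_pad [Nonempty X₁] [Nonempty X₂] [Nonempty X₃] {n' : ℕ} (hn : n ≤ n')
    (c : CMACrCode X₁ X₂ X₃ Y₁ Y₂ Y₃ M₁ M₂ M₃ n) :
    ∃ c' : CMACrCode X₁ X₂ X₃ Y₁ Y₂ Y₃ M₁ M₂ M₃ n', c'.errorProb W = c.errorProb W := by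
  induction n', hn using Nat.le_induction with
  | base => exact ⟨c, rfl⟩
  | succ n' _ ih =>
    obtain ⟨c', hc'⟩ := ih
    exact ⟨c'.pad (Classical.arbitrary _) (Classical.arbitrary _) (Classical.arbitrary _),
      by rw [errorProb_pad, hc']⟩

end CMACrCode

/-- The channel for blocks of `m` letters. -/
noncomputable def blockChannel {X₁ X₂ X₃ Y₁ Y₂ Y₃ : Type*} [Fintype Y₁] [Fintype Y₂] [Fintype Y₃]
    (W : CMACr X₁ X₂ X₃ Y₁ Y₂ Y₃) (m : ℕ) :
    CMACr (Fin m → X₁) (Fin m → X₂) (Fin m → X₃) (Fin m → Y₁) (Fin m → Y₂) (Fin m → Y₃) :=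
  fun x₁ x₂ x₃ => ⟨fun t => ∏ i, W (x₁ i) (x₂ i) (x₃ i) (t.1 i, t.2.1 i, t.2.2 i),
    fun _ => Finset.prod_nonneg fun _ _ => (stdSimplex_isPMF _).nonneg _, by
      simp only [Fintype.sum_prod_type]
      rw [sum_triple_seq fun y₁ y₂ y₃ => ∏ i, W (x₁ i) (x₂ i) (x₃ i) (y₁ i, y₂ i, y₃ i)]
      exact (IsPMF.pi fun i => stdSimplex_isPMF (W (x₁ i) (x₂ i) (x₃ i))).sum_one⟩

namespace CMACrCode

variable {X₁ X₂ X₃ Y₁ Y₂ Y₃ : Type*} {M₁ M₂ M₃ n N m : ℕ}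

theorem g_congr (c : CMACrCode X₁ X₂ X₃ Y₁ Y₂ Y₃ M₁ M₂ M₃ n) (w : Fin M₃) {j j' : Fin n}
    (h : j = j') {p : Fin j → Y₃} {p' : Fin j' → Y₃}
    (hp : ∀ (i : ℕ) (h₁ : i < j) (h₂ : i < j'), p ⟨i, h₁⟩ = p' ⟨i, h₂⟩) :
    c.g j w p = c.g j' w p' := by
  subst h
  exact congrArg _ (funext fun i => hp i i.isLt i.isLt)

/-- Causality: every letter of an earlier block precedes the letter `j`, so the relay has already
seen it. -/
theorem block_index_lt {j : Fin (N * m)} (b : Fin j.divNat) (i : Fin m) :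
    (b : ℕ) * m + i < j := by
  have h1 : (b : ℕ) + 1 ≤ (j : ℕ) / m := b.isLt
  have h2 := Nat.mul_le_of_le_div _ _ _ h1
  have := i.isLt
  nlinarith

/-- A code for blocks of letters, as a code for letters. -/
def unblock (c : CMACrCode (Fin m → X₁) (Fin m → X₂) (Fin m → X₃) (Fin m → Y₁) (Fin m → Y₂)
    (Fin m → Y₃) M₁ M₂ M₃ N) : CMACrCode X₁ X₂ X₃ Y₁ Y₂ Y₃ M₁ M₂ M₃ (N * m) where
  f₁ w j := c.f₁ w j.divNat j.modNat
  f₂ w j := c.f₂ w j.divNat j.modNat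
  g j w past := c.g j.divNat w (fun b i => past ⟨b * m + i, block_index_lt b i⟩) j.modNat
  h₁ y := c.h₁ fun b i => y (finProdFinEquiv (b, i))
  h₂ y := c.h₂ fun b i => y (finProdFinEquiv (b, i))

variable [Fintype Y₁] [Fintype Y₂] [Fintype Y₃] {W : CMACr X₁ X₂ X₃ Y₁ Y₂ Y₃}

/-- Within a block the relay's inputs depend only on completed blocks, so the product over letters
groups into uses of the block channel. -/
theorem outputProb_unblock (c : CMACrCode (Fin m → X₁) (Fin m → X₂) (Fin m → X₃) (Fin m → Y₁)
    (Fin m → Y₂) (Fin m → Y₃) M₁ M₂ M₃ N) (w : Fin M₁ × Fin M₂ × Fin M₃)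
    (y₁ : Fin (N * m) → Y₁) (y₂ : Fin (N * m) → Y₂) (y₃ : Fin (N * m) → Y₃) :
    c.unblock.outputProb W w y₁ y₂ y₃ = c.outputProb (blockChannel W m) w
      (fun b i => y₁ (finProdFinEquiv (b, i))) (fun b i => y₂ (finProdFinEquiv (b, i)))
      (fun b i => y₃ (finProdFinEquiv (b, i))) := by
  unfold outputProb
  rw [← Equiv.prod_comp finProdFinEquiv, Fintype.prod_prod_type]
  refine Finset.prod_congr rfl fun b _ => ?_
  refine (Finset.prod_congr rfl fun i _ => ?_ :
    ∏ i : Fin m, (_ : ℝ) = ∏ i : Fin m, (_ : ℝ))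
  have hb : (finProdFinEquiv (b, i)).divNat = b :=
    congrArg Prod.fst (finProdFinEquiv.symm_apply_apply (b, i))
  have hi : (finProdFinEquiv (b, i)).modNat = i :=
    congrArg Prod.snd (finProdFinEquiv.symm_apply_apply (b, i))
  simp only [unblock]
  rw [c.g_congr w.2.2 hb (p' := fun b' i => y₃ (finProdFinEquiv (b'.castLE b.isLt.le, i)))]
  · rw [hb, hi]
  · intro k h₁ h₂
    refine funext fun i' => congrArg y₃ (Fin.ext ?_)
    simp [finProdFinEquiv, mul_comm, add_comm]
    rfl

/-- Sequences of letters as sequences of blocks. -/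
def blockEquiv (Y : Type*) (N m : ℕ) : (Fin N → Fin m → Y) ≃ (Fin (N * m) → Y) :=
  (Equiv.curry _ _ _).symm.trans (Equiv.arrowCongr finProdFinEquiv (Equiv.refl Y))

theorem errorProb_unblock (c : CMACrCode (Fin m → X₁) (Fin m → X₂) (Fin m → X₃) (Fin m → Y₁)
    (Fin m → Y₂) (Fin m → Y₃) M₁ M₂ M₃ N) :
    c.unblock.errorProb W = c.errorProb (blockChannel W m) := by
  unfold errorProb
  congr 1
  refine Finset.sum_congr rfl fun w _ => ?_
  rw [← Equiv.sum_comp (blockEquiv Y₁ N m).symm]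
  refine Finset.sum_congr rfl fun y₁ _ => ?_
  rw [← Equiv.sum_comp (blockEquiv Y₂ N m).symm]
  refine Finset.sum_congr rfl fun y₂ _ => ?_
  rw [← Equiv.sum_comp (blockEquiv Y₃ N m).symm]
  refine Finset.sum_congr rfl fun y₃ _ => ?_
  rw [outputProb_unblock]
  rfl

end CMACrCode

/-! ### The channel seen by each receiver together with the relay -/

section ReceiverChannels

variable {X₁ X₂ X₃ Y₁ Y₂ Y₃ : Type*} [Fintype Y₁] [Fintype Y₂] [Fintype Y₃]

/-- The channel to the first receiver and the relay. -/
def receiverOne (W : CMACr X₁ X₂ X₃ Y₁ Y₂ Y₃) (x₁ : X₁) (x₂ : X₂) (x₃ : X₃) (t : Y₁ × Y₃) : ℝ :=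
  ∑ y₂, W x₁ x₂ x₃ (t.1, y₂, t.2)

/-- The channel to the second receiver and the relay. -/
def receiverTwo (W : CMACr X₁ X₂ X₃ Y₁ Y₂ Y₃) (x₁ : X₁) (x₂ : X₂) (x₃ : X₃) (t : Y₂ × Y₃) : ℝ :=
  ∑ y₁, W x₁ x₂ x₃ (y₁, t.1, t.2)

theorem receiverOne_isPMF (W : CMACr X₁ X₂ X₃ Y₁ Y₂ Y₃) (x₁ : X₁) (x₂ : X₂) (x₃ : X₃) :
    IsPMF (receiverOne W x₁ x₂ x₃) where
  nonneg t := Finset.sum_nonneg fun _ _ => (stdSimplex_isPMF _).nonneg _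
  sum_one := by
    rw [← (stdSimplex_isPMF (W x₁ x₂ x₃)).sum_one]
    simp only [receiverOne, Fintype.sum_prod_type]
    exact Finset.sum_congr rfl fun y₁ _ => Finset.sum_comm

theorem receiverTwo_isPMF (W : CMACr X₁ X₂ X₃ Y₁ Y₂ Y₃) (x₁ : X₁) (x₂ : X₂) (x₃ : X₃) :
    IsPMF (receiverTwo W x₁ x₂ x₃) where
  nonneg t := Finset.sum_nonneg fun _ _ => (stdSimplex_isPMF _).nonneg _
  sum_one := by
    rw [← (stdSimplex_isPMF (W x₁ x₂ x₃)).sum_one]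
    simp only [receiverTwo, Fintype.sum_prod_type]
    symm
    rw [Finset.sum_comm]
    exact Finset.sum_congr rfl fun y₂ _ => Finset.sum_comm

end ReceiverChannels

/-! ### One code for both receivers -/

namespace BlockEnsemble

variable {Ω X₁ X₂ X₃ Y₁ Y₂ Y₃ K₁ K₂ V K : Type*} [Fintype Ω] [Fintype Y₁] [Fintype Y₂] [Fintype Y₃]
  [Nonempty Ω] [Nonempty Y₁] [Nonempty Y₂] [Nonempty Y₃]
  (E : BlockEnsemble Ω X₁ X₂ X₃ Y₃ K₁ K₂ V K)

/-- The code given by a draw of the ensemble, with the messages written as sequences. -/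
noncomputable def toCode {M₁ M₂ M₃ N : ℕ} (e₁ : Fin M₁ → ℕ → K₁) (e₂ : Fin M₂ → ℕ → K₂)
    (e₃ : Fin M₃ → ℕ → V) (h₁ : (Fin N → Y₁) → Fin M₁ × Fin M₂ × Fin M₃)
    (h₂ : (Fin N → Y₂) → Fin M₁ × Fin M₂ × Fin M₃) (ω : Fin N → Ω) :
    CMACrCode X₁ X₂ X₃ Y₁ Y₂ Y₃ M₁ M₂ M₃ N where
  f₁ w b := E.f₁ (ω b) (e₁ w b)
  f₂ w b := E.f₂ (ω b) (e₂ w b)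
  g b w past := E.f₃ (ω b) (e₃ w b, E.relayIndex (e₃ w) (extendSeq ω) (extendSeq past) b)
  h₁ := h₁
  h₂ := h₂

section

variable {W : CMACr X₁ X₂ X₃ Y₁ Y₂ Y₃} {M₁ M₂ M₃ N : ℕ} (e₁ : Fin M₁ → ℕ → K₁)
  (e₂ : Fin M₂ → ℕ → K₂) (e₃ : Fin M₃ → ℕ → V)
  (h₁ : (Fin N → Y₁) → Fin M₁ × Fin M₂ × Fin M₃) (h₂ : (Fin N → Y₂) → Fin M₁ × Fin M₂ × Fin M₃)
  (ω : Fin N → Ω) (w : Fin M₁ × Fin M₂ × Fin M₃)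

/-- The relay applies `relayIndex` to its past, continued arbitrarily. The index of block `b` uses
only outputs before `b`, so the full output sequence gives the same value. -/
theorem outputProb_toCode (y : Fin N → Y₁ × Y₂ × Y₃) :
    (E.toCode e₁ e₂ e₃ h₁ h₂ ω).outputProb W w (fun j => (y j).1) (fun j => (y j).2.1)
      (fun j => (y j).2.2) =
    ∏ b : Fin N, W (E.f₁ (ω b) (e₁ w.1 b)) (E.f₂ (ω b) (e₂ w.2.1 b))
      (E.f₃ (ω b) (e₃ w.2.2 b,
        E.relayIndex (e₃ w.2.2) (extendSeq ω) (extendSeq fun i => (y i).2.2) b)) (y b) := by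
  unfold CMACrCode.outputProb toCode
  refine Finset.prod_congr rfl fun b _ => ?_
  dsimp only
  rw [E.relayIndex_congr (e₃ w.2.2) (ω := extendSeq ω) (fun _ _ => rfl)
    (y₃' := extendSeq fun i => (y i).2.2)]
  intro i hi
  rw [extendSeq_of_lt _ hi, extendSeq_of_lt _ (hi.trans b.isLt)]
  rfl

/-- The relay reacts to `y₃` only, so for fixed `y₁` and `y₃` the sum over the other receiver's
outputs factors over the blocks. -/
theorem sum_toCode_one (F : (Fin N → Y₁) → ℝ) :
    ∑ y : Fin N → Y₁ × Y₂ × Y₃, (E.toCode e₁ e₂ e₃ h₁ h₂ ω).outputProb W w (fun j => (y j).1)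
      (fun j => (y j).2.1) (fun j => (y j).2.2) * F (fun j => (y j).1) =
    wsum (E.blocksW (receiverOne W) (e₁ w.1) (e₂ w.2.1) (e₃ w.2.2) ω) fun t =>
      F fun b => (t b).1 := by
  simp only [outputProb_toCode]
  rw [← sum_triple_seq fun y₁ y₂ y₃ => (∏ b : Fin N, W (E.f₁ (ω b) (e₁ w.1 b))
    (E.f₂ (ω b) (e₂ w.2.1 b)) (E.f₃ (ω b) (e₃ w.2.2 b,
        E.relayIndex (e₃ w.2.2) (extendSeq ω) (extendSeq y₃) b)) (y₁ b, y₂ b, y₃ b)) * F y₁]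
  unfold wsum blocksW
  rw [← sum_pair_seq fun (y₁ : Fin N → Y₁) (y₃ : Fin N → Y₃) => (∏ b : Fin N,
    receiverOne W (E.f₁ (ω b) (e₁ w.1 b))
    (E.f₂ (ω b) (e₂ w.2.1 b)) (E.f₃ (ω b) (e₃ w.2.2 b,
        E.relayIndex (e₃ w.2.2) (extendSeq ω) (extendSeq y₃) b)) (y₁ b, y₃ b)) * F y₁]
  refine Finset.sum_congr rfl fun y₁ _ => ?_
  rw [Finset.sum_comm]
  refine Finset.sum_congr rfl fun y₃ _ => ?_
  rw [← Finset.sum_mul]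
  congr 1
  unfold receiverOne
  rw [← sum_pi_prod]

theorem sum_toCode_two (F : (Fin N → Y₂) → ℝ) :
    ∑ y : Fin N → Y₁ × Y₂ × Y₃, (E.toCode e₁ e₂ e₃ h₁ h₂ ω).outputProb W w (fun j => (y j).1)
      (fun j => (y j).2.1) (fun j => (y j).2.2) * F (fun j => (y j).2.1) =
    wsum (E.blocksW (receiverTwo W) (e₁ w.1) (e₂ w.2.1) (e₃ w.2.2) ω) fun t =>
      F fun b => (t b).1 := by
  simp only [outputProb_toCode]
  rw [← sum_triple_seq fun y₁ y₂ y₃ => (∏ b : Fin N, W (E.f₁ (ω b) (e₁ w.1 b))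
    (E.f₂ (ω b) (e₂ w.2.1 b)) (E.f₃ (ω b) (e₃ w.2.2 b,
        E.relayIndex (e₃ w.2.2) (extendSeq ω) (extendSeq y₃) b)) (y₁ b, y₂ b, y₃ b)) * F y₂]
  unfold wsum blocksW
  rw [← sum_pair_seq fun (y₂ : Fin N → Y₂) (y₃ : Fin N → Y₃) => (∏ b : Fin N,
    receiverTwo W (E.f₁ (ω b) (e₁ w.1 b))
    (E.f₂ (ω b) (e₂ w.2.1 b)) (E.f₃ (ω b) (e₃ w.2.2 b,
        E.relayIndex (e₃ w.2.2) (extendSeq ω) (extendSeq y₃) b)) (y₂ b, y₃ b)) * F y₂]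
  rw [Finset.sum_comm]
  refine Finset.sum_congr rfl fun y₂ _ => ?_
  rw [Finset.sum_comm]
  refine Finset.sum_congr rfl fun y₃ _ => ?_
  rw [← Finset.sum_mul]
  congr 1
  unfold receiverTwo
  rw [← sum_pi_prod]

end

theorem blocksW_nonneg {Y : Type*} [Fintype Y] [Nonempty Y] {W : X₁ → X₂ → X₃ → Y × Y₃ → ℝ}
    (hW : ∀ x₁ x₂ x₃, IsPMF (W x₁ x₂ x₃)) {N : ℕ} (w₁ : ℕ → K₁) (w₂ : ℕ → K₂)
    (v : ℕ → V) (ω : Fin N → Ω) (t : Fin N → Y × Y₃) : 0 ≤ E.blocksW W w₁ w₂ v ω t :=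
  Finset.prod_nonneg fun _ _ => (hW _ _ _).nonneg _

/-- Some draw of the ensemble is a good code for both receivers. -/
theorem exists_code (W : CMACr X₁ X₂ X₃ Y₁ Y₂ Y₃) [Nonempty K₁] [Nonempty K₂] [Nonempty V]
    {B : ℕ} {δ₁ δ₂ : ℝ}
    (hd₁ : ∃ dec, E.ReceiverErrorLE (receiverOne W) B dec δ₁)
    (hd₂ : ∃ dec, E.ReceiverErrorLE (receiverTwo W) B dec δ₂)
    {M₁ M₂ M₃ : ℕ} (hM₁ : 0 < M₁) (hM₂ : 0 < M₂) (hM₃ : 0 < M₃)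
    (i₁ : Fin M₁ ↪ (Fin B → K₁)) (i₂ : Fin M₂ ↪ (Fin B → K₂)) (i₃ : Fin M₃ ↪ (Fin B → V)) :
    ∃ c : CMACrCode X₁ X₂ X₃ Y₁ Y₂ Y₃ M₁ M₂ M₃ (B + 1), c.errorProb W ≤ δ₁ + δ₂ := by
  obtain ⟨d₁, hd₁⟩ := hd₁
  obtain ⟨d₂, hd₂⟩ := hd₂
  have : Nonempty (Fin M₁) := ⟨⟨0, hM₁⟩⟩
  have : Nonempty (Fin M₂) := ⟨⟨0, hM₂⟩⟩
  have : Nonempty (Fin M₃) := ⟨⟨0, hM₃⟩⟩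
  let back : (Fin B → K₁) × (Fin B → K₂) × (Fin B → V) → Fin M₁ × Fin M₂ × Fin M₃ := fun k =>
    (Function.invFun i₁ k.1, Function.invFun i₂ k.2.1, Function.invFun i₃ k.2.2)
  have hback (w : Fin M₁ × Fin M₂ × Fin M₃) : back (fun b => extendSeq (i₁ w.1) b,
      fun b => extendSeq (i₂ w.2.1) b, fun b => extendSeq (i₃ w.2.2) b) = w := by
    simp only [back, extendSeq_fin]
    refine Prod.ext ?_ (Prod.ext ?_ ?_)
    · exact Function.leftInverse_invFun i₁.injective _
    · exact Function.leftInverse_invFun i₂.injective _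
    · exact Function.leftInverse_invFun i₃.injective _
  let code (ω : Fin (B + 1) → Ω) : CMACrCode X₁ X₂ X₃ Y₁ Y₂ Y₃ M₁ M₂ M₃ (B + 1) :=
    E.toCode (fun w => extendSeq (i₁ w)) (fun w => extendSeq (i₂ w)) (fun w => extendSeq (i₃ w))
      (fun y => back (d₁ ω y)) (fun y => back (d₂ ω y)) ω
  -- Both receivers must succeed with the same draw, so their mean errors are added before a draw is
  -- selected.
  suffices h : wsum (piW fun _ : Fin (B + 1) => E.ρ) (fun ω => (code ω).errorProb W) ≤ δ₁ + δ₂ by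
    obtain ⟨ω, hω⟩ := (IsPMF.piW fun _ : Fin (B + 1) => E.hρ).exists_le h
    exact ⟨code ω, hω⟩
  have hcode (ω : Fin (B + 1) → Ω) : (code ω).errorProb W ≤ (1 / ((M₁ : ℝ) * M₂ * M₃)) *
      ∑ w : Fin M₁ × Fin M₂ × Fin M₃,
        (wsum (E.blocksW (receiverOne W) (extendSeq (i₁ w.1)) (extendSeq (i₂ w.2.1))
          (extendSeq (i₃ w.2.2)) ω) (fun t => ind (d₁ ω (fun b => (t b).1) ≠
            (fun b : Fin B => extendSeq (i₁ w.1) b, fun b : Fin B => extendSeq (i₂ w.2.1) b,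
              fun b : Fin B => extendSeq (i₃ w.2.2) b))) +
        wsum (E.blocksW (receiverTwo W) (extendSeq (i₁ w.1)) (extendSeq (i₂ w.2.1))
          (extendSeq (i₃ w.2.2)) ω) (fun t => ind (d₂ ω (fun b => (t b).1) ≠
            (fun b : Fin B => extendSeq (i₁ w.1) b, fun b : Fin B => extendSeq (i₂ w.2.1) b,
              fun b : Fin B => extendSeq (i₃ w.2.2) b)))) := by
    rw [CMACrCode.errorProb_eq]
    refine mul_le_mul_of_nonneg_left (Finset.sum_le_sum fun w _ => ?_) (by positivity)
    have hone := E.sum_toCode_one (W := W) (fun w => extendSeq (i₁ w)) (fun w => extendSeq (i₂ w))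
      (fun w => extendSeq (i₃ w)) (fun y => back (d₁ ω y)) (fun y => back (d₂ ω y)) ω w
      (fun y₁ => ind (back (d₁ ω y₁) ≠ w))
    have htwo := E.sum_toCode_two (W := W) (fun w => extendSeq (i₁ w)) (fun w => extendSeq (i₂ w))
      (fun w => extendSeq (i₃ w)) (fun y => back (d₁ ω y)) (fun y => back (d₂ ω y)) ω w
      (fun y₂ => ind (back (d₂ ω y₂) ≠ w))
    have hb {k} : back k ≠ w → k ≠ (fun b : Fin B => extendSeq (i₁ w.1) b,
        fun b : Fin B => extendSeq (i₂ w.2.1) b, fun b : Fin B => extendSeq (i₃ w.2.2) b) := by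
      rintro h rfl
      exact h (hback w)
    refine le_trans ?_ (add_le_add
      (wsum_mono (E.blocksW_nonneg (receiverOne_isPMF W) _ _ _ ω) fun t => ind_mono hb)
      (wsum_mono (E.blocksW_nonneg (receiverTwo_isPMF W) _ _ _ ω) fun t => ind_mono hb))
    rw [← hone, ← htwo, ← Finset.sum_add_distrib]
    refine Finset.sum_le_sum fun y _ => ?_
    rw [← mul_add]
    exact mul_le_mul_of_nonneg_left (ind_or_le _ _) (CMACrCode.outputProb_nonneg _ _ _ _ _)
  refine ((IsPMF.piW fun _ : Fin (B + 1) => E.hρ).mono hcode).trans ?_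
  rw [wsum_const_mul, wsum_sum]
  have hsum : ∑ w : Fin M₁ × Fin M₂ × Fin M₃, (δ₁ + δ₂) = (M₁ : ℝ) * M₂ * M₃ * (δ₁ + δ₂) := by
    simp; ring
  have hpos : (0 : ℝ) < (M₁ : ℝ) * M₂ * M₃ := by positivity
  rw [one_div, inv_mul_le_iff₀ hpos, ← hsum]
  refine Finset.sum_le_sum fun w _ => ?_
  rw [wsum_add]
  exact add_le_add (hd₁ _ _ _) (hd₂ _ _ _)

end BlockEnsemble

/-! ### Memoryless extensions and the compress-and-forward ensemble -/

/-- The memoryless extension of a channel to one receiver and the relay. -/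
def powChannel {X₁ X₂ X₃ Y Y₃ : Type*} (W : X₁ → X₂ → X₃ → Y × Y₃ → ℝ) (m : ℕ)
    (x₁ : Fin m → X₁) (x₂ : Fin m → X₂) (x₃ : Fin m → X₃) (t : (Fin m → Y) × (Fin m → Y₃)) : ℝ :=
  ∏ i, W (x₁ i) (x₂ i) (x₃ i) (t.1 i, t.2 i)

theorem powChannel_isPMF {X₁ X₂ X₃ Y Y₃ : Type*} [Fintype Y] [Fintype Y₃]
    {W : X₁ → X₂ → X₃ → Y × Y₃ → ℝ} (hW : ∀ x₁ x₂ x₃, IsPMF (W x₁ x₂ x₃)) (m : ℕ)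
    (x₁ : Fin m → X₁) (x₂ : Fin m → X₂) (x₃ : Fin m → X₃) : IsPMF (powChannel W m x₁ x₂ x₃) where
  nonneg t := Finset.prod_nonneg fun _ _ => (hW _ _ _).nonneg _
  sum_one := by
    rw [Fintype.sum_prod_type]
    unfold powChannel
    rw [sum_pair_seq fun (y : Fin m → Y) (y₃ : Fin m → Y₃) =>
      ∏ i, W (x₁ i) (x₂ i) (x₃ i) (y i, y₃ i)]
    exact (IsPMF.pi fun i => hW (x₁ i) (x₂ i) (x₃ i)).sum_one

section

variable {X₁ X₂ X₃ Y₁ Y₂ Y₃ : Type*} [Fintype Y₁] [Fintype Y₂] [Fintype Y₃]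

theorem receiverOne_blockChannel (W : CMACr X₁ X₂ X₃ Y₁ Y₂ Y₃) (m : ℕ) :
    receiverOne (blockChannel W m) = powChannel (receiverOne W) m := by
  funext x₁ x₂ x₃ t
  unfold receiverOne powChannel
  rw [← sum_pi_prod]
  rfl

theorem receiverTwo_blockChannel (W : CMACr X₁ X₂ X₃ Y₁ Y₂ Y₃) (m : ℕ) :
    receiverTwo (blockChannel W m) = powChannel (receiverTwo W) m := by
  funext x₁ x₂ x₃ t
  unfold receiverTwo powChannel
  rw [← sum_pi_prod]
  rfl

end

namespace CFLaw

section Power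

variable {Q X₁ X₂ X₃ Y Y₃ U : Type*}
  [Fintype Q] [Fintype X₁] [Fintype X₂] [Fintype X₃] [Fintype Y] [Fintype Y₃] [Fintype U]

/-- The law of `m` independent letters. -/
def pow (D : CFLaw Q X₁ X₂ X₃ Y₃ U) (m : ℕ) :
    CFLaw (Fin m → Q) (Fin m → X₁) (Fin m → X₂) (Fin m → X₃) (Fin m → Y₃) (Fin m → U) where
  pQ q := ∏ i, D.pQ (q i)
  p₁ q x := ∏ i, D.p₁ (q i) (x i)
  p₂ q x := ∏ i, D.p₂ (q i) (x i)
  p₃ q x := ∏ i, D.p₃ (q i) (x i)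
  pU q x₃ y₃ u := ∏ i, D.pU (q i) (x₃ i) (y₃ i) (u i)
  hQ := IsPMF.pi fun _ => D.hQ
  h₁ q := IsPMF.pi fun i => D.h₁ (q i)
  h₂ q := IsPMF.pi fun i => D.h₂ (q i)
  h₃ q := IsPMF.pi fun i => D.h₃ (q i)
  hU q x₃ y₃ := IsPMF.pi fun i => D.hU (q i) (x₃ i) (y₃ i)

/-- A sequence of tuples as a tuple of sequences. -/
def tupleEquiv (Q X₁ X₂ X₃ Y Y₃ U : Type*) (m : ℕ) :
    (Fin m → Q × X₁ × X₂ × X₃ × Y × Y₃ × U) ≃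
      (Fin m → Q) × (Fin m → X₁) × (Fin m → X₂) × (Fin m → X₃) × (Fin m → Y) × (Fin m → Y₃) ×
        (Fin m → U) where
  toFun ω := (fun j => cQ (ω j), fun j => c₁ (ω j), fun j => c₂ (ω j), fun j => c₃ (ω j),
    fun j => cY (ω j), fun j => cY₃ (ω j), fun j => cU (ω j))
  invFun t j := (t.1 j, t.2.1 j, t.2.2.1 j, t.2.2.2.1 j, t.2.2.2.2.1 j, t.2.2.2.2.2.1 j,
    t.2.2.2.2.2.2 j)
  left_inv _ := rfl
  right_inv _ := rfl

theorem joint_pow (D : CFLaw Q X₁ X₂ X₃ Y₃ U) (W : X₁ → X₂ → X₃ → Y × Y₃ → ℝ) (m : ℕ)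
    (ω : Fin m → Q × X₁ × X₂ × X₃ × Y × Y₃ × U) :
    (D.pow m).joint (powChannel W m) (tupleEquiv Q X₁ X₂ X₃ Y Y₃ U m ω) =
      ∏ j, D.joint W (ω j) := by
  simp only [joint, Finset.prod_mul_distrib]
  rfl

theorem missProb_pow_le (D : CFLaw Q X₁ X₂ X₃ Y₃ U) {W : X₁ → X₂ → X₃ → Y × Y₃ → ℝ}
    (hW : ∀ x₁ x₂ x₃, IsPMF (W x₁ x₂ x₃)) {m : ℕ} (hm : 0 < m) {δ : ℝ} (hδ : 0 < δ) :
    missProb ((D.pow m).joint (powChannel W m)) c₃ cY cQ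
      ((2 : ℝ) ^ (m * (condMutualInfo (D.joint W) c₃ cY cQ - δ))) ≤
        infoVariance (D.joint W) c₃ cY cQ / (m * δ ^ 2) ∧
    missProb ((D.pow m).joint (powChannel W m)) cU cY (fun ω => (c₃ ω, cQ ω))
      ((2 : ℝ) ^ (m * (condMutualInfo (D.joint W) cU cY (fun ω => (c₃ ω, cQ ω)) - δ))) ≤
        infoVariance (D.joint W) cU cY (fun ω => (c₃ ω, cQ ω)) / (m * δ ^ 2) ∧
    missProb ((D.pow m).joint (powChannel W m)) c₁ (fun ω => (cY ω, cU ω))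
        (fun ω => (c₂ ω, c₃ ω, cQ ω))
      ((2 : ℝ) ^ (m * (condMutualInfo (D.joint W) c₁ (fun ω => (cY ω, cU ω))
        (fun ω => (c₂ ω, c₃ ω, cQ ω)) - δ))) ≤
        infoVariance (D.joint W) c₁ (fun ω => (cY ω, cU ω))
          (fun ω => (c₂ ω, c₃ ω, cQ ω)) / (m * δ ^ 2) ∧
    missProb ((D.pow m).joint (powChannel W m)) c₂ (fun ω => (cY ω, cU ω))
        (fun ω => (c₁ ω, c₃ ω, cQ ω))
      ((2 : ℝ) ^ (m * (condMutualInfo (D.joint W) c₂ (fun ω => (cY ω, cU ω))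
        (fun ω => (c₁ ω, c₃ ω, cQ ω)) - δ))) ≤
        infoVariance (D.joint W) c₂ (fun ω => (cY ω, cU ω))
          (fun ω => (c₁ ω, c₃ ω, cQ ω)) / (m * δ ^ 2) ∧
    missProb ((D.pow m).joint (powChannel W m)) (fun ω => (c₁ ω, c₂ ω)) (fun ω => (cY ω, cU ω))
        (fun ω => (c₃ ω, cQ ω))
      ((2 : ℝ) ^ (m * (condMutualInfo (D.joint W) (fun ω => (c₁ ω, c₂ ω)) (fun ω => (cY ω, cU ω))
        (fun ω => (c₃ ω, cQ ω)) - δ))) ≤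
        infoVariance (D.joint W) (fun ω => (c₁ ω, c₂ ω)) (fun ω => (cY ω, cU ω))
          (fun ω => (c₃ ω, cQ ω)) / (m * δ ^ 2) ∧
    denseProb ((D.pow m).joint (powChannel W m)) cY₃ cU (fun ω => (c₃ ω, cQ ω))
      ((2 : ℝ) ^ (m * (condMutualInfo (D.joint W) cY₃ cU (fun ω => (c₃ ω, cQ ω)) + δ))) ≤
        infoVariance (D.joint W) cY₃ cU (fun ω => (c₃ ω, cQ ω)) / (m * δ ^ 2) := by
  refine ⟨?_, ?_, ?_, ?_, ?_, ?_⟩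
  rotate_right
  · refine denseProb_power_le hm (D.joint_isPMF hW) (tupleEquiv Q X₁ X₂ X₃ Y Y₃ U m)
      (D.joint_pow W m) (fun ω ω' => ?_) (fun ω ω' => ?_) (fun ω ω' => ?_) hδ <;>
      simp [tupleEquiv, funext_iff, forall_and]
  all_goals
    refine missProb_power_le hm (D.joint_isPMF hW) (tupleEquiv Q X₁ X₂ X₃ Y Y₃ U m)
      (D.joint_pow W m) (fun ω ω' => ?_) (fun ω ω' => ?_) (fun ω ω' => ?_) hδ <;>
      simp [tupleEquiv, funext_iff, forall_and]

theorem missProb_pow_direct_le (D : CFLaw Q X₁ X₂ X₃ Y₃ U) {W : X₁ → X₂ → X₃ → Y × Y₃ → ℝ}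
    (hW : ∀ x₁ x₂ x₃, IsPMF (W x₁ x₂ x₃)) {m : ℕ} (hm : 0 < m) {δ : ℝ} (hδ : 0 < δ) :
    missProb ((D.pow m).joint (powChannel W m)) c₁ cY (fun ω => (c₂ ω, cQ ω))
      ((2 : ℝ) ^ (m * (condMutualInfo (D.joint W) c₁ cY (fun ω => (c₂ ω, cQ ω)) - δ))) ≤
        infoVariance (D.joint W) c₁ cY (fun ω => (c₂ ω, cQ ω)) / (m * δ ^ 2) ∧
    missProb ((D.pow m).joint (powChannel W m)) c₂ cY (fun ω => (c₁ ω, cQ ω))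
      ((2 : ℝ) ^ (m * (condMutualInfo (D.joint W) c₂ cY (fun ω => (c₁ ω, cQ ω)) - δ))) ≤
        infoVariance (D.joint W) c₂ cY (fun ω => (c₁ ω, cQ ω)) / (m * δ ^ 2) ∧
    missProb ((D.pow m).joint (powChannel W m)) (fun ω => (c₁ ω, c₂ ω)) cY cQ
      ((2 : ℝ) ^ (m * (condMutualInfo (D.joint W) (fun ω => (c₁ ω, c₂ ω)) cY cQ - δ))) ≤
        infoVariance (D.joint W) (fun ω => (c₁ ω, c₂ ω)) cY cQ / (m * δ ^ 2) := by
  refine ⟨?_, ?_, ?_⟩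
  all_goals
    refine missProb_power_le hm (D.joint_isPMF hW) (tupleEquiv Q X₁ X₂ X₃ Y Y₃ U m)
      (D.joint_pow W m) (fun ω ω' => ?_) (fun ω ω' => ?_) (fun ω ω' => ?_) hδ <;>
      simp [tupleEquiv, funext_iff, forall_and]

end Power

section Ensemble

variable {Q X₁ X₂ X₃ Y Y₃ U K₁ K₂ V K : Type*}
  [Fintype Q] [Fintype X₁] [Fintype X₂] [Fintype X₃] [Fintype Y] [Fintype Y₃] [Fintype U]
  [Fintype K₁] [Fintype K₂] [Fintype V] [Fintype K]
  [DecidableEq Y₃] [DecidableEq K₁] [DecidableEq K₂] [DecidableEq V]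
  [DecidableEq K] [Nonempty K] [Nonempty K₁] [Nonempty K₂] [Nonempty V]

/-- The ensemble of block codes of compress-and-forward. -/
noncomputable def ensemble (D : CFLaw Q X₁ X₂ X₃ Y₃ U) {P : Q → X₃ → U → ℝ}
    (hP : ∀ q x₃, IsPMF (P q x₃)) (K₁ K₂ V K : Type*) [Fintype K₁] [Fintype K₂] [Fintype V]
    [Fintype K] [DecidableEq K₁] [DecidableEq K₂] [DecidableEq V]
    [DecidableEq K] [Nonempty K] :
    BlockEnsemble (BlockCodebook Q X₁ X₂ X₃ Y₃ U K₁ K₂ (V × K) K) X₁ X₂ X₃ Y₃ K₁ K₂ V K where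
  ρ := D.codebookW P
  hρ := D.codebookW_isPMF hP
  f₁ ω w := ω.2.1 w
  f₂ ω w := ω.2.2.1 w
  f₃ ω s := (ω.2.2.2 s).1
  κ ω s y₃ := (ω.2.2.2 s).2.2 y₃
  k₀ := Classical.arbitrary K

variable [Nonempty Y] [Nonempty Y₃] (D : CFLaw Q X₁ X₂ X₃ Y₃ U) {W : X₁ → X₂ → X₃ → Y × Y₃ → ℝ}

/-- The side information is the list, valid if it contains the true index and has at most `l₀`
entries; the initial index is known, so it starts as a singleton. The codebook law is a parameter
`P` with an equation, so that both receivers, whose channels `W` differ, can refer to the same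
ensemble. -/
theorem exists_decoder_of_relay_le (hW : ∀ x₁ x₂ x₃, IsPMF (W x₁ x₂ x₃)) {P : Q → X₃ → U → ℝ}
    (hP : ∀ q x₃, IsPMF (P q x₃)) (hPW : P = D.pUX W)
    [Nonempty (BlockCodebook Q X₁ X₂ X₃ Y₃ U K₁ K₂ (V × K) K)]
    {γ₀ γ₁ γ₂ γa γb γc : ℝ} (hγ₀ : 0 < γ₀) (hγ₁ : 0 < γ₁) (hγ₂ : 0 < γ₂) (hγa : 0 < γa)
    (hγb : 0 < γb) (hγc : 0 < γc) {l₀ : ℕ} (hl₀ : 0 < l₀) {ε : ℝ}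
    (h : missProb (D.joint W) c₃ cY cQ γ₁ +
      missProb (D.joint W) cU cY (fun ω => (c₃ ω, cQ ω)) γ₂ +
      (missProb (D.joint W) c₁ (fun ω => (cY ω, cU ω)) (fun ω => (c₂ ω, c₃ ω, cQ ω)) γa +
      missProb (D.joint W) c₂ (fun ω => (cY ω, cU ω)) (fun ω => (c₁ ω, c₃ ω, cQ ω)) γb +
      missProb (D.joint W) (fun ω => (c₁ ω, c₂ ω)) (fun ω => (cY ω, cU ω))
        (fun ω => (c₃ ω, cQ ω)) γc +
      (Fintype.card K₁ - 1 : ℝ) / γa + (Fintype.card K₂ - 1 : ℝ) / γb +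
      (Fintype.card K₁ - 1 : ℝ) * (Fintype.card K₂ - 1 : ℝ) / γc) +
      (denseProb (D.joint W) cY₃ cU (fun ω => (c₃ ω, cQ ω)) γ₀ + √(γ₀ / Fintype.card K)) +
      Fintype.card V * l₀ / γ₁ + Fintype.card K / (l₀ * γ₂) ≤ ε) (B : ℕ) :
    ∃ dec, (D.ensemble hP K₁ K₂ V K).ReceiverErrorLE W B dec ((B + 1 : ℕ) * ε) := by
  subst hPW
  have key (w₁ : K₁) (w₂ : K₂) (s : V × K) {l : Finset K} (hsl : s.2 ∈ l) (hl : l.card ≤ l₀) :=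
    (D.relay_receiver hW hγ₀ hγ₁ hγ₂ hγa hγb hγc hl₀ w₁ w₂ s hsl hl).trans h
  have hε : 0 ≤ ε := by
    refine le_trans ?_ (key (Classical.arbitrary K₁) (Classical.arbitrary K₂)
      (Classical.arbitrary V, Classical.arbitrary K)
      (Finset.mem_singleton_self (Classical.arbitrary K)) (by rw [Finset.card_singleton]; exact hl₀))
    exact wsum_nonneg (D.codebookW_isPMF hP).nonneg fun _ =>
      wsum_nonneg (hW _ _ _).nonneg fun _ => ind_nonneg _
  refine BlockEnsemble.exists_decoder_of_relay (D.ensemble hP K₁ K₂ V K) hW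
    (valid := fun (l : Finset K) k => k ∈ l ∧ l.card ≤ l₀) (l₀ := {Classical.arbitrary K})
    ⟨Finset.mem_singleton_self _, by rw [Finset.card_singleton]; exact hl₀⟩
    (fun ω l y => D.decodeRelay W γ₁ ω l y) (fun ω s y => D.compressionList W γ₂ ω s y)
    (fun ω s k y => D.decodePair W γa γb γc ω s k y) hε
    (fun w₁ w₂ s l hl => ?_) B
  refine le_trans ?_ (key w₁ w₂ s hl.1 hl.2)
  refine (D.codebookW_isPMF hP).mono fun ω => (hW _ _ _).mono fun t => ind_mono ?_
  rintro (h | h | h)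
  · exact Or.inl h
  · rw [not_and_or, not_le] at h
    rcases h with h | h
    · exact Or.inr (Or.inl h)
    · exact Or.inr (Or.inr (Or.inl h))
  · exact Or.inr (Or.inr (Or.inr h))

theorem exists_decoder_of_direct_le [Subsingleton V] (hW : ∀ x₁ x₂ x₃, IsPMF (W x₁ x₂ x₃))
    {P : Q → X₃ → U → ℝ} (hP : ∀ q x₃, IsPMF (P q x₃))
    [Nonempty (BlockCodebook Q X₁ X₂ X₃ Y₃ U K₁ K₂ (V × K) K)]
    {γa γb γc : ℝ} (hγa : 0 < γa) (hγb : 0 < γb) (hγc : 0 < γc) {ε : ℝ}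
    (h : missProb (D.joint W) c₁ cY (fun ω => (c₂ ω, cQ ω)) γa +
      missProb (D.joint W) c₂ cY (fun ω => (c₁ ω, cQ ω)) γb +
      missProb (D.joint W) (fun ω => (c₁ ω, c₂ ω)) cY cQ γc +
      (Fintype.card K₁ - 1 : ℝ) / γa + (Fintype.card K₂ - 1 : ℝ) / γb +
      (Fintype.card K₁ - 1 : ℝ) * (Fintype.card K₂ - 1 : ℝ) / γc ≤ ε) (B : ℕ) :
    ∃ dec, (D.ensemble hP K₁ K₂ V K).ReceiverErrorLE W B dec ((B + 1 : ℕ) * ε) := by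
  have key (w₁ : K₁) (w₂ : K₂) (s : V × K) :=
    (D.direct_receiver (K := K) hW hP hγa hγb hγc w₁ w₂ s).trans h
  have hε : 0 ≤ ε := by
    refine le_trans ?_ (key (Classical.arbitrary K₁) (Classical.arbitrary K₂)
      (Classical.arbitrary V, Classical.arbitrary K))
    exact wsum_nonneg (D.codebookW_isPMF hP).nonneg fun _ =>
      wsum_nonneg (hW _ _ _).nonneg fun _ => ind_nonneg _
  exact BlockEnsemble.exists_decoder_of_direct (D.ensemble hP K₁ K₂ V K) hW
    (fun ω y => D.decodePairDirect W γa γb γc ω y) hε key B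

end Ensemble

/-- The law of the compression codewords involves only the relay's output, whose law is the same in
both receiver channels. One codebook therefore suits both. -/
theorem pUX_receiverOne_eq {Q X₁ X₂ X₃ Y₁ Y₂ Y₃ U : Type*} [Fintype Q] [Fintype X₁] [Fintype X₂]
    [Fintype X₃] [Fintype Y₁] [Fintype Y₂] [Fintype Y₃] [Fintype U]
    (D : CFLaw Q X₁ X₂ X₃ Y₃ U) (W : CMACr X₁ X₂ X₃ Y₁ Y₂ Y₃) :
    D.pUX (receiverOne W) = D.pUX (receiverTwo W) := by
  funext q x₃ u
  unfold pUX
  refine wsum_congr fun x₁ => wsum_congr fun x₂ => ?_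
  simp only [wsum, receiverOne, receiverTwo, Fintype.sum_prod_type, Finset.sum_mul]
  rw [Finset.sum_comm' (t' := (Finset.univ : Finset Y₃)) (s' := fun _ => (Finset.univ : Finset Y₁))
    (by simp)]
  rw [Finset.sum_comm (s := (Finset.univ : Finset Y₂))]
  exact Finset.sum_congr rfl fun y₃ _ => Finset.sum_comm

end CFLaw

/-! ### Asymptotics of the numbers of messages -/

section MessageCount

theorem two_rpow_pos (x : ℝ) : 0 < (2 : ℝ) ^ x := Real.rpow_pos_of_pos two_pos x

theorem messageCount_pos (R : ℝ) (n : ℕ) : 0 < messageCount R n :=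
  Nat.ceil_pos.2 (two_rpow_pos _)

instance (R : ℝ) (n : ℕ) : Nonempty (Fin (messageCount R n)) := ⟨⟨0, messageCount_pos R n⟩⟩

theorem le_messageCount (R : ℝ) (n : ℕ) : (2 : ℝ) ^ ((n : ℝ) * R) ≤ messageCount R n :=
  Nat.le_ceil _

theorem messageCount_sub_one_le (R : ℝ) (n : ℕ) :
    (messageCount R n : ℝ) - 1 ≤ (2 : ℝ) ^ ((n : ℝ) * R) := by
  have := Nat.ceil_lt_add_one (two_rpow_pos ((n : ℝ) * R)).le
  unfold messageCount
  linarith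

theorem messageCount_sub_one_nonneg (R : ℝ) (n : ℕ) : 0 ≤ (messageCount R n : ℝ) - 1 :=
  sub_nonneg.2 (by exact_mod_cast messageCount_pos R n)

theorem messageCount_le_two_mul {R : ℝ} (hR : 0 ≤ R) (n : ℕ) :
    (messageCount R n : ℝ) ≤ 2 * (2 : ℝ) ^ ((n : ℝ) * R) := by
  have h1 := messageCount_sub_one_le R n
  have h2 := Real.one_le_rpow one_le_two (mul_nonneg n.cast_nonneg hR)
  linarith

theorem messageCount_zero (n : ℕ) : messageCount 0 n = 1 := by simp [messageCount]

theorem tendsto_two_rpow_mul {s : ℝ} (hs : s < 0) :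
    Tendsto (fun m : ℕ => (2 : ℝ) ^ ((m : ℝ) * s)) atTop (𝓝 0) := by
  have h : (fun m : ℕ => (2 : ℝ) ^ ((m : ℝ) * s)) = fun m : ℕ => ((2 : ℝ) ^ s) ^ m := by
    funext m
    rw [mul_comm, Real.rpow_mul two_pos.le, Real.rpow_natCast]
  rw [h]
  exact tendsto_pow_atTop_nhds_zero_of_lt_one (two_rpow_pos s).le
    (Real.rpow_lt_one_of_one_lt_of_neg one_lt_two hs)

theorem tendsto_zero_of_le_rpow {f : ℕ → ℝ} (h0 : ∀ m, 0 ≤ f m) {C s : ℝ} (hs : s < 0)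
    (h : ∀ m : ℕ, f m ≤ C * (2 : ℝ) ^ ((m : ℝ) * s)) : Tendsto f atTop (𝓝 0) := by
  refine squeeze_zero h0 h ?_
  simpa using (tendsto_two_rpow_mul hs).const_mul C

theorem two_rpow_mul_add (m : ℕ) (s t : ℝ) :
    (2 : ℝ) ^ ((m : ℝ) * s) * (2 : ℝ) ^ ((m : ℝ) * t) = (2 : ℝ) ^ ((m : ℝ) * (s + t)) := by
  rw [← Real.rpow_add two_pos, mul_add]

theorem two_rpow_mul_sub (m : ℕ) (s t : ℝ) :
    (2 : ℝ) ^ ((m : ℝ) * s) / (2 : ℝ) ^ ((m : ℝ) * t) = (2 : ℝ) ^ ((m : ℝ) * (s - t)) := by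
  rw [← Real.rpow_sub two_pos, mul_sub]

theorem tendsto_div_mul_sq (V δ : ℝ) :
    Tendsto (fun m : ℕ => V / ((m : ℝ) * δ ^ 2)) atTop (𝓝 0) := by
  have h := tendsto_const_div_atTop_nhds_zero_nat (V / δ ^ 2)
  refine h.congr fun m => ?_
  rw [div_div, mul_comm]

/-- At rate zero there is a single message, hence no wrong one, and `s` is arbitrary. This matters
for the closed conditions, where a zero rate can face zero information. -/
theorem tendsto_messageCount_sub_one_div {R s : ℝ} (h : R = 0 ∨ R < s) :
    Tendsto (fun m : ℕ => ((messageCount R m : ℝ) - 1) / (2 : ℝ) ^ ((m : ℝ) * s)) atTop (𝓝 0) := by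
  rcases h with rfl | h
  · simp [messageCount_zero]
  · refine tendsto_zero_of_le_rpow (fun m => div_nonneg (messageCount_sub_one_nonneg _ _)
      (two_rpow_pos _).le) (sub_neg.2 h) (C := 1) fun m => ?_
    rw [one_mul, ← two_rpow_mul_sub]
    exact div_le_div_of_nonneg_right (messageCount_sub_one_le R m) (two_rpow_pos _).le

theorem tendsto_messageCount_mul_sub_one_div {R R' s : ℝ} (h : R = 0 ∨ R' = 0 ∨ R + R' < s) :
    Tendsto (fun m : ℕ => ((messageCount R m : ℝ) - 1) * ((messageCount R' m : ℝ) - 1) /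
      (2 : ℝ) ^ ((m : ℝ) * s)) atTop (𝓝 0) := by
  rcases h with rfl | rfl | h
  · simp [messageCount_zero]
  · simp [messageCount_zero]
  · refine tendsto_zero_of_le_rpow (fun m => div_nonneg (mul_nonneg
      (messageCount_sub_one_nonneg _ _) (messageCount_sub_one_nonneg _ _))
      (two_rpow_pos _).le) (sub_neg.2 h) (C := 1) fun m => ?_
    rw [one_mul, ← two_rpow_mul_sub, ← two_rpow_mul_add]
    exact div_le_div_of_nonneg_right (mul_le_mul (messageCount_sub_one_le R m)
      (messageCount_sub_one_le R' m) (messageCount_sub_one_nonneg _ _) (two_rpow_pos _).le)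
      (two_rpow_pos _).le

theorem tendsto_sqrt_div_messageCount {s R : ℝ} (h : s < R) :
    Tendsto (fun m : ℕ => √((2 : ℝ) ^ ((m : ℝ) * s) / (messageCount R m : ℝ))) atTop (𝓝 0) := by
  have h1 : Tendsto (fun m : ℕ => (2 : ℝ) ^ ((m : ℝ) * s) / (messageCount R m : ℝ))
      atTop (𝓝 0) := by
    refine tendsto_zero_of_le_rpow (fun m => div_nonneg (two_rpow_pos _).le (Nat.cast_nonneg _))
      (sub_neg.2 h) (C := 1) fun m => ?_
    rw [one_mul, ← two_rpow_mul_sub]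
    exact div_le_div_of_nonneg_left (two_rpow_pos _).le (two_rpow_pos _) (le_messageCount R m)
  have h2 := (Real.continuous_sqrt.tendsto 0).comp h1
  rwa [Real.sqrt_zero] at h2

theorem tendsto_messageCount_mul_div {R R' s : ℝ} (hR : 0 ≤ R) (hR' : 0 ≤ R') (h : R + R' < s) :
    Tendsto (fun m : ℕ => (messageCount R m : ℝ) * (messageCount R' m : ℝ) /
      (2 : ℝ) ^ ((m : ℝ) * s)) atTop (𝓝 0) := by
  refine tendsto_zero_of_le_rpow (fun m => by have := two_rpow_pos ((m : ℝ) * s); positivity)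
    (sub_neg.2 h) (C := 4) fun m => ?_
  rw [← two_rpow_mul_sub, ← two_rpow_mul_add, ← mul_div_assoc]
  refine div_le_div_of_nonneg_right ?_ (two_rpow_pos _).le
  refine (mul_le_mul (messageCount_le_two_mul hR m) (messageCount_le_two_mul hR' m)
    (Nat.cast_nonneg _) (by have := two_rpow_pos ((m : ℝ) * R); positivity)).trans (le_of_eq ?_)
  ring

/-- For the list of compression indices: `R` is the codebook rate, `s` the exponent by which the
test thins it out, and `R'` the allowed list rate. -/
theorem tendsto_messageCount_div_mul {R R' s : ℝ} (hR : 0 ≤ R) (h : R < R' + s) :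
    Tendsto (fun m : ℕ => (messageCount R m : ℝ) / ((messageCount R' m : ℝ) *
      (2 : ℝ) ^ ((m : ℝ) * s))) atTop (𝓝 0) := by
  refine tendsto_zero_of_le_rpow (fun m => by have := two_rpow_pos ((m : ℝ) * s); positivity)
    (sub_neg.2 h) (C := 2) fun m => ?_
  rw [← two_rpow_mul_sub, ← two_rpow_mul_add, ← mul_div_assoc]
  exact div_le_div₀ (by have := two_rpow_pos ((m : ℝ) * R); positivity)
    (messageCount_le_two_mul hR m) (mul_pos (two_rpow_pos _) (two_rpow_pos _))
    (mul_le_mul_of_nonneg_right (le_messageCount R' m) (two_rpow_pos _).le)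

end MessageCount

/-! ### Rates at which a receiver decodes -/

namespace CFLaw

variable {Q X₁ X₂ X₃ Y Y₃ U : Type*}
  [Fintype Q] [Fintype X₁] [Fintype X₂] [Fintype X₃] [Fintype Y] [Fintype Y₃] [Fintype U]
  (D : CFLaw Q X₁ X₂ X₃ Y₃ U) {W : X₁ → X₂ → X₃ → Y × Y₃ → ℝ}

/-- Given the relay's output, the receiver's output carries no information on the compressed
output. -/
theorem condMutualInfo_u_y_eq_zero (W : X₁ → X₂ → X₃ → Y × Y₃ → ℝ) :
    condMutualInfo (D.joint W) cU cY (fun ω => (cY₃ ω, c₃ ω, cQ ω)) = 0 := by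
  refine condMutualInfo_eq_zero _ (g := fun u c => D.pU c.2.2 c.2.1 c.1 u)
    (h := fun y c => D.pQ c.2.2 * D.p₃ c.2.2 c.2.1 * wsum (D.p₁ c.2.2) fun x₁ =>
      wsum (D.p₂ c.2.2) fun x₂ => W x₁ x₂ c.2.1 (y, c.1)) ?_
  rintro u y ⟨y₃, x₃, q⟩
  rw [marginal_eq_wsum, wsum_joint]
  simp only [cQ, c₁, c₂, c₃, cY, cY₃, cU, Prod.mk.injEq, ind_and]
  have h1 (q' : Q) (x₁ : X₁) (x₂ : X₂) (x₃' : X₃) :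
      wsum (W x₁ x₂ x₃') (fun t => wsum (D.pU q' x₃' t.2) fun u' =>
        ind (u' = u) * (ind (t.1 = y) * (ind (t.2 = y₃) * (ind (x₃' = x₃) * ind (q' = q))))) =
      W x₁ x₂ x₃ (y, y₃) * D.pU q x₃ y₃ u * ind (x₃' = x₃) * ind (q' = q) := by
    simp only [wsum_const_mul', wsum_ind_eq, wsum, Fintype.sum_prod_type]
    by_cases h3 : x₃' = x₃
    · by_cases hq : q' = q
      · subst h3 hq
        simp [ind]
      · simp [ind, hq]
    · simp [ind, h3]
  refine (wsum_congr fun q' => wsum_congr fun x₁ => wsum_congr fun x₂ => wsum_congr fun x₃' =>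
    h1 q' x₁ x₂ x₃').trans ?_
  rw [wsum, Finset.sum_eq_single q]
  · simp only [wsum, ind, mul_ite, mul_one, mul_zero, Finset.sum_ite_eq', Finset.mem_univ,
      if_true, Finset.mul_sum]
    refine Finset.sum_congr rfl fun x₁ _ => Finset.sum_congr rfl fun x₂ _ => ?_
    ring
  · intro q' _ hq
    simp [wsum, ind, hq]
  · simp

/-- The chain rule for `I(U; Y, Y₃ | X₃, Q)` in both orders, where `I(U; Y | Y₃, X₃, Q)` vanishes.
The covering rate, less the exponent gained by the receiver's test, is the Wyner-Ziv rate. -/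
theorem condMutualInfo_y₃_u_eq (hW : ∀ x₁ x₂ x₃, IsPMF (W x₁ x₂ x₃)) :
    condMutualInfo (D.joint W) cY₃ cU (fun ω => (c₃ ω, cQ ω)) =
      condMutualInfo (D.joint W) cU cY (fun ω => (c₃ ω, cQ ω)) +
        condMutualInfo (D.joint W) cY₃ cU (fun ω => (c₃ ω, cY ω, cQ ω)) := by
  have hp := (D.joint_isPMF hW).nonneg
  have h1 := condMutualInfo_chain hp cU cY cY₃ (fun ω => (c₃ ω, cQ ω))
  have h2 := condMutualInfo_chain hp cU cY₃ cY (fun ω => (c₃ ω, cQ ω))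
  rw [D.condMutualInfo_u_y_eq_zero] at h2
  have h3 : condMutualInfo (D.joint W) cU (fun ω => (cY ω, cY₃ ω)) (fun ω => (c₃ ω, cQ ω)) =
      condMutualInfo (D.joint W) cU (fun ω => (cY₃ ω, cY ω)) (fun ω => (c₃ ω, cQ ω)) :=
    condMutualInfo_congr hp (fun _ _ => Iff.rfl)
      (fun _ _ => by simp only [Prod.mk.injEq]; tauto) (fun _ _ => Iff.rfl)
  have h4 : condMutualInfo (D.joint W) cU cY₃ (fun ω => (cY ω, c₃ ω, cQ ω)) =
      condMutualInfo (D.joint W) cU cY₃ (fun ω => (c₃ ω, cY ω, cQ ω)) :=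
    condMutualInfo_congr hp (fun _ _ => Iff.rfl) (fun _ _ => Iff.rfl)
      (fun _ _ => by simp only [Prod.mk.injEq]; tauto)
  rw [condMutualInfo_comm hp cY₃ cU, condMutualInfo_comm hp cY₃ cU]
  linarith

/-- The rates for which a receiver can decode with the help of the relay. -/
def RelayRates (W : X₁ → X₂ → X₃ → Y × Y₃ → ℝ) (R₁ R₂ R₃ : ℝ) : Prop :=
  (R₁ = 0 ∨ R₁ < condMutualInfo (D.joint W) c₁ (fun ω => (cY ω, cU ω))
    (fun ω => (c₂ ω, c₃ ω, cQ ω))) ∧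
  (R₂ = 0 ∨ R₂ < condMutualInfo (D.joint W) c₂ (fun ω => (cY ω, cU ω))
    (fun ω => (c₁ ω, c₃ ω, cQ ω))) ∧
  (R₁ = 0 ∨ R₂ = 0 ∨ R₁ + R₂ < condMutualInfo (D.joint W) (fun ω => (c₁ ω, c₂ ω))
    (fun ω => (cY ω, cU ω)) (fun ω => (c₃ ω, cQ ω))) ∧
  R₃ + condMutualInfo (D.joint W) cY₃ cU (fun ω => (c₃ ω, cY ω, cQ ω)) <
    condMutualInfo (D.joint W) c₃ cY cQ

/-- The rates for which a receiver can decode without the relay. -/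
def DirectRates (W : X₁ → X₂ → X₃ → Y × Y₃ → ℝ) (R₁ R₂ R₃ : ℝ) : Prop :=
  (R₁ = 0 ∨ R₁ < condMutualInfo (D.joint W) c₁ cY (fun ω => (c₂ ω, cQ ω))) ∧
  (R₂ = 0 ∨ R₂ < condMutualInfo (D.joint W) c₂ cY (fun ω => (c₁ ω, cQ ω))) ∧
  (R₁ = 0 ∨ R₂ = 0 ∨ R₁ + R₂ < condMutualInfo (D.joint W) (fun ω => (c₁ ω, c₂ ω)) cY cQ) ∧
  R₃ = 0

variable [Nonempty Q] [Nonempty X₁] [Nonempty X₂] [Nonempty X₃] [Nonempty Y] [Nonempty Y₃]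
  [Nonempty U]

/-- For long blocks, the receiver decodes with high probability. -/
def DecodesAt (W : X₁ → X₂ → X₃ → Y × Y₃ → ℝ) (R₁ R₂ R₃ R₀ : ℝ) : Prop :=
  ∃ err : ℕ → ℝ, Tendsto err atTop (𝓝 0) ∧ ∀ m, 0 < m → ∀ {P : (Fin m → Q) → (Fin m → X₃) → (Fin m → U) → ℝ} (hP : ∀ q x₃, IsPMF (P q x₃)),
    P = (D.pow m).pUX (powChannel W m) → ∀ B,
      ∃ dec, ((D.pow m).ensemble hP (Fin (messageCount R₁ m)) (Fin (messageCount R₂ m))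
        (Fin (messageCount R₃ m)) (Fin (messageCount R₀ m))).ReceiverErrorLE (powChannel W m) B dec
          ((B + 1 : ℕ) * err m)

theorem eventually_add_mul_lt {x y : ℝ} (k : ℝ) (h : x < y) :
    ∀ᶠ δ in 𝓝[>] (0 : ℝ), x + k * δ < y := by
  have hc : Continuous fun δ : ℝ => x + k * δ := by fun_prop
  exact (hc.continuousAt.eventually_lt continuousAt_const (by simpa using h)).filter_mono
    nhdsWithin_le_nhds

/-- Stated for all small `δ`, so that a common `δ`, and with it a common compression rate, can be
chosen for both receivers. -/
theorem RelayRates.decodesAt (hW : ∀ x₁ x₂ x₃, IsPMF (W x₁ x₂ x₃)) {R₁ R₂ R₃ : ℝ} (hR₃ : 0 ≤ R₃)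
    (h : D.RelayRates W R₁ R₂ R₃) : ∀ᶠ δ in 𝓝[>] (0 : ℝ), D.DecodesAt W R₁ R₂ R₃
      (condMutualInfo (D.joint W) cY₃ cU (fun ω => (c₃ ω, cQ ω)) + 2 * δ) := by
  obtain ⟨ha, hb, hc, h3⟩ := h
  have ha' : ∀ᶠ δ in 𝓝[>] (0 : ℝ), R₁ = 0 ∨ R₁ < condMutualInfo (D.joint W) c₁
      (fun ω => (cY ω, cU ω)) (fun ω => (c₂ ω, c₃ ω, cQ ω)) - δ := by
    rcases ha with ha | ha
    · exact Eventually.of_forall fun _ => Or.inl ha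
    · filter_upwards [eventually_add_mul_lt 1 ha] with δ hδ
      exact Or.inr (by linarith)
  have hb' : ∀ᶠ δ in 𝓝[>] (0 : ℝ), R₂ = 0 ∨ R₂ < condMutualInfo (D.joint W) c₂
      (fun ω => (cY ω, cU ω)) (fun ω => (c₁ ω, c₃ ω, cQ ω)) - δ := by
    rcases hb with hb | hb
    · exact Eventually.of_forall fun _ => Or.inl hb
    · filter_upwards [eventually_add_mul_lt 1 hb] with δ hδ
      exact Or.inr (by linarith)
  have hc' : ∀ᶠ δ in 𝓝[>] (0 : ℝ), R₁ = 0 ∨ R₂ = 0 ∨ R₁ + R₂ < condMutualInfo (D.joint W)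
      (fun ω => (c₁ ω, c₂ ω)) (fun ω => (cY ω, cU ω)) (fun ω => (c₃ ω, cQ ω)) - δ := by
    rcases hc with hc | hc | hc
    · exact Eventually.of_forall fun _ => Or.inl hc
    · exact Eventually.of_forall fun _ => Or.inr (Or.inl hc)
    · filter_upwards [eventually_add_mul_lt 1 hc] with δ hδ
      exact Or.inr (Or.inr (by linarith))
  -- The factor 5 is the slack `4 δ` of the list rate plus `δ` of the relay threshold.
  filter_upwards [ha', hb', hc', eventually_add_mul_lt 5 h3, self_mem_nhdsWithin] with δ ha hb hc h3
    hδ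
  replace hδ : 0 < δ := hδ
  have hI := D.condMutualInfo_y₃_u_eq hW
  have hp := (D.joint_isPMF hW).nonneg
  have hI0 : 0 ≤ condMutualInfo (D.joint W) cY₃ cU (fun ω => (c₃ ω, cQ ω)) :=
    condMutualInfo_nonneg hp _ _ _
  have ha0 : 0 ≤ condMutualInfo (D.joint W) cY₃ cU (fun ω => (c₃ ω, cY ω, cQ ω)) :=
    condMutualInfo_nonneg hp _ _ _
  set Ia := condMutualInfo (D.joint W) c₁ (fun ω => (cY ω, cU ω)) (fun ω => (c₂ ω, c₃ ω, cQ ω))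
    with hIa
  set Ib := condMutualInfo (D.joint W) c₂ (fun ω => (cY ω, cU ω)) (fun ω => (c₁ ω, c₃ ω, cQ ω))
    with hIb
  set Ic := condMutualInfo (D.joint W) (fun ω => (c₁ ω, c₂ ω)) (fun ω => (cY ω, cU ω))
    (fun ω => (c₃ ω, cQ ω)) with hIc
  set I0 := condMutualInfo (D.joint W) cY₃ cU (fun ω => (c₃ ω, cQ ω)) with hI0_def
  set a := condMutualInfo (D.joint W) cY₃ cU (fun ω => (c₃ ω, cY ω, cQ ω)) with ha_def
  set c := condMutualInfo (D.joint W) c₃ cY cQ with hc_def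
  set I2 := condMutualInfo (D.joint W) cU cY (fun ω => (c₃ ω, cQ ω)) with hI2
  -- Exponents: the compression rate `I0 + 2 δ` exceeds the covering threshold `I0 + δ`; the
  -- expected list has rate at most `I0 + 2 δ - (I2 - δ) = a + 3 δ`, below the list rate `a + 4 δ`;
  -- and `R₃ + a + 4 δ < c - δ`.
  refine ⟨fun m => infoVariance (D.joint W) c₃ cY cQ / (m * δ ^ 2) +
      infoVariance (D.joint W) cU cY (fun ω => (c₃ ω, cQ ω)) / (m * δ ^ 2) +
      (infoVariance (D.joint W) c₁ (fun ω => (cY ω, cU ω)) (fun ω => (c₂ ω, c₃ ω, cQ ω)) /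
        (m * δ ^ 2) +
      infoVariance (D.joint W) c₂ (fun ω => (cY ω, cU ω)) (fun ω => (c₁ ω, c₃ ω, cQ ω)) /
        (m * δ ^ 2) +
      infoVariance (D.joint W) (fun ω => (c₁ ω, c₂ ω)) (fun ω => (cY ω, cU ω))
        (fun ω => (c₃ ω, cQ ω)) / (m * δ ^ 2) +
      ((messageCount R₁ m : ℝ) - 1) / (2 : ℝ) ^ ((m : ℝ) * (Ia - δ)) +
      ((messageCount R₂ m : ℝ) - 1) / (2 : ℝ) ^ ((m : ℝ) * (Ib - δ)) +
      ((messageCount R₁ m : ℝ) - 1) * ((messageCount R₂ m : ℝ) - 1) /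
        (2 : ℝ) ^ ((m : ℝ) * (Ic - δ))) +
      (infoVariance (D.joint W) cY₃ cU (fun ω => (c₃ ω, cQ ω)) / (m * δ ^ 2) +
        √((2 : ℝ) ^ ((m : ℝ) * (I0 + δ)) / (messageCount (I0 + 2 * δ) m : ℝ))) +
      (messageCount R₃ m : ℝ) * (messageCount (a + 4 * δ) m : ℝ) / (2 : ℝ) ^ ((m : ℝ) * (c - δ)) +
      (messageCount (I0 + 2 * δ) m : ℝ) / ((messageCount (a + 4 * δ) m : ℝ) *
        (2 : ℝ) ^ ((m : ℝ) * (I2 - δ))), ?_, ?_⟩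
  · have hv (V : ℝ) := tendsto_div_mul_sq V δ
    have := ((((((hv (infoVariance (D.joint W) c₃ cY cQ)).add
      (hv (infoVariance (D.joint W) cU cY (fun ω => (c₃ ω, cQ ω))))).add
      ((((((hv (infoVariance (D.joint W) c₁ (fun ω => (cY ω, cU ω))
        (fun ω => (c₂ ω, c₃ ω, cQ ω)))).add
      (hv (infoVariance (D.joint W) c₂ (fun ω => (cY ω, cU ω))
        (fun ω => (c₁ ω, c₃ ω, cQ ω))))).add
      (hv (infoVariance (D.joint W) (fun ω => (c₁ ω, c₂ ω)) (fun ω => (cY ω, cU ω))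
        (fun ω => (c₃ ω, cQ ω))))).add (tendsto_messageCount_sub_one_div ha)).add
      (tendsto_messageCount_sub_one_div hb)).add (tendsto_messageCount_mul_sub_one_div hc))).add
      ((hv (infoVariance (D.joint W) cY₃ cU (fun ω => (c₃ ω, cQ ω)))).add
        (tendsto_sqrt_div_messageCount (by linarith : I0 + δ < I0 + 2 * δ)))).add
      (tendsto_messageCount_mul_div (R := R₃) (R' := a + 4 * δ) (s := c - δ) hR₃ (by linarith)
        (by linarith))).add
      (tendsto_messageCount_div_mul (R := I0 + 2 * δ) (R' := a + 4 * δ) (s := I2 - δ)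
        (by linarith) (by linarith)))
    simpa only [add_zero] using this
  · intro m hm P hP hPW B
    refine (D.pow m).exists_decoder_of_relay_le (K₁ := Fin (messageCount R₁ m))
      (K₂ := Fin (messageCount R₂ m)) (V := Fin (messageCount R₃ m))
      (K := Fin (messageCount (I0 + 2 * δ) m)) (powChannel_isPMF hW m) hP hPW
      (γ₀ := (2 : ℝ) ^ ((m : ℝ) * (I0 + δ))) (γ₁ := (2 : ℝ) ^ ((m : ℝ) * (c - δ)))
      (γ₂ := (2 : ℝ) ^ ((m : ℝ) * (I2 - δ))) (γa := (2 : ℝ) ^ ((m : ℝ) * (Ia - δ)))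
      (γb := (2 : ℝ) ^ ((m : ℝ) * (Ib - δ))) (γc := (2 : ℝ) ^ ((m : ℝ) * (Ic - δ)))
      (two_rpow_pos _) (two_rpow_pos _) (two_rpow_pos _) (two_rpow_pos _) (two_rpow_pos _)
      (two_rpow_pos _) (messageCount_pos (a + 4 * δ) m) ?_ B
    obtain ⟨h1, h2, h4, h5, h6, h7⟩ := D.missProb_pow_le hW hm hδ
    simp only [Fintype.card_fin]
    gcongr

/-- The compression rate `R₀` is arbitrary, so this receiver adapts to the rate that the other one
needs. -/
theorem DirectRates.decodesAt (hW : ∀ x₁ x₂ x₃, IsPMF (W x₁ x₂ x₃)) {R₁ R₂ R₃ : ℝ}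
    (h : D.DirectRates W R₁ R₂ R₃) (R₀ : ℝ) : D.DecodesAt W R₁ R₂ R₃ R₀ := by
  obtain ⟨ha, hb, hc, rfl⟩ := h
  have ha' : ∀ᶠ δ in 𝓝[>] (0 : ℝ), R₁ = 0 ∨ R₁ < condMutualInfo (D.joint W) c₁ cY
      (fun ω => (c₂ ω, cQ ω)) - δ := by
    rcases ha with ha | ha
    · exact Eventually.of_forall fun _ => Or.inl ha
    · filter_upwards [eventually_add_mul_lt 1 ha] with δ hδ
      exact Or.inr (by linarith)
  have hb' : ∀ᶠ δ in 𝓝[>] (0 : ℝ), R₂ = 0 ∨ R₂ < condMutualInfo (D.joint W) c₂ cY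
      (fun ω => (c₁ ω, cQ ω)) - δ := by
    rcases hb with hb | hb
    · exact Eventually.of_forall fun _ => Or.inl hb
    · filter_upwards [eventually_add_mul_lt 1 hb] with δ hδ
      exact Or.inr (by linarith)
  have hc' : ∀ᶠ δ in 𝓝[>] (0 : ℝ), R₁ = 0 ∨ R₂ = 0 ∨ R₁ + R₂ < condMutualInfo (D.joint W)
      (fun ω => (c₁ ω, c₂ ω)) cY cQ - δ := by
    rcases hc with hc | hc | hc
    · exact Eventually.of_forall fun _ => Or.inl hc
    · exact Eventually.of_forall fun _ => Or.inr (Or.inl hc)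
    · filter_upwards [eventually_add_mul_lt 1 hc] with δ hδ
      exact Or.inr (Or.inr (by linarith))
  obtain ⟨δ, ⟨⟨ha, hb⟩, hc⟩, hδ⟩ :=
    (((ha'.and hb').and hc').and (self_mem_nhdsWithin : ∀ᶠ δ in 𝓝[>] (0 : ℝ), δ ∈ Set.Ioi 0)).exists
  replace hδ : 0 < δ := hδ
  set Ia := condMutualInfo (D.joint W) c₁ cY (fun ω => (c₂ ω, cQ ω)) with hIa
  set Ib := condMutualInfo (D.joint W) c₂ cY (fun ω => (c₁ ω, cQ ω)) with hIb
  set Ic := condMutualInfo (D.joint W) (fun ω => (c₁ ω, c₂ ω)) cY cQ with hIc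
  refine ⟨fun m => infoVariance (D.joint W) c₁ cY (fun ω => (c₂ ω, cQ ω)) / (m * δ ^ 2) +
      infoVariance (D.joint W) c₂ cY (fun ω => (c₁ ω, cQ ω)) / (m * δ ^ 2) +
      infoVariance (D.joint W) (fun ω => (c₁ ω, c₂ ω)) cY cQ / (m * δ ^ 2) +
      ((messageCount R₁ m : ℝ) - 1) / (2 : ℝ) ^ ((m : ℝ) * (Ia - δ)) +
      ((messageCount R₂ m : ℝ) - 1) / (2 : ℝ) ^ ((m : ℝ) * (Ib - δ)) +
      ((messageCount R₁ m : ℝ) - 1) * ((messageCount R₂ m : ℝ) - 1) /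
        (2 : ℝ) ^ ((m : ℝ) * (Ic - δ)), ?_, ?_⟩
  · have hv (V : ℝ) := tendsto_div_mul_sq V δ
    have := (((((hv (infoVariance (D.joint W) c₁ cY (fun ω => (c₂ ω, cQ ω)))).add
      (hv (infoVariance (D.joint W) c₂ cY (fun ω => (c₁ ω, cQ ω))))).add
      (hv (infoVariance (D.joint W) (fun ω => (c₁ ω, c₂ ω)) cY cQ))).add
      (tendsto_messageCount_sub_one_div ha)).add
      (tendsto_messageCount_sub_one_div hb)).add (tendsto_messageCount_mul_sub_one_div hc)
    simpa only [add_zero] using this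
  · intro m hm P hP hPW B
    have : Subsingleton (Fin (messageCount 0 m)) :=
      Fin.subsingleton_iff_le_one.2 (messageCount_zero m).le
    refine (D.pow m).exists_decoder_of_direct_le (K₁ := Fin (messageCount R₁ m))
      (K₂ := Fin (messageCount R₂ m)) (V := Fin (messageCount 0 m))
      (K := Fin (messageCount R₀ m)) (powChannel_isPMF hW m) hP
      (γa := (2 : ℝ) ^ ((m : ℝ) * (Ia - δ)))
      (γb := (2 : ℝ) ^ ((m : ℝ) * (Ib - δ))) (γc := (2 : ℝ) ^ ((m : ℝ) * (Ic - δ)))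
      (two_rpow_pos _) (two_rpow_pos _) (two_rpow_pos _) ?_ B
    obtain ⟨h1, h2, h4⟩ := D.missProb_pow_direct_le hW hm hδ
    simp only [Fintype.card_fin]
    gcongr

end CFLaw

/-! ### From good codes to achievable rates -/

section Codes

variable {X₁ X₂ X₃ Y₁ Y₂ Y₃ : Type*} [Fintype Y₁] [Fintype Y₂] [Fintype Y₃]
  [Nonempty X₁] [Nonempty X₂] [Nonempty X₃]

instance {M₁ M₂ M₃ n : ℕ} [Nonempty (Fin M₁)] [Nonempty (Fin M₂)] [Nonempty (Fin M₃)] :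
    Nonempty (CMACrCode X₁ X₂ X₃ Y₁ Y₂ Y₃ M₁ M₂ M₃ n) :=
  ⟨⟨Classical.arbitrary _, Classical.arbitrary _, fun _ => Classical.arbitrary _,
    Classical.arbitrary _, Classical.arbitrary _⟩⟩

/-- The good codes may depend on `ε`. Taking for each `n` a code within `1 / (n + 1)` of the infimum
of the error probabilities gives one sequence that serves all `ε`. -/
theorem achievable_of_eventually (W : CMACr X₁ X₂ X₃ Y₁ Y₂ Y₃) {R₁ R₂ R₃ : ℝ} (hR₁ : 0 ≤ R₁)
    (hR₂ : 0 ≤ R₂) (hR₃ : 0 ≤ R₃)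
    (h : ∀ ε > 0, ∀ᶠ n in atTop, ∃ c : CMACrCode X₁ X₂ X₃ Y₁ Y₂ Y₃ (messageCount R₁ n)
      (messageCount R₂ n) (messageCount R₃ n) n, c.errorProb W ≤ ε) :
    Achievable W (R₁, R₂, R₃) := by
  refine ⟨hR₁, hR₂, hR₃, ?_⟩
  have hex (n : ℕ) : ∃ c : CMACrCode X₁ X₂ X₃ Y₁ Y₂ Y₃ (messageCount R₁ n)
      (messageCount R₂ n) (messageCount R₃ n) n, ∀ c' : CMACrCode X₁ X₂ X₃ Y₁ Y₂ Y₃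
        (messageCount R₁ n) (messageCount R₂ n) (messageCount R₃ n) n,
          c.errorProb W ≤ c'.errorProb W + 1 / (n + 1) := by
    have hlt := exists_lt_of_ciInf_lt (lt_add_of_pos_right (⨅ c : CMACrCode X₁ X₂ X₃ Y₁ Y₂ Y₃
      (messageCount R₁ n) (messageCount R₂ n) (messageCount R₃ n) n, c.errorProb W)
      (Nat.one_div_pos_of_nat (α := ℝ) (n := n)))
    obtain ⟨c, hc⟩ := hlt
    refine ⟨c, fun c' => hc.le.trans (add_le_add_left (ciInf_le ⟨0, ?_⟩ c') _)⟩
    rintro _ ⟨c, rfl⟩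
    exact c.errorProb_nonneg
  choose c hc using hex
  refine ⟨c, ?_⟩
  rw [Metric.tendsto_atTop']
  intro ε hε
  have h1 := (tendsto_one_div_add_atTop_nhds_zero_nat (𝕜 := ℝ)).eventually_lt_const (half_pos hε)
  obtain ⟨N, hN⟩ := eventually_atTop.1 ((h (ε / 2) (half_pos hε)).and h1)
  refine ⟨N, fun n hn => ?_⟩
  obtain ⟨⟨c', hc'⟩, h2⟩ := hN n hn.le
  rw [Real.dist_eq, sub_zero, abs_of_nonneg (c n).errorProb_nonneg]
  have := hc n c'
  linarith

end Codes

theorem messageCount_le_pow {R R' : ℝ} {n m B : ℕ} (h : n * R ≤ m * B * R') :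
    messageCount R n ≤ messageCount R' m ^ B := by
  refine Nat.ceil_le.2 ?_
  rw [Nat.cast_pow]
  refine le_trans ?_ (pow_le_pow_left₀ (two_rpow_pos _).le (le_messageCount R' m) B)
  rw [← Real.rpow_natCast, ← Real.rpow_mul two_pos.le]
  exact Real.rpow_le_rpow_of_exponent_le one_le_two (h.trans (le_of_eq (by ring)))

namespace CFLaw

variable {Q X₁ X₂ X₃ Y₁ Y₂ Y₃ U : Type*}
  [Fintype Q] [Fintype X₁] [Fintype X₂] [Fintype X₃] [Fintype Y₁] [Fintype Y₂] [Fintype Y₃]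
  [Fintype U] [Nonempty Q] [Nonempty X₁] [Nonempty X₂] [Nonempty X₃] [Nonempty Y₁] [Nonempty Y₂]
  [Nonempty Y₃] [Nonempty U]

/-- If both receivers decode at slightly higher rates, then the rates are achievable. -/
theorem achievable_of_decodesAt (D : CFLaw Q X₁ X₂ X₃ Y₃ U) (W : CMACr X₁ X₂ X₃ Y₁ Y₂ Y₃)
    {R₁ R₂ R₃ R₀ η : ℝ} (hR₁ : 0 ≤ R₁) (hR₂ : 0 ≤ R₂) (hR₃ : 0 ≤ R₃) (hη : 0 < η)
    (h₁ : D.DecodesAt (receiverOne W) ((1 + η) * R₁) ((1 + η) * R₂) ((1 + η) * R₃) R₀)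
    (h₂ : D.DecodesAt (receiverTwo W) ((1 + η) * R₁) ((1 + η) * R₂) ((1 + η) * R₃) R₀) :
    Achievable W (R₁, R₂, R₃) := by
  obtain ⟨e₁, he₁, h₁⟩ := h₁
  obtain ⟨e₂, he₂, h₂⟩ := h₂
  refine achievable_of_eventually W hR₁ hR₂ hR₃ fun ε hε => ?_
  -- The gain `B η ≥ 2` in the rates pays for two losses of `m` letters each: the last block, whose
  -- messages are not decoded, and the rounding of `n` to a multiple of `B + 1`, which costs at most
  -- `B + 1 ≤ m` letters.
  obtain ⟨B, hB⟩ := exists_nat_ge (2 / η)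
  rw [div_le_iff₀ hη] at hB
  have herr : Tendsto (fun m => ((B + 1 : ℕ) : ℝ) * e₁ m + ((B + 1 : ℕ) : ℝ) * e₂ m)
      atTop (𝓝 0) := by
    simpa using (he₁.const_mul ((B + 1 : ℕ) : ℝ)).add (he₂.const_mul ((B + 1 : ℕ) : ℝ))
  have hm : ∀ᶠ m in atTop, B + 1 ≤ m ∧
      ((B + 1 : ℕ) : ℝ) * e₁ m + ((B + 1 : ℕ) : ℝ) * e₂ m ≤ ε :=
    (eventually_ge_atTop (B + 1)).and (herr.eventually_le_const hε)
  filter_upwards [(Nat.tendsto_div_const_atTop (Nat.succ_ne_zero B)).eventually hm] with n hn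
  set m := n / (B + 1) with hm_def
  obtain ⟨hmB, hme⟩ := hn
  have hm0 : 0 < m := by omega
  have hlen : (B + 1) * m ≤ n := Nat.mul_div_le n (B + 1)
  have hn : n < (B + 1) * (m + 1) := by
    rw [hm_def]; exact Nat.lt_mul_div_succ n (Nat.succ_pos B)
  have hrate {R : ℝ} (hR : 0 ≤ R) : (n : ℝ) * R ≤ m * B * ((1 + η) * R) := by
    have h1 : (n : ℝ) ≤ ((B : ℝ) + 1) * (m + 1) := by exact_mod_cast hn.le
    have h2 : (B : ℝ) + 1 ≤ m := by exact_mod_cast hmB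
    have h3 : (n : ℝ) ≤ m * B * (1 + η) := by nlinarith
    calc (n : ℝ) * R ≤ m * B * (1 + η) * R := mul_le_mul_of_nonneg_right h3 hR
      _ = _ := by ring
  have hemb {R : ℝ} (hR : 0 ≤ R) : Nonempty (Fin (messageCount R n) ↪
      (Fin B → Fin (messageCount ((1 + η) * R) m))) := by
    refine Function.Embedding.nonempty_of_card_le ?_
    simpa using messageCount_le_pow (hrate hR)
  obtain ⟨i₁⟩ := hemb hR₁
  obtain ⟨i₂⟩ := hemb hR₂
  obtain ⟨i₃⟩ := hemb hR₃
  -- The codebook law is fixed through the first receiver's channel; `pUX_receiverOne_eq` makes it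
  -- valid for the second.
  have hP := (D.pow m).pUX_isPMF (receiverOne_isPMF (blockChannel W m))
  have d₁ := h₁ m hm0 hP (by rw [receiverOne_blockChannel]) B
  have d₂ := h₂ m hm0 hP (by rw [pUX_receiverOne_eq, receiverTwo_blockChannel]) B
  rw [← receiverOne_blockChannel] at d₁
  rw [← receiverTwo_blockChannel] at d₂
  obtain ⟨c, hc⟩ := BlockEnsemble.exists_code _ (blockChannel W m) d₁ d₂ (messageCount_pos R₁ n)
    (messageCount_pos R₂ n) (messageCount_pos R₃ n) i₁ i₂ i₃
  obtain ⟨c', hc'⟩ := CMACrCode.exists_pad (W := W) hlen c.unblock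
  exact ⟨c', by rw [hc', CMACrCode.errorProb_unblock]; exact hc.trans hme⟩

end CFLaw

namespace CFLaw

section

variable {Q X₁ X₂ X₃ Y Y₃ U : Type*}
  [Fintype Q] [Fintype X₁] [Fintype X₂] [Fintype X₃] [Fintype Y] [Fintype Y₃] [Fintype U]
  {D : CFLaw Q X₁ X₂ X₃ Y₃ U} {W : X₁ → X₂ → X₃ → Y × Y₃ → ℝ}

theorem eventually_mul_lt {x y : ℝ} (h : x < y) : ∀ᶠ η in 𝓝[>] (0 : ℝ), (1 + η) * x < y := by
  filter_upwards [eventually_add_mul_lt x h] with η hη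
  linarith

theorem eventually_zero_or_mul_lt {x y : ℝ} (h : x = 0 ∨ x < y) :
    ∀ᶠ η in 𝓝[>] (0 : ℝ), (1 + η) * x = 0 ∨ (1 + η) * x < y := by
  rcases h with h | h
  · exact Eventually.of_forall fun η => Or.inl (by rw [h, mul_zero])
  · exact (eventually_mul_lt h).mono fun _ => Or.inr

theorem eventually_zero_or_zero_or_mul_lt {x x' y : ℝ} (h : x = 0 ∨ x' = 0 ∨ x + x' < y) :
    ∀ᶠ η in 𝓝[>] (0 : ℝ), (1 + η) * x = 0 ∨ (1 + η) * x' = 0 ∨ (1 + η) * x + (1 + η) * x' < y := by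
  rcases h with h | h
  · exact Eventually.of_forall fun η => Or.inl (by rw [h, mul_zero])
  rcases h with h | h
  · exact Eventually.of_forall fun η => Or.inr (Or.inl (by rw [h, mul_zero]))
  · filter_upwards [eventually_mul_lt h] with η hη
    exact Or.inr (Or.inr (by linarith))

/-- Strict inequalities survive a small increase of the rates, and zero rates stay zero. -/
theorem RelayRates.eventually {R₁ R₂ R₃ : ℝ} (h : D.RelayRates W R₁ R₂ R₃) :
    ∀ᶠ η in 𝓝[>] (0 : ℝ), D.RelayRates W ((1 + η) * R₁) ((1 + η) * R₂) ((1 + η) * R₃) := by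
  obtain ⟨ha, hb, hc, h3⟩ := h
  filter_upwards [eventually_zero_or_mul_lt ha, eventually_zero_or_mul_lt hb,
    eventually_zero_or_zero_or_mul_lt hc, eventually_add_mul_lt R₃ h3] with η ha hb hc h3
  exact ⟨ha, hb, hc, by linarith⟩

theorem DirectRates.eventually {R₁ R₂ R₃ : ℝ} (h : D.DirectRates W R₁ R₂ R₃) :
    ∀ᶠ η in 𝓝[>] (0 : ℝ), D.DirectRates W ((1 + η) * R₁) ((1 + η) * R₂) ((1 + η) * R₃) := by
  obtain ⟨ha, hb, hc, h3⟩ := h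
  filter_upwards [eventually_zero_or_mul_lt ha, eventually_zero_or_mul_lt hb,
    eventually_zero_or_zero_or_mul_lt hc] with η ha hb hc
  exact ⟨ha, hb, hc, by rw [h3, mul_zero]⟩

end

section

variable {Q X₁ X₂ X₃ Y₁ Y₂ Y₃ U : Type*}
  [Fintype Q] [Fintype X₁] [Fintype X₂] [Fintype X₃] [Fintype Y₁] [Fintype Y₂] [Fintype Y₃]
  [Fintype U] (D : CFLaw Q X₁ X₂ X₃ Y₃ U) (W : CMACr X₁ X₂ X₃ Y₁ Y₂ Y₃)

theorem wsum_receiverOne_snd (x₁ : X₁) (x₂ : X₂) (x₃ : X₃) (f : Y₃ → ℝ) :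
    wsum (receiverOne W x₁ x₂ x₃) (fun t => f t.2) =
      wsum (receiverTwo W x₁ x₂ x₃) (fun t => f t.2) := by
  simp only [wsum, receiverOne, receiverTwo, Fintype.sum_prod_type, Finset.sum_mul]
  rw [Finset.sum_comm' (t' := (Finset.univ : Finset Y₃)) (s' := fun _ => (Finset.univ : Finset Y₁))
    (by simp)]
  rw [Finset.sum_comm (s := (Finset.univ : Finset Y₂))]
  exact Finset.sum_congr rfl fun y₃ _ => Finset.sum_comm

/-- The law of `(Y₃, U, X₃, Q)` does not involve the receivers, so both ask for the same compression
rate. -/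
theorem condMutualInfo_y₃_u_receiver :
    condMutualInfo (D.joint (receiverOne W)) cY₃ cU (fun ω => (c₃ ω, cQ ω)) =
      condMutualInfo (D.joint (receiverTwo W)) cY₃ cU (fun ω => (c₃ ω, cQ ω)) := by
  refine condMutualInfo_of_law fun t => ?_
  rw [marginal_eq_wsum, marginal_eq_wsum, wsum_joint, wsum_joint]
  refine wsum_congr fun q => wsum_congr fun x₁ => wsum_congr fun x₂ => wsum_congr fun x₃ => ?_
  exact wsum_receiverOne_snd W x₁ x₂ x₃ fun y₃ => wsum (D.pU q x₃ y₃) fun u =>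
    ind ((y₃, u, x₃, q) = t)

variable [Nonempty Q] [Nonempty X₁] [Nonempty X₂] [Nonempty X₃] [Nonempty Y₁] [Nonempty Y₂]
  [Nonempty Y₃] [Nonempty U]

/-- Rates at which each of the receivers can decode are achievable. -/
theorem achievable_of_rates {R₁ R₂ R₃ : ℝ} (hR₁ : 0 ≤ R₁) (hR₂ : 0 ≤ R₂) (hR₃ : 0 ≤ R₃)
    (h₁ : D.RelayRates (receiverOne W) R₁ R₂ R₃ ∨ D.DirectRates (receiverOne W) R₁ R₂ R₃)
    (h₂ : D.RelayRates (receiverTwo W) R₁ R₂ R₃ ∨ D.DirectRates (receiverTwo W) R₁ R₂ R₃) :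
    Achievable W (R₁, R₂, R₃) := by
  have e₁ : ∀ᶠ η in 𝓝[>] (0 : ℝ),
      D.RelayRates (receiverOne W) ((1 + η) * R₁) ((1 + η) * R₂) ((1 + η) * R₃) ∨
      D.DirectRates (receiverOne W) ((1 + η) * R₁) ((1 + η) * R₂) ((1 + η) * R₃) := by
    rcases h₁ with h | h
    · exact h.eventually.mono fun _ => Or.inl
    · exact h.eventually.mono fun _ => Or.inr
  have e₂ : ∀ᶠ η in 𝓝[>] (0 : ℝ),
      D.RelayRates (receiverTwo W) ((1 + η) * R₁) ((1 + η) * R₂) ((1 + η) * R₃) ∨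
      D.DirectRates (receiverTwo W) ((1 + η) * R₁) ((1 + η) * R₂) ((1 + η) * R₃) := by
    rcases h₂ with h | h
    · exact h.eventually.mono fun _ => Or.inl
    · exact h.eventually.mono fun _ => Or.inr
  obtain ⟨η, ⟨h₁, h₂⟩, hη⟩ := ((e₁.and e₂).and
    (self_mem_nhdsWithin : ∀ᶠ η in 𝓝[>] (0 : ℝ), η ∈ Set.Ioi 0)).exists
  replace hη : 0 < η := hη
  set I := condMutualInfo (D.joint (receiverOne W)) cY₃ cU (fun ω => (c₃ ω, cQ ω)) with hI
  have hI' := D.condMutualInfo_y₃_u_receiver W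
  have d₁ : ∀ᶠ δ in 𝓝[>] (0 : ℝ), D.DecodesAt (receiverOne W) ((1 + η) * R₁) ((1 + η) * R₂)
      ((1 + η) * R₃) (I + 2 * δ) := by
    rcases h₁ with h | h
    · exact RelayRates.decodesAt D (receiverOne_isPMF W) (by positivity) h
    · exact Eventually.of_forall fun δ => DirectRates.decodesAt D (receiverOne_isPMF W) h _
  have d₂ : ∀ᶠ δ in 𝓝[>] (0 : ℝ), D.DecodesAt (receiverTwo W) ((1 + η) * R₁) ((1 + η) * R₂)
      ((1 + η) * R₃) (I + 2 * δ) := by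
    rcases h₂ with h | h
    · rw [hI, hI']
      exact RelayRates.decodesAt D (receiverTwo_isPMF W) (by positivity) h
    · exact Eventually.of_forall fun δ => DirectRates.decodesAt D (receiverTwo_isPMF W) h _
  obtain ⟨δ, d₁, d₂⟩ := (d₁.and d₂).exists
  exact D.achievable_of_decodesAt W hR₁ hR₂ hR₃ hη d₁ d₂

end

/-- The conditions on the rates, for one receiver. -/
def ReceiverConditions {Q X₁ X₂ X₃ Y Y₃ U : Type*}
    [Fintype Q] [Fintype X₁] [Fintype X₂] [Fintype X₃] [Fintype Y] [Fintype Y₃] [Fintype U]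
    (rel : ℝ → ℝ → Prop) (D : CFLaw Q X₁ X₂ X₃ Y₃ U) (W : X₁ → X₂ → X₃ → Y × Y₃ → ℝ)
    (R₁ R₂ R₃ : ℝ) : Prop :=
  rel R₁ (condMutualInfo (D.joint W) c₁ (fun ω => (cY ω, cU ω)) (fun ω => (c₂ ω, c₃ ω, cQ ω))) ∧
  rel R₂ (condMutualInfo (D.joint W) c₂ (fun ω => (cY ω, cU ω)) (fun ω => (c₁ ω, c₃ ω, cQ ω))) ∧
  rel (R₁ + R₂) (condMutualInfo (D.joint W) (fun ω => (c₁ ω, c₂ ω)) (fun ω => (cY ω, cU ω))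
    (fun ω => (c₃ ω, cQ ω))) ∧
  rel (R₃ + condMutualInfo (D.joint W) cY₃ cU (fun ω => (c₃ ω, cY ω, cQ ω)))
    (condMutualInfo (D.joint W) c₃ cY cQ)

end CFLaw

/-! ### The stated conditions, split by receivers -/

namespace CFDist

variable {Q X₁ X₂ X₃ Y₁ Y₂ Y₃ U : Type*}
  [Fintype Q] [Fintype X₁] [Fintype X₂] [Fintype X₃] [Fintype Y₁] [Fintype Y₂] [Fintype Y₃]
  [Fintype U]

/-- The factors as plain functions. -/
def toLaw (D : CFDist X₁ X₂ X₃ Y₃ Q U) : CFLaw Q X₁ X₂ X₃ Y₃ U where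
  pQ := D.pQ
  p₁ q := D.pX₁ q
  p₂ q := D.pX₂ q
  p₃ q := D.pX₃ q
  pU q x₃ y₃ := D.pYhat y₃ x₃ q
  hQ := stdSimplex_isPMF _
  h₁ _ := stdSimplex_isPMF _
  h₂ _ := stdSimplex_isPMF _
  h₃ _ := stdSimplex_isPMF _
  hU _ _ _ := stdSimplex_isPMF _

variable (D : CFDist X₁ X₂ X₃ Y₃ Q U) (W : CMACr X₁ X₂ X₃ Y₁ Y₂ Y₃)

theorem marginal_toLaw_one {A : Type*} (X : Q × X₁ × X₂ × X₃ × Y₁ × Y₃ × U → A) (a : A) :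
    marginal (D.joint W) (fun ω => X (ω.1, ω.2.1, ω.2.2.1, ω.2.2.2.1, ω.2.2.2.2.1,
      ω.2.2.2.2.2.2.1, ω.2.2.2.2.2.2.2)) a = marginal (D.toLaw.joint (receiverOne W)) X a := by
  rw [marginal_eq_wsum, marginal_eq_wsum]
  simp only [wsum, Fintype.sum_prod_type, joint, CFLaw.joint, toLaw, receiverOne, Finset.mul_sum,
    Finset.sum_mul]
  refine Finset.sum_congr rfl fun q _ => Finset.sum_congr rfl fun x₁ _ =>
    Finset.sum_congr rfl fun x₂ _ => Finset.sum_congr rfl fun x₃ _ =>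
    Finset.sum_congr rfl fun y₁ _ => ?_
  rw [Finset.sum_comm]
  refine Finset.sum_congr rfl fun y₃ _ => ?_
  rw [Finset.sum_comm]
  refine Finset.sum_congr rfl fun u _ => Finset.sum_congr rfl fun y₂ _ => ?_
  ring

theorem marginal_toLaw_two {A : Type*} (X : Q × X₁ × X₂ × X₃ × Y₂ × Y₃ × U → A) (a : A) :
    marginal (D.joint W) (fun ω => X (ω.1, ω.2.1, ω.2.2.1, ω.2.2.2.1, ω.2.2.2.2.2.1,
      ω.2.2.2.2.2.2.1, ω.2.2.2.2.2.2.2)) a = marginal (D.toLaw.joint (receiverTwo W)) X a := by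
  rw [marginal_eq_wsum, marginal_eq_wsum]
  simp only [wsum, Fintype.sum_prod_type, joint, CFLaw.joint, toLaw, receiverTwo, Finset.mul_sum,
    Finset.sum_mul]
  refine Finset.sum_congr rfl fun q _ => Finset.sum_congr rfl fun x₁ _ =>
    Finset.sum_congr rfl fun x₂ _ => Finset.sum_congr rfl fun x₃ _ => ?_
  rw [Finset.sum_comm]
  refine Finset.sum_congr rfl fun y₂ _ => ?_
  rw [Finset.sum_comm]
  refine Finset.sum_congr rfl fun y₃ _ => ?_
  rw [Finset.sum_comm]
  refine Finset.sum_congr rfl fun u _ => Finset.sum_congr rfl fun y₁ _ => ?_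
  ring

theorem condMutualInfo_toLaw_one {A B C : Type*} [Fintype A] [Fintype B] [Fintype C]
    (X : Q × X₁ × X₂ × X₃ × Y₁ × Y₃ × U → A) (Y : Q × X₁ × X₂ × X₃ × Y₁ × Y₃ × U → B)
    (Z : Q × X₁ × X₂ × X₃ × Y₁ × Y₃ × U → C) :
    condMutualInfo (D.joint W)
      (fun ω => X (ω.1, ω.2.1, ω.2.2.1, ω.2.2.2.1, ω.2.2.2.2.1, ω.2.2.2.2.2.2.1, ω.2.2.2.2.2.2.2))
      (fun ω => Y (ω.1, ω.2.1, ω.2.2.1, ω.2.2.2.1, ω.2.2.2.2.1, ω.2.2.2.2.2.2.1, ω.2.2.2.2.2.2.2))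
      (fun ω => Z (ω.1, ω.2.1, ω.2.2.1, ω.2.2.2.1, ω.2.2.2.2.1, ω.2.2.2.2.2.2.1, ω.2.2.2.2.2.2.2)) =
    condMutualInfo (D.toLaw.joint (receiverOne W)) X Y Z :=
  condMutualInfo_of_law fun t => D.marginal_toLaw_one W (fun ω => (X ω, Y ω, Z ω)) t

theorem condMutualInfo_toLaw_two {A B C : Type*} [Fintype A] [Fintype B] [Fintype C]
    (X : Q × X₁ × X₂ × X₃ × Y₂ × Y₃ × U → A) (Y : Q × X₁ × X₂ × X₃ × Y₂ × Y₃ × U → B)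
    (Z : Q × X₁ × X₂ × X₃ × Y₂ × Y₃ × U → C) :
    condMutualInfo (D.joint W)
      (fun ω => X (ω.1, ω.2.1, ω.2.2.1, ω.2.2.2.1, ω.2.2.2.2.2.1, ω.2.2.2.2.2.2.1, ω.2.2.2.2.2.2.2))
      (fun ω => Y (ω.1, ω.2.1, ω.2.2.1, ω.2.2.2.1, ω.2.2.2.2.2.1, ω.2.2.2.2.2.2.1, ω.2.2.2.2.2.2.2))
      (fun ω => Z (ω.1, ω.2.1, ω.2.2.1, ω.2.2.2.1, ω.2.2.2.2.2.1, ω.2.2.2.2.2.2.1,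
        ω.2.2.2.2.2.2.2)) =
    condMutualInfo (D.toLaw.joint (receiverTwo W)) X Y Z :=
  condMutualInfo_of_law fun t => D.marginal_toLaw_two W (fun ω => (X ω, Y ω, Z ω)) t

-- Each information quantity involves the output of one receiver only, so the other output can be
-- summed out. `hrel` splits the minima, and holds for both `≤` and `<`.
open CFLaw in
theorem conditions_iff {rel : ℝ → ℝ → Prop} (hrel : ∀ x y z, rel x (min y z) ↔ rel x y ∧ rel x z)
    (R₁ R₂ R₃ : ℝ) :
    D.Conditions rel W R₁ R₂ R₃ ↔
      ReceiverConditions rel D.toLaw (receiverOne W) R₁ R₂ R₃ ∧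
      ReceiverConditions rel D.toLaw (receiverTwo W) R₁ R₂ R₃ := by
  unfold ReceiverConditions
  rw [← D.condMutualInfo_toLaw_one W c₁ (fun ω => (cY ω, cU ω)) (fun ω => (c₂ ω, c₃ ω, cQ ω)),
    ← D.condMutualInfo_toLaw_one W c₂ (fun ω => (cY ω, cU ω)) (fun ω => (c₁ ω, c₃ ω, cQ ω)),
    ← D.condMutualInfo_toLaw_one W (fun ω => (c₁ ω, c₂ ω)) (fun ω => (cY ω, cU ω))
      (fun ω => (c₃ ω, cQ ω)),
    ← D.condMutualInfo_toLaw_one W cY₃ cU (fun ω => (c₃ ω, cY ω, cQ ω)),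
    ← D.condMutualInfo_toLaw_one W c₃ cY cQ,
    ← D.condMutualInfo_toLaw_two W c₁ (fun ω => (cY ω, cU ω)) (fun ω => (c₂ ω, c₃ ω, cQ ω)),
    ← D.condMutualInfo_toLaw_two W c₂ (fun ω => (cY ω, cU ω)) (fun ω => (c₁ ω, c₃ ω, cQ ω)),
    ← D.condMutualInfo_toLaw_two W (fun ω => (c₁ ω, c₂ ω)) (fun ω => (cY ω, cU ω))
      (fun ω => (c₃ ω, cQ ω)),
    ← D.condMutualInfo_toLaw_two W cY₃ cU (fun ω => (c₃ ω, cY ω, cQ ω)),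
    ← D.condMutualInfo_toLaw_two W c₃ cY cQ]
  unfold Conditions
  simp only [hrel]
  tauto

end CFDist

namespace CFLaw

variable {Q X₁ X₂ X₃ Y Y₃ U : Type*}
  [Fintype Q] [Fintype X₁] [Fintype X₂] [Fintype X₃] [Fintype Y] [Fintype Y₃] [Fintype U]
  {D : CFLaw Q X₁ X₂ X₃ Y₃ U} {W : X₁ → X₂ → X₃ → Y × Y₃ → ℝ}

theorem ReceiverConditions.relayRates {R₁ R₂ R₃ : ℝ}
    (h : D.ReceiverConditions (· < ·) W R₁ R₂ R₃) : D.RelayRates W R₁ R₂ R₃ :=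
  ⟨Or.inr h.1, Or.inr h.2.1, Or.inr (Or.inr h.2.2.1), h.2.2.2⟩

end CFLaw

/-- Strict conditions let both receivers use the relay. The remaining steps extract nonempty
alphabets from the existence of mass functions on them. -/
theorem achievable_of_conditions {Q X₁ X₂ X₃ Y₁ Y₂ Y₃ U : Type*}
    [Fintype Q] [Fintype X₁] [Fintype X₂] [Fintype X₃] [Fintype Y₁] [Fintype Y₂] [Fintype Y₃]
    [Fintype U] (D : CFDist X₁ X₂ X₃ Y₃ Q U) (W : CMACr X₁ X₂ X₃ Y₁ Y₂ Y₃) {R₁ R₂ R₃ : ℝ}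
    (hR₁ : 0 ≤ R₁) (hR₂ : 0 ≤ R₂) (hR₃ : 0 ≤ R₃) (h : D.Conditions (· < ·) W R₁ R₂ R₃) :
    Achievable W (R₁, R₂, R₃) := by
  obtain ⟨h₁, h₂⟩ := (D.conditions_iff W (fun _ _ _ => lt_min_iff) R₁ R₂ R₃).1 h
  have nQ := D.toLaw.hQ.nonempty
  obtain ⟨q⟩ := id nQ
  have n₁ := (D.toLaw.h₁ q).nonempty
  have n₂ := (D.toLaw.h₂ q).nonempty
  have n₃ := (D.toLaw.h₃ q).nonempty
  obtain ⟨x₁⟩ := id n₁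
  obtain ⟨x₂⟩ := id n₂
  obtain ⟨x₃⟩ := id n₃
  obtain ⟨y₁, y₂, y₃⟩ := (stdSimplex_isPMF (W x₁ x₂ x₃)).nonempty
  obtain ⟨u⟩ := (D.toLaw.hU q x₃ y₃).nonempty
  have : Nonempty Y₁ := ⟨y₁⟩
  have : Nonempty Y₂ := ⟨y₂⟩
  have : Nonempty Y₃ := ⟨y₃⟩
  have : Nonempty U := ⟨u⟩
  exact D.toLaw.achievable_of_rates W hR₁ hR₂ hR₃ (Or.inl h₁.relayRates) (Or.inl h₂.relayRates)

/-! ### Time sharing and the probe -/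

section Mixtures

variable {Ω Ω' Ω'' A B C A₁ B₁ C₁ A₂ B₂ C₂ : Type*} [Fintype Ω] [Fintype Ω'] [Fintype Ω'']
  [Fintype A] [Fintype B] [Fintype C] [Fintype A₁] [Fintype B₁] [Fintype C₁]
  [Fintype A₂] [Fintype B₂] [Fintype C₂]

/-- By `hne` the value of `T` reveals the component of the mixture, so a value taken on the left
receives no mass from the right. -/
theorem marginal_mix_left (e : Ω ⊕ Ω' ≃ Ω'') {p : Ω'' → ℝ} {p₁ : Ω → ℝ} {s : ℝ}
    (h₁ : ∀ ω, p (e (Sum.inl ω)) = s * p₁ ω) {T : Ω'' → A} {T₁ : Ω → A₁}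
    (hT : ∀ ω ω', T (e (Sum.inl ω')) = T (e (Sum.inl ω)) ↔ T₁ ω' = T₁ ω)
    (hne : ∀ ω ω', T (e (Sum.inr ω')) ≠ T (e (Sum.inl ω))) (ω : Ω) :
    marginal p T (T (e (Sum.inl ω))) = s * marginal p₁ T₁ (T₁ ω) := by
  rw [marginal_eq, marginal_eq, ← Equiv.sum_comp e, Fintype.sum_sum_type, Finset.mul_sum]
  simp only [hT, hne, if_false, Finset.sum_const_zero, add_zero, h₁, mul_ite, mul_zero]

/-- All four marginals are scaled by `s`, and `s ^ 2` cancels in the density ratio; only the outer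
weight keeps a factor `s`. -/
theorem condMutualInfo_mix_left (e : Ω ⊕ Ω' ≃ Ω'') {p : Ω'' → ℝ} {p₁ : Ω → ℝ} {s : ℝ} (hs : s ≠ 0)
    (h₁ : ∀ ω, p (e (Sum.inl ω)) = s * p₁ ω) {X : Ω'' → A} {Y : Ω'' → B} {Z : Ω'' → C}
    {X₁ : Ω → A₁} {Y₁ : Ω → B₁} {Z₁ : Ω → C₁}
    (hX : ∀ ω ω', X (e (Sum.inl ω')) = X (e (Sum.inl ω)) ↔ X₁ ω' = X₁ ω)
    (hY : ∀ ω ω', Y (e (Sum.inl ω')) = Y (e (Sum.inl ω)) ↔ Y₁ ω' = Y₁ ω)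
    (hZ : ∀ ω ω', Z (e (Sum.inl ω')) = Z (e (Sum.inl ω)) ↔ Z₁ ω' = Z₁ ω)
    (hne : ∀ ω ω', Z (e (Sum.inr ω')) ≠ Z (e (Sum.inl ω))) :
    ∑ ω, p (e (Sum.inl ω)) * Real.logb 2
      (marginal p (fun ω => (X ω, Y ω, Z ω)) (X (e (Sum.inl ω)), Y (e (Sum.inl ω)),
          Z (e (Sum.inl ω))) * marginal p Z (Z (e (Sum.inl ω))) /
        (marginal p (fun ω => (X ω, Z ω)) (X (e (Sum.inl ω)), Z (e (Sum.inl ω))) *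
          marginal p (fun ω => (Y ω, Z ω)) (Y (e (Sum.inl ω)), Z (e (Sum.inl ω))))) =
      s * condMutualInfo p₁ X₁ Y₁ Z₁ := by
  rw [condMutualInfo_eq_sum, Finset.mul_sum]
  refine Finset.sum_congr rfl fun ω _ => ?_
  have hXYZ := marginal_mix_left e h₁ (T := fun ω => (X ω, Y ω, Z ω))
    (T₁ := fun ω => (X₁ ω, Y₁ ω, Z₁ ω)) (fun ω ω' => by simp only [Prod.mk.injEq, hX, hY, hZ])
    (fun ω ω' => by simp [hne]) ω
  have hXZ := marginal_mix_left e h₁ (T := fun ω => (X ω, Z ω))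
    (T₁ := fun ω => (X₁ ω, Z₁ ω)) (fun ω ω' => by simp only [Prod.mk.injEq, hX, hZ])
    (fun ω ω' => by simp [hne]) ω
  have hYZ := marginal_mix_left e h₁ (T := fun ω => (Y ω, Z ω))
    (T₁ := fun ω => (Y₁ ω, Z₁ ω)) (fun ω ω' => by simp only [Prod.mk.injEq, hY, hZ])
    (fun ω ω' => by simp [hne]) ω
  have hZ' := marginal_mix_left e h₁ (T := Z) (T₁ := Z₁) hZ hne ω
  beta_reduce at hXYZ hXZ hYZ
  rw [hXYZ, hXZ, hYZ, hZ', h₁, mul_assoc]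
  congr 3
  rw [mul_mul_mul_comm s _ s, mul_mul_mul_comm s _ s, mul_div_mul_left _ _ (mul_ne_zero hs hs)]

/-- Conditional mutual information is linear in mixtures that can be told from the condition. -/
theorem condMutualInfo_mix (e : Ω ⊕ Ω' ≃ Ω'') {p : Ω'' → ℝ} {p₁ : Ω → ℝ} {p₂ : Ω' → ℝ} {s t : ℝ}
    (hs : s ≠ 0) (ht : t ≠ 0) (h₁ : ∀ ω, p (e (Sum.inl ω)) = s * p₁ ω)
    (h₂ : ∀ ω, p (e (Sum.inr ω)) = t * p₂ ω) {X : Ω'' → A} {Y : Ω'' → B} {Z : Ω'' → C}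
    {X₁ : Ω → A₁} {Y₁ : Ω → B₁} {Z₁ : Ω → C₁} {X₂ : Ω' → A₂} {Y₂ : Ω' → B₂} {Z₂ : Ω' → C₂}
    (hX₁ : ∀ ω ω', X (e (Sum.inl ω')) = X (e (Sum.inl ω)) ↔ X₁ ω' = X₁ ω)
    (hY₁ : ∀ ω ω', Y (e (Sum.inl ω')) = Y (e (Sum.inl ω)) ↔ Y₁ ω' = Y₁ ω)
    (hZ₁ : ∀ ω ω', Z (e (Sum.inl ω')) = Z (e (Sum.inl ω)) ↔ Z₁ ω' = Z₁ ω)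
    (hX₂ : ∀ ω ω', X (e (Sum.inr ω')) = X (e (Sum.inr ω)) ↔ X₂ ω' = X₂ ω)
    (hY₂ : ∀ ω ω', Y (e (Sum.inr ω')) = Y (e (Sum.inr ω)) ↔ Y₂ ω' = Y₂ ω)
    (hZ₂ : ∀ ω ω', Z (e (Sum.inr ω')) = Z (e (Sum.inr ω)) ↔ Z₂ ω' = Z₂ ω)
    (hne : ∀ ω ω', Z (e (Sum.inr ω')) ≠ Z (e (Sum.inl ω))) :
    condMutualInfo p X Y Z = s * condMutualInfo p₁ X₁ Y₁ Z₁ + t * condMutualInfo p₂ X₂ Y₂ Z₂ := by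
  rw [condMutualInfo_eq_sum, ← Equiv.sum_comp e, Fintype.sum_sum_type]
  congr 1
  · exact condMutualInfo_mix_left e hs h₁ hX₁ hY₁ hZ₁ hne
  · exact condMutualInfo_mix_left ((Equiv.sumComm Ω' Ω).trans e) ht h₂ hX₂ hY₂ hZ₂
      fun ω ω' => (hne ω' ω).symm

end Mixtures

namespace CFLaw

variable {Q Q' X₁ X₂ X₃ Y Y₃ U : Type*} [Fintype Q] [Fintype Q']
  [Fintype X₁] [Fintype X₂] [Fintype X₃] [Fintype Y] [Fintype Y₃] [Fintype U]

/-- Time sharing between two laws. -/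
def mix (ε : ℝ) (hε₀ : 0 ≤ ε) (hε₁ : ε ≤ 1) (D : CFLaw Q X₁ X₂ X₃ Y₃ U)
    (D' : CFLaw Q' X₁ X₂ X₃ Y₃ U) : CFLaw (Q ⊕ Q') X₁ X₂ X₃ Y₃ U where
  pQ := Sum.elim (fun q => (1 - ε) * D.pQ q) (fun q => ε * D'.pQ q)
  p₁ := Sum.elim D.p₁ D'.p₁
  p₂ := Sum.elim D.p₂ D'.p₂
  p₃ := Sum.elim D.p₃ D'.p₃
  pU := Sum.elim D.pU D'.pU
  hQ :=
    { nonneg := by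
        rintro (q | q)
        · exact mul_nonneg (sub_nonneg.2 hε₁) (D.hQ.nonneg q)
        · exact mul_nonneg hε₀ (D'.hQ.nonneg q)
      sum_one := by
        simp [Fintype.sum_sum_type, ← Finset.mul_sum, D.hQ.sum_one, D'.hQ.sum_one] }
  h₁ := Sum.rec D.h₁ D'.h₁
  h₂ := Sum.rec D.h₂ D'.h₂
  h₃ := Sum.rec D.h₃ D'.h₃
  hU := Sum.rec D.hU D'.hU

section

variable {ε : ℝ} (hε₀ : 0 < ε) (hε₁ : ε < 1) (D : CFLaw Q X₁ X₂ X₃ Y₃ U)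
  (D' : CFLaw Q' X₁ X₂ X₃ Y₃ U) (W : X₁ → X₂ → X₃ → Y × Y₃ → ℝ)

theorem joint_mix_inl (q : Q) (t : X₁ × X₂ × X₃ × Y × Y₃ × U) :
    (mix ε hε₀.le hε₁.le D D').joint W (Sum.inl q, t) = (1 - ε) * D.joint W (q, t) :=
  mul_assoc _ _ _

theorem joint_mix_inr (q : Q') (t : X₁ × X₂ × X₃ × Y × Y₃ × U) :
    (mix ε hε₀.le hε₁.le D D').joint W (Sum.inr q, t) = ε * D'.joint W (q, t) :=
  mul_assoc _ _ _

/-- Conditional mutual informations given time-sharing variables are linear in time sharing. -/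
theorem condMutualInfo_joint_mix {A B C : Type*} [Fintype A] [Fintype B] [Fintype C]
    (X : X₁ × X₂ × X₃ × Y × Y₃ × U → A) (Z : X₁ × X₂ × X₃ × Y × Y₃ × U → B)
    (V : X₁ × X₂ × X₃ × Y × Y₃ × U → C) {C₀ C₁ C₂ : Type*} [Fintype C₀] [Fintype C₁] [Fintype C₂]
    {V₀ : (Q ⊕ Q') × X₁ × X₂ × X₃ × Y × Y₃ × U → C₀} {V₁ : Q × X₁ × X₂ × X₃ × Y × Y₃ × U → C₁}
    {V₂ : Q' × X₁ × X₂ × X₃ × Y × Y₃ × U → C₂}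
    (h₀ : ∀ ω ω', V₀ ω' = V₀ ω ↔ V ω'.2 = V ω.2 ∧ ω'.1 = ω.1)
    (h₁ : ∀ ω ω', V₁ ω' = V₁ ω ↔ V ω'.2 = V ω.2 ∧ ω'.1 = ω.1)
    (h₂ : ∀ ω ω', V₂ ω' = V₂ ω ↔ V ω'.2 = V ω.2 ∧ ω'.1 = ω.1) :
    condMutualInfo ((mix ε hε₀.le hε₁.le D D').joint W) (fun ω => X ω.2) (fun ω => Z ω.2) V₀ =
      (1 - ε) * condMutualInfo (D.joint W) (fun ω => X ω.2) (fun ω => Z ω.2) V₁ +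
      ε * condMutualInfo (D'.joint W) (fun ω => X ω.2) (fun ω => Z ω.2) V₂ := by
  refine condMutualInfo_mix (Equiv.sumProdDistrib Q Q' (X₁ × X₂ × X₃ × Y × Y₃ × U)).symm
    (sub_pos.2 hε₁).ne' hε₀.ne' (fun ω => joint_mix_inl hε₀ hε₁ D D' W ω.1 ω.2)
    (fun ω => joint_mix_inr hε₀ hε₁ D D' W ω.1 ω.2) (fun ω ω' => Iff.rfl) (fun ω ω' => Iff.rfl) ?_
    (fun ω ω' => Iff.rfl) (fun ω ω' => Iff.rfl) ?_ ?_
  · intro ω ω'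
    rw [h₀, h₁]
    simp
  · intro ω ω'
    rw [h₀, h₂]
    simp
  · intro ω ω'
    rw [Ne, h₀]
    simp

/-- The second law contributes a nonnegative amount. For the bounds on `R₁`, `R₂` and `R₁ + R₂`
nothing more is needed from the probe. -/
theorem le_condMutualInfo_joint_mix (hW : ∀ x₁ x₂ x₃, IsPMF (W x₁ x₂ x₃))
    {A B C : Type*} [Fintype A] [Fintype B] [Fintype C]
    (X : X₁ × X₂ × X₃ × Y × Y₃ × U → A) (Z : X₁ × X₂ × X₃ × Y × Y₃ × U → B)
    (V : X₁ × X₂ × X₃ × Y × Y₃ × U → C) {C₀ C₁ : Type*} [Fintype C₀] [Fintype C₁]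
    {V₀ : (Q ⊕ Q') × X₁ × X₂ × X₃ × Y × Y₃ × U → C₀} {V₁ : Q × X₁ × X₂ × X₃ × Y × Y₃ × U → C₁}
    (h₀ : ∀ ω ω', V₀ ω' = V₀ ω ↔ V ω'.2 = V ω.2 ∧ ω'.1 = ω.1)
    (h₁ : ∀ ω ω', V₁ ω' = V₁ ω ↔ V ω'.2 = V ω.2 ∧ ω'.1 = ω.1) :
    (1 - ε) * condMutualInfo (D.joint W) (fun ω => X ω.2) (fun ω => Z ω.2) V₁ ≤
    condMutualInfo ((mix ε hε₀.le hε₁.le D D').joint W) (fun ω => X ω.2) (fun ω => Z ω.2) V₀ := by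
  rw [condMutualInfo_joint_mix hε₀ hε₁ D D' W X Z V h₀ h₁ (V₂ := fun ω => (V ω.2, ω.1))
    (fun ω ω' => Prod.mk.injEq _ _ _ _ ▸ Iff.rfl)]
  have := condMutualInfo_nonneg (D'.joint_isPMF hW).nonneg (fun ω => X ω.2) (fun ω => Z ω.2)
    (fun ω => (V ω.2, ω.1))
  nlinarith

end

/-- The law that tests whether the relay's input affects the outputs: the transmitters send
constants, which are shared. -/
noncomputable def probe (Y₃ : Type*) [Nonempty X₁] [Nonempty X₂] [Nonempty X₃] {ν : U → ℝ}
    (hν : IsPMF ν) : CFLaw (X₁ × X₂) X₁ X₂ X₃ Y₃ U where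
  -- Uniform over all pairs of constants, so that a dependence on the relay's input at any single
  -- pair is detected.
  pQ _ := 1 / Fintype.card (X₁ × X₂)
  p₁ q x := ind (x = q.1)
  p₂ q x := ind (x = q.2)
  p₃ _ _ := 1 / Fintype.card X₃
  -- Independent noise: describing it costs the relay no rate.
  pU _ _ _ := ν
  hQ := ⟨fun _ => by positivity, by
    rw [Finset.sum_const, Finset.card_univ, nsmul_eq_mul, mul_one_div_cancel]
    exact_mod_cast Fintype.card_ne_zero⟩
  h₁ q := ⟨fun _ => ind_nonneg _, by simp [ind]⟩
  h₂ q := ⟨fun _ => ind_nonneg _, by simp [ind]⟩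
  h₃ q := ⟨fun _ => by positivity, by simp⟩
  hU _ _ _ := hν

/-- The law of the receiver's output. -/
noncomputable def outputLaw (W : X₁ → X₂ → X₃ → Y × Y₃ → ℝ) (x₁ : X₁) (x₂ : X₂) (x₃ : X₃) (y : Y) :
    ℝ := ∑ y₃, W x₁ x₂ x₃ (y, y₃)

section

variable (D : CFLaw Q X₁ X₂ X₃ Y₃ U) {W : X₁ → X₂ → X₃ → Y × Y₃ → ℝ}

theorem wsum_ind_fst (x₁ : X₁) (x₂ : X₂) (x₃ : X₃) (y : Y) :
    wsum (W x₁ x₂ x₃) (fun t => ind (t.1 = y)) = outputLaw W x₁ x₂ x₃ y := by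
  rw [wsum, Fintype.sum_prod_type, Finset.sum_eq_single y]
  · simp [ind, outputLaw]
  · intro y' _ hy
    simp [ind, hy]
  · simp

theorem marginal_x₃yq (x₃ : X₃) (y : Y) (q : Q) :
    marginal (D.joint W) (fun ω => (c₃ ω, cY ω, cQ ω)) (x₃, y, q) =
      D.p₃ q x₃ * (D.pQ q * wsum (D.p₁ q) fun x₁ => wsum (D.p₂ q) fun x₂ =>
        outputLaw W x₁ x₂ x₃ y) := by
  rw [marginal_eq_wsum, wsum_joint]
  simp only [cQ, c₁, c₂, c₃, cY, cY₃, cU, Prod.mk.injEq, ind_and]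
  simp only [(D.hU _ _ _).wsum_const, wsum_const_mul', wsum_const_mul, wsum_ind_fst]
  rw [wsum, Finset.sum_eq_single q]
  · simp only [wsum, ind, mul_ite, ite_mul, one_mul, zero_mul, mul_one, mul_zero,
      Finset.sum_ite_eq', Finset.mem_univ, if_true, Finset.mul_sum]
    refine Finset.sum_congr rfl fun x₁ _ => Finset.sum_congr rfl fun x₂ _ => ?_
    ring
  · intro q' _ hq
    simp [wsum, ind, hq]
  · simp

theorem marginal_x₁x₂x₃yq (x₁ : X₁) (x₂ : X₂) (x₃ : X₃) (y : Y) (q : Q) :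
    marginal (D.joint W) (fun ω => (c₃ ω, cY ω, c₁ ω, c₂ ω, cQ ω)) (x₃, y, x₁, x₂, q) =
      D.p₃ q x₃ * (D.pQ q * D.p₁ q x₁ * D.p₂ q x₂ * outputLaw W x₁ x₂ x₃ y) := by
  rw [marginal_eq_wsum, wsum_joint]
  simp only [cQ, c₁, c₂, c₃, cY, cY₃, cU, Prod.mk.injEq, ind_and]
  simp only [(D.hU _ _ _).wsum_const, wsum_const_mul', wsum_const_mul, wsum_ind_fst]
  simp [wsum, ind]
  ring

/-- If the relay's input never affects the receiver's output, the probe does not see it. -/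
theorem outputLaw_eq_of_probe [Nonempty X₁] [Nonempty X₂] [Nonempty X₃] {ν : U → ℝ}
    (hν : IsPMF ν) (hW : ∀ x₁ x₂ x₃, IsPMF (W x₁ x₂ x₃))
    (h : condMutualInfo ((probe Y₃ hν : CFLaw (X₁ × X₂) X₁ X₂ X₃ Y₃ U).joint W) c₃ cY cQ ≤ 0)
    (x₁ : X₁) (x₂ : X₂) (x₃ x₃' : X₃) (y : Y) :
    outputLaw W x₁ x₂ x₃ y = outputLaw W x₁ x₂ x₃' y := by
  set P := (probe Y₃ hν : CFLaw (X₁ × X₂) X₁ X₂ X₃ Y₃ U) with hP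
  -- Equality case of Gibbs' inequality: given each pair of constants, relay input and output are
  -- independent. All relay inputs have positive weight, so the output laws agree.
  have key := (condMutualInfo_gibbs (P.joint_isPMF hW).nonneg c₃ cY cQ).2.mt h.not_gt
  push Not at key
  have k (x : X₃) := key x y (x₁, x₂)
  simp only [marginal_x₃yq, marginal_q _ hW, marginal_x₃q _ hW] at k
  have hc : (0 : ℝ) < Fintype.card X₃ := by exact_mod_cast Fintype.card_pos
  have hq : (0 : ℝ) < Fintype.card (X₁ × X₂) := by exact_mod_cast Fintype.card_pos
  have hw (x : X₃) : (wsum (P.p₁ (x₁, x₂)) fun a => wsum (P.p₂ (x₁, x₂)) fun b =>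
      outputLaw W a b x y) = outputLaw W x₁ x₂ x y := by
    simp [hP, probe, wsum, ind]
  have hpq : P.pQ (x₁, x₂) = 1 / Fintype.card (X₁ × X₂) := rfl
  have hp3 (x : X₃) : P.p₃ (x₁, x₂) x = 1 / Fintype.card X₃ := rfl
  have k' (x : X₃) : outputLaw W x₁ x₂ x y / Fintype.card (X₁ × X₂) =
      marginal (P.joint W) (fun ω => (cY ω, cQ ω)) (y, x₁, x₂) := by
    have := k x
    rw [hw, hpq, hp3] at this
    field_simp at this ⊢
    linarith
  have := (k' x₃).trans (k' x₃').symm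
  field_simp at this
  exact this

/-- The probe's compressed output is independent of everything else, so the joint law factors. -/
theorem condMutualInfo_probe_u [Nonempty X₁] [Nonempty X₂] [Nonempty X₃] {ν : U → ℝ}
    (hν : IsPMF ν) (W : X₁ → X₂ → X₃ → Y × Y₃ → ℝ) :
    condMutualInfo ((probe Y₃ hν : CFLaw (X₁ × X₂) X₁ X₂ X₃ Y₃ U).joint W) cY₃ cU
      (fun ω => (c₃ ω, cY ω, cQ ω)) = 0 := by
  set P := (probe Y₃ hν : CFLaw (X₁ × X₂) X₁ X₂ X₃ Y₃ U) with hP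
  refine condMutualInfo_eq_zero _
    (g := fun y₃ c => marginal (P.joint W) (fun ω => (cY₃ ω, c₃ ω, cY ω, cQ ω)) (y₃, c))
    (h := fun u _ => ν u) ?_
  rintro y₃ u ⟨x₃, y, q⟩
  rw [marginal_eq_wsum, marginal_eq_wsum, wsum_joint, wsum_joint, ← wsum_const_mul']
  refine wsum_congr fun q' => ?_
  rw [← wsum_const_mul']
  refine wsum_congr fun x₁ => ?_
  rw [← wsum_const_mul']
  refine wsum_congr fun x₂ => ?_
  rw [← wsum_const_mul']
  refine wsum_congr fun x₃' => ?_
  rw [← wsum_const_mul']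
  refine wsum_congr fun t => ?_
  simp only [cQ, c₁, c₂, c₃, cY, cY₃, cU, Prod.mk.injEq, ind_and]
  rw [(P.hU _ _ _).wsum_const]
  rw [wsum_const_mul, wsum_const_mul', wsum_ind_eq]
  change _ * (ν u * _) = _
  ring

end

end CFLaw

/-! ### The closed conditions, and receivers that the relay does not reach -/

namespace CFLaw

section

variable {Q X₁ X₂ X₃ Y Y₃ U : Type*}
  [Fintype Q] [Fintype X₁] [Fintype X₂] [Fintype X₃] [Fintype Y] [Fintype Y₃] [Fintype U]
  (D : CFLaw Q X₁ X₂ X₃ Y₃ U) {W : X₁ → X₂ → X₃ → Y × Y₃ → ℝ}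

/-- Given the relay's input and output, the inputs of the transmitters and the compressed output
are independent. -/
theorem condMutualInfo_x_u_eq_zero (W : X₁ → X₂ → X₃ → Y × Y₃ → ℝ) :
    condMutualInfo (D.joint W) cU (fun ω => (c₁ ω, c₂ ω)) (fun ω => (cY₃ ω, cY ω, c₃ ω, cQ ω)) =
      0 := by
  refine condMutualInfo_eq_zero _ (g := fun u c => D.pU c.2.2.2 c.2.2.1 c.1 u)
    (h := fun x c => D.pQ c.2.2.2 * D.p₁ c.2.2.2 x.1 * D.p₂ c.2.2.2 x.2 * D.p₃ c.2.2.2 c.2.2.1 *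
      W x.1 x.2 c.2.2.1 (c.2.1, c.1)) ?_
  rintro u ⟨x₁, x₂⟩ ⟨y₃, y, x₃, q⟩
  have h := marginal_congr_val (D.joint W)
    (X := fun ω => (cU ω, (c₁ ω, c₂ ω), (cY₃ ω, cY ω, c₃ ω, cQ ω)))
    (a := (u, (x₁, x₂), (y₃, y, x₃, q))) (Y := fun ω => ω) (b := (q, x₁, x₂, x₃, y, y₃, u))
    (by rintro ⟨q', x₁', x₂', x₃', y', y₃', u'⟩; simp only [Prod.mk.injEq]; tauto)
  rw [h, marginal_eq, Finset.sum_ite_eq' Finset.univ, if_pos (Finset.mem_univ _), joint]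
  ring

/-- With output laws that do not depend on the relay's input, that input can be fixed to any `x₀`,
and the law of `(X₃, Y)` factors given `Q`. -/
theorem condMutualInfo_x₃_y_eq_zero
    (hind : ∀ x₁ x₂ x₃ x₃' y, outputLaw W x₁ x₂ x₃ y = outputLaw W x₁ x₂ x₃' y) :
    condMutualInfo (D.joint W) c₃ cY cQ = 0 := by
  rcases isEmpty_or_nonempty X₃ with h | ⟨⟨x₀⟩⟩
  · simp [condMutualInfo]
  refine condMutualInfo_eq_zero _ (g := fun x₃ q => D.p₃ q x₃)
    (h := fun y q => D.pQ q * wsum (D.p₁ q) fun x₁ => wsum (D.p₂ q) fun x₂ =>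
        outputLaw W x₁ x₂ x₀ y) fun x₃ y q => ?_
  rw [marginal_x₃yq]
  simp only [hind _ _ x₃ x₀]

theorem condMutualInfo_x₃_y_x₁x₂_eq_zero
    (hind : ∀ x₁ x₂ x₃ x₃' y, outputLaw W x₁ x₂ x₃ y = outputLaw W x₁ x₂ x₃' y) :
    condMutualInfo (D.joint W) c₃ cY (fun ω => (c₁ ω, c₂ ω, cQ ω)) = 0 := by
  rcases isEmpty_or_nonempty X₃ with h | ⟨⟨x₀⟩⟩
  · simp [condMutualInfo]
  refine condMutualInfo_eq_zero _ (g := fun x₃ c => D.p₃ c.2.2 x₃)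
    (h := fun y c => D.pQ c.2.2 * D.p₁ c.2.2 c.1 * D.p₂ c.2.2 c.2.1 *
        outputLaw W c.1 c.2.1 x₀ y) ?_
  rintro x₃ y ⟨x₁, x₂, q⟩
  rw [marginal_x₁x₂x₃yq]
  simp only [hind _ _ x₃ x₀]

/-- A compressed output that is determined by the outputs at a receiver that the relay does not
reach is useless to it. -/
theorem condMutualInfo_le_direct (hW : ∀ x₁ x₂ x₃, IsPMF (W x₁ x₂ x₃))
    (hind : ∀ x₁ x₂ x₃ x₃' y, outputLaw W x₁ x₂ x₃ y = outputLaw W x₁ x₂ x₃' y)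
    (ha : condMutualInfo (D.joint W) cY₃ cU (fun ω => (c₃ ω, cY ω, cQ ω)) ≤ 0) :
    condMutualInfo (D.joint W) c₁ (fun ω => (cY ω, cU ω)) (fun ω => (c₂ ω, c₃ ω, cQ ω)) ≤
      condMutualInfo (D.joint W) c₁ cY (fun ω => (c₂ ω, cQ ω)) ∧
    condMutualInfo (D.joint W) c₂ (fun ω => (cY ω, cU ω)) (fun ω => (c₁ ω, c₃ ω, cQ ω)) ≤
      condMutualInfo (D.joint W) c₂ cY (fun ω => (c₁ ω, cQ ω)) ∧
    condMutualInfo (D.joint W) (fun ω => (c₁ ω, c₂ ω)) (fun ω => (cY ω, cU ω))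
      (fun ω => (c₃ ω, cQ ω)) ≤ condMutualInfo (D.joint W) (fun ω => (c₁ ω, c₂ ω)) cY cQ := by
  have hp := (D.joint_isPMF hW).nonneg
  -- the compressed output
  have hU : condMutualInfo (D.joint W) cU (fun ω => (c₁ ω, c₂ ω)) (fun ω => (cY ω, c₃ ω, cQ ω)) ≤
      0 := by
    -- Given both outputs and the relay's input, `U` is independent of `(X₁, X₂)`, hence `I(U; X₁,
    -- X₂ | Y, X₃, Q) ≤ I(U; Y₃ | Y, X₃, Q)`, which is nonpositive by `ha`.
    have k1 := condMutualInfo_chain hp cU cY₃ (fun ω => (c₁ ω, c₂ ω))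
      (fun ω => (cY ω, c₃ ω, cQ ω))
    have k2 := condMutualInfo_chain hp cU (fun ω => (c₁ ω, c₂ ω)) cY₃
      (fun ω => (cY ω, c₃ ω, cQ ω))
    rw [D.condMutualInfo_x_u_eq_zero] at k1
    have k3 : condMutualInfo (D.joint W) cU (fun ω => (cY₃ ω, c₁ ω, c₂ ω))
        (fun ω => (cY ω, c₃ ω, cQ ω)) = condMutualInfo (D.joint W) cU
        (fun ω => ((c₁ ω, c₂ ω), cY₃ ω)) (fun ω => (cY ω, c₃ ω, cQ ω)) :=
      condMutualInfo_congr hp (fun _ _ => Iff.rfl)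
        (fun _ _ => by simp only [Prod.mk.injEq]; tauto) (fun _ _ => Iff.rfl)
    have k4 : condMutualInfo (D.joint W) cU cY₃ (fun ω => (cY ω, c₃ ω, cQ ω)) =
        condMutualInfo (D.joint W) cY₃ cU (fun ω => (c₃ ω, cY ω, cQ ω)) := by
      rw [condMutualInfo_comm hp]
      exact condMutualInfo_congr hp (fun _ _ => Iff.rfl) (fun _ _ => Iff.rfl)
        (fun _ _ => by simp only [Prod.mk.injEq]; tauto)
    have k5 := condMutualInfo_nonneg hp cU cY₃ (fun ω => ((c₁ ω, c₂ ω), cY ω, c₃ ω, cQ ω))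
    linarith
  have h3 := D.condMutualInfo_x₃_y_x₁x₂_eq_zero hind
  refine ⟨?_, ?_, ?_⟩
  -- The part of the information due to `U` vanishes by `hU`. The rest is at most `I(X₁, X₃; Y | X₂,
  -- Q)`, in which `X₃` adds nothing once the transmitters' inputs are given. The two other cases
  -- run in the same way.
  · have k1 := condMutualInfo_chain hp c₁ cY cU (fun ω => (c₂ ω, c₃ ω, cQ ω))
    have k2 := condMutualInfo_chain hp cU c₂ c₁ (fun ω => (cY ω, c₃ ω, cQ ω))
    have k3 : condMutualInfo (D.joint W) cU (fun ω => (c₂ ω, c₁ ω)) (fun ω => (cY ω, c₃ ω, cQ ω)) =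
        condMutualInfo (D.joint W) cU (fun ω => (c₁ ω, c₂ ω)) (fun ω => (cY ω, c₃ ω, cQ ω)) :=
      condMutualInfo_congr hp (fun _ _ => Iff.rfl)
        (fun _ _ => by simp only [Prod.mk.injEq]; tauto) (fun _ _ => Iff.rfl)
    have k4 : condMutualInfo (D.joint W) c₁ cU (fun ω => (cY ω, c₂ ω, c₃ ω, cQ ω)) =
        condMutualInfo (D.joint W) cU c₁ (fun ω => (c₂ ω, cY ω, c₃ ω, cQ ω)) := by
      rw [condMutualInfo_comm hp]
      exact condMutualInfo_congr hp (fun _ _ => Iff.rfl) (fun _ _ => Iff.rfl)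
        (fun _ _ => by simp only [Prod.mk.injEq]; tauto)
    have k5 := condMutualInfo_nonneg hp cU c₂ (fun ω => (cY ω, c₃ ω, cQ ω))
    have k6 := condMutualInfo_chain hp cY c₁ c₃ (fun ω => (c₂ ω, cQ ω))
    have k7 := condMutualInfo_chain hp cY c₃ c₁ (fun ω => (c₂ ω, cQ ω))
    have k8 : condMutualInfo (D.joint W) cY (fun ω => (c₁ ω, c₃ ω)) (fun ω => (c₂ ω, cQ ω)) =
        condMutualInfo (D.joint W) cY (fun ω => (c₃ ω, c₁ ω)) (fun ω => (c₂ ω, cQ ω)) :=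
      condMutualInfo_congr hp (fun _ _ => Iff.rfl)
        (fun _ _ => by simp only [Prod.mk.injEq]; tauto) (fun _ _ => Iff.rfl)
    have k9 : condMutualInfo (D.joint W) cY c₃ (fun ω => (c₁ ω, c₂ ω, cQ ω)) = 0 := by
      rw [condMutualInfo_comm hp, h3]
    have k10 : condMutualInfo (D.joint W) cY c₁ (fun ω => (c₃ ω, c₂ ω, cQ ω)) =
        condMutualInfo (D.joint W) c₁ cY (fun ω => (c₂ ω, c₃ ω, cQ ω)) := by
      rw [condMutualInfo_comm hp]
      exact condMutualInfo_congr hp (fun _ _ => Iff.rfl) (fun _ _ => Iff.rfl)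
        (fun _ _ => by simp only [Prod.mk.injEq]; tauto)
    have k11 := condMutualInfo_nonneg hp cY c₃ (fun ω => (c₂ ω, cQ ω))
    rw [condMutualInfo_comm hp c₁ cY (fun ω => (c₂ ω, cQ ω))]
    linarith
  · have k1 := condMutualInfo_chain hp c₂ cY cU (fun ω => (c₁ ω, c₃ ω, cQ ω))
    have k2 := condMutualInfo_chain hp cU c₁ c₂ (fun ω => (cY ω, c₃ ω, cQ ω))
    have k4 : condMutualInfo (D.joint W) c₂ cU (fun ω => (cY ω, c₁ ω, c₃ ω, cQ ω)) =
        condMutualInfo (D.joint W) cU c₂ (fun ω => (c₁ ω, cY ω, c₃ ω, cQ ω)) := by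
      rw [condMutualInfo_comm hp]
      exact condMutualInfo_congr hp (fun _ _ => Iff.rfl) (fun _ _ => Iff.rfl)
        (fun _ _ => by simp only [Prod.mk.injEq]; tauto)
    have k5 := condMutualInfo_nonneg hp cU c₁ (fun ω => (cY ω, c₃ ω, cQ ω))
    have k6 := condMutualInfo_chain hp cY c₂ c₃ (fun ω => (c₁ ω, cQ ω))
    have k7 := condMutualInfo_chain hp cY c₃ c₂ (fun ω => (c₁ ω, cQ ω))
    have k8 : condMutualInfo (D.joint W) cY (fun ω => (c₂ ω, c₃ ω)) (fun ω => (c₁ ω, cQ ω)) =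
        condMutualInfo (D.joint W) cY (fun ω => (c₃ ω, c₂ ω)) (fun ω => (c₁ ω, cQ ω)) :=
      condMutualInfo_congr hp (fun _ _ => Iff.rfl)
        (fun _ _ => by simp only [Prod.mk.injEq]; tauto) (fun _ _ => Iff.rfl)
    have k9 : condMutualInfo (D.joint W) cY c₃ (fun ω => (c₂ ω, c₁ ω, cQ ω)) = 0 := by
      rw [condMutualInfo_comm hp, ← h3]
      exact condMutualInfo_congr hp (fun _ _ => Iff.rfl) (fun _ _ => Iff.rfl)
        (fun _ _ => by simp only [Prod.mk.injEq]; tauto)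
    have k10 : condMutualInfo (D.joint W) cY c₂ (fun ω => (c₃ ω, c₁ ω, cQ ω)) =
        condMutualInfo (D.joint W) c₂ cY (fun ω => (c₁ ω, c₃ ω, cQ ω)) := by
      rw [condMutualInfo_comm hp]
      exact condMutualInfo_congr hp (fun _ _ => Iff.rfl) (fun _ _ => Iff.rfl)
        (fun _ _ => by simp only [Prod.mk.injEq]; tauto)
    have k11 := condMutualInfo_nonneg hp cY c₃ (fun ω => (c₁ ω, cQ ω))
    rw [condMutualInfo_comm hp c₂ cY (fun ω => (c₁ ω, cQ ω))]
    linarith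
  · have k1 := condMutualInfo_chain hp (fun ω => (c₁ ω, c₂ ω)) cY cU (fun ω => (c₃ ω, cQ ω))
    have k4 := condMutualInfo_comm hp (fun ω => (c₁ ω, c₂ ω)) cU (fun ω => (cY ω, c₃ ω, cQ ω))
    have k6 := condMutualInfo_chain hp cY (fun ω => (c₁ ω, c₂ ω)) c₃ cQ
    have k7 := condMutualInfo_chain hp cY c₃ (fun ω => (c₁ ω, c₂ ω)) cQ
    have k8 : condMutualInfo (D.joint W) cY (fun ω => ((c₁ ω, c₂ ω), c₃ ω)) cQ =
        condMutualInfo (D.joint W) cY (fun ω => (c₃ ω, c₁ ω, c₂ ω)) cQ :=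
      condMutualInfo_congr hp (fun _ _ => Iff.rfl)
        (fun _ _ => by simp only [Prod.mk.injEq]; tauto) (fun _ _ => Iff.rfl)
    have k9 : condMutualInfo (D.joint W) cY c₃ (fun ω => ((c₁ ω, c₂ ω), cQ ω)) = 0 := by
      rw [condMutualInfo_comm hp, ← h3]
      exact condMutualInfo_congr hp (fun _ _ => Iff.rfl) (fun _ _ => Iff.rfl)
        (fun _ _ => by simp only [Prod.mk.injEq]; tauto)
    have k10 := condMutualInfo_comm hp cY (fun ω => (c₁ ω, c₂ ω)) (fun ω => (c₃ ω, cQ ω))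
    have k11 := condMutualInfo_nonneg hp cY c₃ cQ
    rw [condMutualInfo_comm hp (fun ω => (c₁ ω, c₂ ω)) cY cQ]
    linarith

/-- One factor `1 - ε` pays for the time given to the probe; the other makes the inequality strict
unless the rate is zero. -/
theorem zero_or_mul_lt {ε R I I' : ℝ} (hε₀ : 0 < ε) (hε₁ : ε < 1) (hR : 0 ≤ R) (h : R ≤ I)
    (hI : (1 - ε) * I ≤ I') : (1 - ε) ^ 2 * R = 0 ∨ (1 - ε) ^ 2 * R < I' := by
  rcases hR.eq_or_lt with rfl | hR
  · exact Or.inl (mul_zero _)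
  · right
    have : (1 - ε) * R ≤ (1 - ε) * I := mul_le_mul_of_nonneg_left h (by linarith)
    have : 0 < (1 - ε) * R := mul_pos (by linarith) hR
    nlinarith

theorem zero_or_zero_or_mul_lt {ε R R' I I' : ℝ} (hε₀ : 0 < ε) (hε₁ : ε < 1) (hR : 0 ≤ R)
    (hR' : 0 ≤ R') (h : R + R' ≤ I) (hI : (1 - ε) * I ≤ I') :
    (1 - ε) ^ 2 * R = 0 ∨ (1 - ε) ^ 2 * R' = 0 ∨ (1 - ε) ^ 2 * R + (1 - ε) ^ 2 * R' < I' := by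
  rcases zero_or_mul_lt hε₀ hε₁ (add_nonneg hR hR') h hI with h | h
  · left
    have h1 : (1 - ε) ^ 2 ≠ 0 := pow_ne_zero _ (by linarith)
    have h2 : R = 0 := by
      have := (mul_eq_zero.1 h).resolve_left h1
      linarith
    rw [h2, mul_zero]
  · exact Or.inr (Or.inr (by linarith))

/-- Time sharing with the probe makes room in the conditions. -/
theorem ReceiverConditions.mix_probe [Nonempty X₁] [Nonempty X₂] [Nonempty X₃] {ν : U → ℝ}
    (hν : IsPMF ν) (hW : ∀ x₁ x₂ x₃, IsPMF (W x₁ x₂ x₃)) {R₁ R₂ R₃ : ℝ} (hR₁ : 0 ≤ R₁)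
    (hR₂ : 0 ≤ R₂) (hR₃ : 0 ≤ R₃) (h : D.ReceiverConditions (· ≤ ·) W R₁ R₂ R₃) {ε : ℝ}
    (hε₀ : 0 < ε) (hε₁ : ε < 1) :
    (mix ε hε₀.le hε₁.le D (probe Y₃ hν)).RelayRates W ((1 - ε) ^ 2 * R₁) ((1 - ε) ^ 2 * R₂)
      ((1 - ε) ^ 2 * R₃) ∨
    (mix ε hε₀.le hε₁.le D (probe Y₃ hν)).DirectRates W ((1 - ε) ^ 2 * R₁) ((1 - ε) ^ 2 * R₂)
      ((1 - ε) ^ 2 * R₃) := by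
  obtain ⟨ha, hb, hc, h3⟩ := h
  -- If the probe carries no information, the relay does not reach this receiver, the relay
  -- condition forces `R₃ = 0` and a compressed output useless to it, and decoding is direct.
  -- Otherwise the probe creates slack and the relay is used.
  rcases le_or_gt (condMutualInfo ((probe Y₃ hν : CFLaw (X₁ × X₂) X₁ X₂ X₃ Y₃ U).joint W) c₃ cY cQ)
    0 with hle | hlt
  · have hind := outputLaw_eq_of_probe hν hW hle
    have hp := (D.joint_isPMF hW).nonneg
    have ha0 := condMutualInfo_nonneg hp cY₃ cU (fun ω => (c₃ ω, cY ω, cQ ω))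
    rw [D.condMutualInfo_x₃_y_eq_zero hind] at h3
    have hR₃' : R₃ = 0 := by linarith
    obtain ⟨k1, k2, k3⟩ := D.condMutualInfo_le_direct hW hind (by linarith)
    refine Or.inr ⟨zero_or_mul_lt hε₀ hε₁ hR₁ (ha.trans k1) ?_,
      zero_or_mul_lt hε₀ hε₁ hR₂ (hb.trans k2) ?_,
      zero_or_zero_or_mul_lt hε₀ hε₁ hR₁ hR₂ (hc.trans k3) ?_, by rw [hR₃', mul_zero]⟩
    · exact le_condMutualInfo_joint_mix hε₀ hε₁ D (probe Y₃ hν) W hW (fun t => t.1)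
        (fun t => t.2.2.2.1) (fun t => t.2.1) (fun _ _ => by simp) (fun _ _ => by simp)
    · exact le_condMutualInfo_joint_mix hε₀ hε₁ D (probe Y₃ hν) W hW (fun t => t.2.1)
        (fun t => t.2.2.2.1) (fun t => t.1) (fun _ _ => by simp) (fun _ _ => by simp)
    · exact le_condMutualInfo_joint_mix hε₀ hε₁ D (probe Y₃ hν) W hW (fun t => (t.1, t.2.1))
        (fun t => t.2.2.2.1) (fun t => ()) (fun _ _ => by simp) (fun _ _ => by simp)
  · refine Or.inl ⟨zero_or_mul_lt hε₀ hε₁ hR₁ ha ?_, zero_or_mul_lt hε₀ hε₁ hR₂ hb ?_,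
      zero_or_zero_or_mul_lt hε₀ hε₁ hR₁ hR₂ hc ?_, ?_⟩
    · exact le_condMutualInfo_joint_mix hε₀ hε₁ D (probe Y₃ hν) W hW (fun t => t.1)
        (fun t => (t.2.2.2.1, t.2.2.2.2.2)) (fun t => (t.2.1, t.2.2.1)) (fun _ _ => by simp [and_assoc])
        (fun _ _ => by simp [and_assoc])
    · exact le_condMutualInfo_joint_mix hε₀ hε₁ D (probe Y₃ hν) W hW (fun t => t.2.1)
        (fun t => (t.2.2.2.1, t.2.2.2.2.2)) (fun t => (t.1, t.2.2.1)) (fun _ _ => by simp [and_assoc])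
        (fun _ _ => by simp [and_assoc])
    · exact le_condMutualInfo_joint_mix hε₀ hε₁ D (probe Y₃ hν) W hW (fun t => (t.1, t.2.1))
        (fun t => (t.2.2.2.1, t.2.2.2.2.2)) (fun t => t.2.2.1) (fun _ _ => by simp)
        (fun _ _ => by simp)
    · have e1 : condMutualInfo ((mix ε hε₀.le hε₁.le D (probe Y₃ hν)).joint W) cY₃ cU
          (fun ω => (c₃ ω, cY ω, cQ ω)) = (1 - ε) * condMutualInfo (D.joint W) cY₃ cU
            (fun ω => (c₃ ω, cY ω, cQ ω)) + ε * condMutualInfo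
              ((probe Y₃ hν : CFLaw (X₁ × X₂) X₁ X₂ X₃ Y₃ U).joint W) cY₃ cU
                (fun ω => (c₃ ω, cY ω, cQ ω)) :=
        condMutualInfo_joint_mix hε₀ hε₁ D (probe Y₃ hν) W (fun t => t.2.2.2.2.1)
          (fun t => t.2.2.2.2.2) (fun t => (t.2.2.1, t.2.2.2.1)) (fun _ _ => by simp [and_assoc])
          (fun _ _ => by simp [and_assoc]) (fun _ _ => by simp [and_assoc])
      have e2 : condMutualInfo ((mix ε hε₀.le hε₁.le D (probe Y₃ hν)).joint W) c₃ cY cQ =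
          (1 - ε) * condMutualInfo (D.joint W) c₃ cY cQ + ε * condMutualInfo
              ((probe Y₃ hν : CFLaw (X₁ × X₂) X₁ X₂ X₃ Y₃ U).joint W) c₃ cY cQ :=
        condMutualInfo_joint_mix hε₀ hε₁ D (probe Y₃ hν) W (fun t => t.2.2.1)
          (fun t => t.2.2.2.1) (fun t => ()) (fun _ _ => by simp)
          (fun _ _ => by simp) (fun _ _ => by simp)
      -- The probe adds nothing to the compression cost, but `ε` times a positive amount to the
      -- relay's information; this yields the strict inequality even when `R₃ = 0`.
      rw [e1, e2, condMutualInfo_probe_u, mul_zero, add_zero]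
      have k1 := mul_le_mul_of_nonneg_left h3 (by linarith : 0 ≤ 1 - ε)
      have k2 : 0 ≤ (1 - ε) * R₃ := mul_nonneg (by linarith) hR₃
      have k3 := mul_pos hε₀ hlt
      nlinarith

end

end CFLaw

/-- The triplets shrunk by `(1 - ε) ^ 2` are achieved by time sharing with the probe, and they
converge to the given triplet as `ε → 0`. -/
theorem mem_capacityRegion_of_conditions {Q X₁ X₂ X₃ Y₁ Y₂ Y₃ U : Type*}
    [Fintype Q] [Fintype X₁] [Fintype X₂] [Fintype X₃] [Fintype Y₁] [Fintype Y₂] [Fintype Y₃]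
    [Fintype U] (D : CFDist X₁ X₂ X₃ Y₃ Q U) (W : CMACr X₁ X₂ X₃ Y₁ Y₂ Y₃) {R₁ R₂ R₃ : ℝ}
    (hR₁ : 0 ≤ R₁) (hR₂ : 0 ≤ R₂) (hR₃ : 0 ≤ R₃) (h : D.Conditions (· ≤ ·) W R₁ R₂ R₃) :
    (R₁, R₂, R₃) ∈ capacityRegion W := by
  obtain ⟨h₁, h₂⟩ := (D.conditions_iff W (fun _ _ _ => le_min_iff) R₁ R₂ R₃).1 h
  have nQ := D.toLaw.hQ.nonempty
  obtain ⟨q⟩ := id nQ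
  have n₁ := (D.toLaw.h₁ q).nonempty
  have n₂ := (D.toLaw.h₂ q).nonempty
  have n₃ := (D.toLaw.h₃ q).nonempty
  obtain ⟨x₁⟩ := id n₁
  obtain ⟨x₂⟩ := id n₂
  obtain ⟨x₃⟩ := id n₃
  obtain ⟨y₁, y₂, y₃⟩ := (stdSimplex_isPMF (W x₁ x₂ x₃)).nonempty
  have hν := D.toLaw.hU q x₃ y₃
  obtain ⟨u⟩ := hν.nonempty
  have : Nonempty Y₁ := ⟨y₁⟩
  have : Nonempty Y₂ := ⟨y₂⟩
  have : Nonempty Y₃ := ⟨y₃⟩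
  have : Nonempty U := ⟨u⟩
  have hach : ∀ᶠ ε in 𝓝[>] (0 : ℝ), ((1 - ε) ^ 2 * R₁, (1 - ε) ^ 2 * R₂, (1 - ε) ^ 2 * R₃) ∈
      {R | Achievable W R} := by
    filter_upwards [Ioo_mem_nhdsGT (zero_lt_one' ℝ)] with ε hε
    exact (CFLaw.mix ε hε.1.le hε.2.le D.toLaw (CFLaw.probe Y₃ hν)).achievable_of_rates W
      (by positivity) (by positivity) (by positivity)
      (h₁.mix_probe D.toLaw hν (receiverOne_isPMF W) hR₁ hR₂ hR₃ hε.1 hε.2)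
      (h₂.mix_probe D.toLaw hν (receiverTwo_isPMF W) hR₁ hR₂ hR₃ hε.1 hε.2)
  refine mem_closure_of_tendsto ?_ hach
  have hc : Continuous fun ε : ℝ => ((1 - ε) ^ 2 * R₁, (1 - ε) ^ 2 * R₂, (1 - ε) ^ 2 * R₃) := by
    fun_prop
  have := (hc.tendsto 0).mono_left (nhdsWithin_le_nhds (s := Set.Ioi 0))
  simpa using this

/-! ### A bounded alphabet for the compressed output -/

/-- A sum of vectors is a combination with nonnegative weights of few of them. -/
theorem exists_few_weights {ι U : Type*} [Fintype ι] [Fintype U] [Nonempty U] (v : U → ι → ℝ) :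
    ∃ (σ : Fin (Fintype.card ι + 1) → U) (μ : Fin (Fintype.card ι + 1) → ℝ),
      (∀ j, 0 ≤ μ j) ∧ ∀ i, ∑ j, μ j * v (σ j) i = ∑ u, v u i := by
  have hc : (0 : ℝ) < Fintype.card U := by exact_mod_cast Fintype.card_pos
  -- Carathéodory's theorem is applied to the barycentre, and the weights are multiplied by `card U`
  -- afterwards. Unused places are filled with weight zero.
  have hx : (∑ u, (1 / Fintype.card U : ℝ) • v u) ∈ convexHull ℝ (Set.range v) := by
    refine (convex_convexHull ℝ _).sum_mem (fun _ _ => by positivity) ?_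
      fun u _ => subset_convexHull ℝ _ ⟨u, rfl⟩
    rw [Finset.sum_const, Finset.card_univ, nsmul_eq_mul, mul_one_div_cancel hc.ne']
  obtain ⟨κ, _, z, w, hz, hind, hw, -, hsum⟩ := eq_pos_convex_span_of_mem_convexHull hx
  have hz' (k : κ) : ∃ u, v u = z k := hz ⟨k, rfl⟩
  choose u hu using hz'
  have hcard : Fintype.card κ ≤ Fintype.card (Fin (Fintype.card ι + 1)) := by
    rw [Fintype.card_fin]
    refine hind.card_le_finrank_succ.trans (Nat.succ_le_succ ?_)
    exact (Submodule.finrank_le _).trans (Module.finrank_fintype_fun_eq_card ℝ).le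
  obtain ⟨f⟩ := Function.Embedding.nonempty_of_card_le hcard
  refine ⟨Function.extend f u fun _ => Classical.arbitrary U,
    Function.extend f (fun k => Fintype.card U * w k) 0, fun j => ?_, fun i => ?_⟩
  · by_cases h : ∃ k, f k = j
    · obtain ⟨k, rfl⟩ := h
      rw [f.injective.extend_apply]
      exact mul_nonneg hc.le (hw k).le
    · rw [Function.extend_apply' _ _ _ h]
      rfl
  · rw [← Fintype.sum_of_injective f f.injective (fun k => Fintype.card U * w k * v (u k) i) _ ?_ ?_]
    · have h := congrFun hsum i
      simp only [Finset.sum_apply, Pi.smul_apply, smul_eq_mul] at h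
      rw [← Finset.mul_sum] at h
      simp only [hu, mul_assoc]
      rw [← Finset.mul_sum, h]
      field_simp
    · intro j hj
      rw [Function.extend_apply' _ _ _ (by simpa using hj)]
      simp
    · intro k
      rw [f.injective.extend_apply, f.injective.extend_apply]

namespace CFLaw

variable {Q X₁ X₂ X₃ Y Y₃ U U' A B C : Type*}
  [Fintype Q] [Fintype X₁] [Fintype X₂] [Fintype X₃] [Fintype Y] [Fintype Y₃] [Fintype U]
  [Fintype U'] [Fintype A] [Fintype B] [Fintype C]

/-- The compressed output of `D'` arises from that of `D` by a choice of symbols and weights. -/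
structure IsReweighting (D : CFLaw Q X₁ X₂ X₃ Y₃ U) (D' : CFLaw Q X₁ X₂ X₃ Y₃ U')
    (σ : Q → X₃ → U' → U) (μ : Q → X₃ → U' → ℝ) : Prop where
  pQ : D'.pQ = D.pQ
  p₁ : D'.p₁ = D.p₁
  p₂ : D'.p₂ = D.p₂
  p₃ : D'.p₃ = D.p₃
  pU : ∀ q x₃ y₃ j, D'.pU q x₃ y₃ j = μ q x₃ j * D.pU q x₃ y₃ (σ q x₃ j)

/-- All coordinates but the compressed output. -/
def cR (ω : Q × X₁ × X₂ × X₃ × Y × Y₃ × U) : Q × X₁ × X₂ × X₃ × Y × Y₃ :=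
  (cQ ω, c₁ ω, c₂ ω, c₃ ω, cY ω, cY₃ ω)

/-- The part of a sum with given time sharing, relay input and compressed output. -/
def slice (f : Q × X₁ × X₂ × X₃ × Y × Y₃ × U → ℝ) (q : Q) (x₃ : X₃) (u : U) : ℝ :=
  ∑ x₁, ∑ x₂, ∑ y, ∑ y₃, f (q, x₁, x₂, x₃, y, y₃, u)

theorem sum_slice (f : Q × X₁ × X₂ × X₃ × Y × Y₃ × U → ℝ) :
    ∑ ω, f ω = ∑ q, ∑ x₃, ∑ u, slice f q x₃ u := by
  simp only [Fintype.sum_prod_type, slice]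
  refine Finset.sum_congr rfl fun q _ => ?_
  simp only [Finset.sum_comm (s := (Finset.univ : Finset Y₃)) (t := (Finset.univ : Finset U))]
  simp only [Finset.sum_comm (s := (Finset.univ : Finset Y)) (t := (Finset.univ : Finset U))]
  simp only [Finset.sum_comm (s := (Finset.univ : Finset X₂)) (t := (Finset.univ : Finset X₃))]
  simp only [Finset.sum_comm (s := (Finset.univ : Finset X₂)) (t := (Finset.univ : Finset U))]
  rw [Finset.sum_comm]
  refine Finset.sum_congr rfl fun x₃ _ => ?_
  rw [Finset.sum_comm]

section

variable {D : CFLaw Q X₁ X₂ X₃ Y₃ U} {D' : CFLaw Q X₁ X₂ X₃ Y₃ U'} {σ : Q → X₃ → U' → U}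
  {μ : Q → X₃ → U' → ℝ} (V : X₁ → X₂ → X₃ → Y × Y₃ → ℝ)

/-- The compressed output comes last in the generation of the joint law and sums out, so the rest
does not notice the reweighting. -/
theorem IsReweighting.marginal_rest (h : IsReweighting D D' σ μ) {T : Type*} (t : Q × X₁ × X₂ × X₃ × Y × Y₃ → T) (a : T) :
    marginal (D'.joint V) (fun ω => t (cR ω)) a = marginal (D.joint V) (fun ω => t (cR ω)) a := by
  rw [marginal_eq_wsum, marginal_eq_wsum, wsum_joint, wsum_joint]
  simp only [cR, cQ, c₁, c₂, c₃, cY, cY₃, cU, (D.hU _ _ _).wsum_const, (D'.hU _ _ _).wsum_const,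
    h.pQ, h.p₁, h.p₂, h.p₃]

/-- By `ht` the observed value determines `q` and `x₃`, on which the weights depend; a single weight
therefore comes out of the whole sum. -/
theorem IsReweighting.marginal_u (h : IsReweighting D D' σ μ) {T : Type*} {t : Q × X₁ × X₂ × X₃ × Y × Y₃ → T}
    (ht : ∀ r r', t r = t r' → r.1 = r'.1 ∧ r.2.2.2.1 = r'.2.2.2.1)
    (r : Q × X₁ × X₂ × X₃ × Y × Y₃) (j : U') :
    marginal (D'.joint V) (fun ω => (t (cR ω), cU ω)) (t r, j) =
      μ r.1 r.2.2.2.1 j *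
        marginal (D.joint V) (fun ω => (t (cR ω), cU ω)) (t r, σ r.1 r.2.2.2.1 j) := by
  rw [marginal_eq_wsum, marginal_eq_wsum, wsum_joint, wsum_joint]
  simp only [cR, cQ, c₁, c₂, c₃, cY, cY₃, cU, h.pQ, h.p₁, h.p₂, h.p₃, Prod.mk.injEq, ind_and]
  simp only [← wsum_const_mul (μ r.1 r.2.2.2.1 j)]
  refine wsum_congr fun q => wsum_congr fun x₁ => wsum_congr fun x₂ => wsum_congr fun x₃ =>
    wsum_congr fun s => ?_
  rw [wsum_const_mul, wsum_const_mul, wsum_const_mul, wsum_ind_eq, wsum_ind_eq, h.pU]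
  by_cases hr : t (q, x₁, x₂, x₃, s.1, s.2) = t r
  · obtain ⟨h1, h2⟩ := ht _ _ hr
    simp only at h1 h2
    rw [← h1, ← h2]
    ring
  · rw [ind_false hr]
    ring

/-- Reweighting keeps the conditional mutual informations, if it keeps certain sums. -/
theorem IsReweighting.condMutualInfo_eq (h : IsReweighting D D' σ μ)
    {X : Q × X₁ × X₂ × X₃ × Y × Y₃ → A}
    {Y₀ : Q × X₁ × X₂ × X₃ × Y × Y₃ → B} {Z : Q × X₁ × X₂ × X₃ × Y × Y₃ → C}
    (hZ : ∀ r r', Z r = Z r' → r.1 = r'.1 ∧ r.2.2.2.1 = r'.2.2.2.1)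
    (hs : ∀ q x₃, ∑ j, μ q x₃ j * slice (fun ω => D.joint V ω * infoDensity (D.joint V)
      (fun ω => X (cR ω)) (fun ω => (Y₀ (cR ω), cU ω)) (fun ω => Z (cR ω)) ω) q x₃ (σ q x₃ j) =
      ∑ u, slice (fun ω => D.joint V ω * infoDensity (D.joint V)
      (fun ω => X (cR ω)) (fun ω => (Y₀ (cR ω), cU ω)) (fun ω => Z (cR ω)) ω) q x₃ u) :
    condMutualInfo (D'.joint V) (fun ω => X (cR ω)) (fun ω => (Y₀ (cR ω), cU ω))
      (fun ω => Z (cR ω)) =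
    condMutualInfo (D.joint V) (fun ω => X (cR ω)) (fun ω => (Y₀ (cR ω), cU ω))
      (fun ω => Z (cR ω)) := by
  rw [condMutualInfo_eq_sum, condMutualInfo_eq_sum]
  rw [sum_slice, sum_slice]
  refine Finset.sum_congr rfl fun q _ => Finset.sum_congr rfl fun x₃ _ => ?_
  refine Eq.trans ?_ (hs q x₃)
  refine Finset.sum_congr rfl fun j _ => ?_
  simp only [slice, Finset.mul_sum]
  refine Finset.sum_congr rfl fun x₁ _ => Finset.sum_congr rfl fun x₂ _ =>
    Finset.sum_congr rfl fun y _ => Finset.sum_congr rfl fun y₃ _ => ?_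
  have hjoint : D'.joint V (q, x₁, x₂, x₃, y, y₃, j) =
      μ q x₃ j * D.joint V (q, x₁, x₂, x₃, y, y₃, σ q x₃ j) := by
    simp only [joint, h.pQ, h.p₁, h.p₂, h.p₃, h.pU]
    ring
  rw [hjoint, mul_assoc]
  -- A nonzero weight occurs once in the numerator and once in the denominator of the density ratio.
  -- So the density at `j` is that of the original symbol `σ q x₃ j`, and the information is linear
  -- in the weights.
  rcases eq_or_ne (μ q x₃ j) 0 with h0 | h0
  · rw [h0, zero_mul, zero_mul]
  congr 2
  unfold infoDensity
  set r : Q × X₁ × X₂ × X₃ × Y × Y₃ := (q, x₁, x₂, x₃, y, y₃) with hr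
  have hcR : cR (q, x₁, x₂, x₃, y, y₃, j) = r := rfl
  have hcR' : cR (q, x₁, x₂, x₃, y, y₃, σ q x₃ j) = r := rfl
  have e1 (p : Q × X₁ × X₂ × X₃ × Y × Y₃ × U' → ℝ) (u : U') :
      marginal p (fun ω => (X (cR ω), (Y₀ (cR ω), cU ω), Z (cR ω))) (X r, (Y₀ r, u), Z r) =
      marginal p (fun ω => ((X (cR ω), Y₀ (cR ω), Z (cR ω)), cU ω)) ((X r, Y₀ r, Z r), u) :=
    marginal_congr_val p fun ω => by simp only [Prod.mk.injEq]; tauto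
  have e2 (p : Q × X₁ × X₂ × X₃ × Y × Y₃ × U → ℝ) (u : U) :
      marginal p (fun ω => (X (cR ω), (Y₀ (cR ω), cU ω), Z (cR ω))) (X r, (Y₀ r, u), Z r) =
      marginal p (fun ω => ((X (cR ω), Y₀ (cR ω), Z (cR ω)), cU ω)) ((X r, Y₀ r, Z r), u) :=
    marginal_congr_val p fun ω => by simp only [Prod.mk.injEq]; tauto
  have e3 (p : Q × X₁ × X₂ × X₃ × Y × Y₃ × U' → ℝ) (u : U') :
      marginal p (fun ω => ((Y₀ (cR ω), cU ω), Z (cR ω))) ((Y₀ r, u), Z r) =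
      marginal p (fun ω => ((Y₀ (cR ω), Z (cR ω)), cU ω)) ((Y₀ r, Z r), u) :=
    marginal_congr_val p fun ω => by simp only [Prod.mk.injEq]; tauto
  have e4 (p : Q × X₁ × X₂ × X₃ × Y × Y₃ × U → ℝ) (u : U) :
      marginal p (fun ω => ((Y₀ (cR ω), cU ω), Z (cR ω))) ((Y₀ r, u), Z r) =
      marginal p (fun ω => ((Y₀ (cR ω), Z (cR ω)), cU ω)) ((Y₀ r, Z r), u) :=
    marginal_congr_val p fun ω => by simp only [Prod.mk.injEq]; tauto
  have m1 := h.marginal_u V (t := fun r => (X r, Y₀ r, Z r))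
    (fun r r' he => hZ r r' (by simp only [Prod.mk.injEq] at he; exact he.2.2)) r j
  have m2 := h.marginal_u V (t := fun r => (Y₀ r, Z r))
    (fun r r' he => hZ r r' (by simp only [Prod.mk.injEq] at he; exact he.2)) r j
  have m3 := h.marginal_rest V Z (Z r)
  have m4 := h.marginal_rest V (fun r => (X r, Z r)) (X r, Z r)
  beta_reduce at m1 m2 m3 m4
  simp only [hcR, hcR', cU]
  rw [e1, e2, e3, e4, m1, m2, m3, m4]
  simp only [hr]
  rw [mul_assoc, mul_left_comm _ (μ q x₃ j), mul_div_mul_left _ _ h0]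

theorem IsReweighting.condMutualInfo_rest (h : IsReweighting D D' σ μ)
    {X : Q × X₁ × X₂ × X₃ × Y × Y₃ → A}
    {Y₀ : Q × X₁ × X₂ × X₃ × Y × Y₃ → B} {Z : Q × X₁ × X₂ × X₃ × Y × Y₃ → C} :
    condMutualInfo (D'.joint V) (fun ω => X (cR ω)) (fun ω => Y₀ (cR ω)) (fun ω => Z (cR ω)) =
    condMutualInfo (D.joint V) (fun ω => X (cR ω)) (fun ω => Y₀ (cR ω)) (fun ω => Z (cR ω)) :=
  condMutualInfo_of_law fun t => h.marginal_rest V (fun r => (X r, Y₀ r, Z r)) t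

end

/-- The sums that a reweighting has to keep for one receiver. -/
noncomputable def sliceInfo (D : CFLaw Q X₁ X₂ X₃ Y₃ U) (V : X₁ → X₂ → X₃ → Y × Y₃ → ℝ) (q : Q)
    (x₃ : X₃) (u : U) : Fin 4 → ℝ :=
  ![slice (fun ω => D.joint V ω * infoDensity (D.joint V) c₁ (fun ω => (cY ω, cU ω))
      (fun ω => (c₂ ω, c₃ ω, cQ ω)) ω) q x₃ u,
    slice (fun ω => D.joint V ω * infoDensity (D.joint V) c₂ (fun ω => (cY ω, cU ω))
      (fun ω => (c₁ ω, c₃ ω, cQ ω)) ω) q x₃ u,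
    slice (fun ω => D.joint V ω * infoDensity (D.joint V) (fun ω => (c₁ ω, c₂ ω))
      (fun ω => (cY ω, cU ω)) (fun ω => (c₃ ω, cQ ω)) ω) q x₃ u,
    -- The unit gives the compressed output alone the form of a pair, as required by
    -- `IsReweighting.condMutualInfo_eq`.
    slice (fun ω => D.joint V ω * infoDensity (D.joint V) cY₃ (fun ω => ((), cU ω))
      (fun ω => (c₃ ω, cY ω, cQ ω)) ω) q x₃ u]

/-- Four of the five quantities involve the compressed output and are kept by `hs`; `I(X₃; Y | Q)`
does not involve it and is kept automatically. -/
theorem IsReweighting.receiverConditions_iff {D : CFLaw Q X₁ X₂ X₃ Y₃ U}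
    {D' : CFLaw Q X₁ X₂ X₃ Y₃ U'} {σ : Q → X₃ → U' → U} {μ : Q → X₃ → U' → ℝ}
    (h : IsReweighting D D' σ μ) {V : X₁ → X₂ → X₃ → Y × Y₃ → ℝ}
    (hV : ∀ x₁ x₂ x₃, IsPMF (V x₁ x₂ x₃))
    (hs : ∀ q x₃ i, ∑ j, μ q x₃ j * sliceInfo D V q x₃ (σ q x₃ j) i = ∑ u, sliceInfo D V q x₃ u i)
    (rel : ℝ → ℝ → Prop) (R₁ R₂ R₃ : ℝ) :
    D'.ReceiverConditions rel V R₁ R₂ R₃ ↔ D.ReceiverConditions rel V R₁ R₂ R₃ := by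
  have ka := h.condMutualInfo_eq V (X := fun r => r.2.1) (Y₀ := fun r => r.2.2.2.2.1)
    (Z := fun r => (r.2.2.1, r.2.2.2.1, r.1))
    (fun r r' he => by simp only [Prod.mk.injEq] at he; tauto) (fun q x₃ => hs q x₃ 0)
  have kb := h.condMutualInfo_eq V (X := fun r => r.2.2.1) (Y₀ := fun r => r.2.2.2.2.1)
    (Z := fun r => (r.2.1, r.2.2.2.1, r.1))
    (fun r r' he => by simp only [Prod.mk.injEq] at he; tauto) (fun q x₃ => hs q x₃ 1)
  have kc := h.condMutualInfo_eq V (X := fun r => (r.2.1, r.2.2.1)) (Y₀ := fun r => r.2.2.2.2.1)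
    (Z := fun r => (r.2.2.2.1, r.1))
    (fun r r' he => by simp only [Prod.mk.injEq] at he; tauto) (fun q x₃ => hs q x₃ 2)
  have kd := h.condMutualInfo_eq V (X := fun r => r.2.2.2.2.2) (Y₀ := fun r => ())
    (Z := fun r => (r.2.2.2.1, r.2.2.2.2.1, r.1))
    (fun r r' he => by simp only [Prod.mk.injEq] at he; tauto) (fun q x₃ => hs q x₃ 3)
  have ke := h.condMutualInfo_rest V (X := fun r => r.2.2.2.1) (Y₀ := fun r => r.2.2.2.2.1)
    (Z := fun r => r.1)
  have kd' : condMutualInfo (D'.joint V) cY₃ cU (fun ω => (c₃ ω, cY ω, cQ ω)) =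
      condMutualInfo (D.joint V) cY₃ cU (fun ω => (c₃ ω, cY ω, cQ ω)) := by
    refine Eq.trans ?_ (kd.trans ?_)
    · exact condMutualInfo_congr (D'.joint_isPMF hV).nonneg (fun _ _ => Iff.rfl)
        (fun _ _ => by simp) (fun _ _ => Iff.rfl)
    · exact condMutualInfo_congr (D.joint_isPMF hV).nonneg (fun _ _ => Iff.rfl)
        (fun _ _ => by simp) (fun _ _ => Iff.rfl)
  unfold ReceiverConditions
  rw [kd']
  change rel R₁ (condMutualInfo (D'.joint V) (fun ω => (cR ω).2.1) _ _) ∧ _ ↔ _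
  refine and_congr (iff_of_eq (congrArg _ ka)) (and_congr (iff_of_eq (congrArg _ kb))
    (and_congr (iff_of_eq (congrArg _ kc)) (iff_of_eq (congrArg _ ke))))

end CFLaw

/-- The compressed output can be replaced by one with a bounded alphabet. -/
theorem exists_bounded_alphabet {Q X₁ X₂ X₃ Y₁ Y₂ Y₃ U : Type*}
    [Fintype Q] [Fintype X₁] [Fintype X₂] [Fintype X₃] [Fintype Y₁] [Fintype Y₂] [Fintype Y₃]
    [Fintype U] (D : CFDist X₁ X₂ X₃ Y₃ Q U) (W : CMACr X₁ X₂ X₃ Y₁ Y₂ Y₃) :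
    ∃ D' : CFDist X₁ X₂ X₃ Y₃ Q (Fin (Fintype.card (Y₃ ⊕ Fin 4 ⊕ Fin 4) + 1)),
      D'.pQ = D.pQ ∧ D'.pX₁ = D.pX₁ ∧ D'.pX₂ = D.pX₂ ∧ D'.pX₃ = D.pX₃ ∧
      ∀ R₁ R₂ R₃ : ℝ, D'.Conditions (· ≤ ·) W R₁ R₂ R₃ ↔ D.Conditions (· ≤ ·) W R₁ R₂ R₃ := by
  obtain ⟨q⟩ := D.toLaw.hQ.nonempty
  obtain ⟨x₁⟩ := (D.toLaw.h₁ q).nonempty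
  obtain ⟨x₂⟩ := (D.toLaw.h₂ q).nonempty
  obtain ⟨x₃⟩ := (D.toLaw.h₃ q).nonempty
  obtain ⟨y₁, y₂, y₃⟩ := (stdSimplex_isPMF (W x₁ x₂ x₃)).nonempty
  have : Nonempty U := (D.toLaw.hU q x₃ y₃).nonempty
  -- For each `(q, x₃)` the coordinates kept are the normalization for every `y₃` and four
  -- information sums per receiver. The weights must not depend on `y₃`, which is why all `y₃` are
  -- treated at once.
  have hex (q : Q) (x₃ : X₃) := exists_few_weights (fun u : U =>
    (Sum.elim (fun y₃ => (D.pYhat y₃ x₃ q : U → ℝ) u)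
      (Sum.elim (D.toLaw.sliceInfo (receiverOne W) q x₃ u)
        (D.toLaw.sliceInfo (receiverTwo W) q x₃ u)) : Y₃ ⊕ Fin 4 ⊕ Fin 4 → ℝ))
  choose σ μ hμ hσ using hex
  let D' : CFDist X₁ X₂ X₃ Y₃ Q (Fin (Fintype.card (Y₃ ⊕ Fin 4 ⊕ Fin 4) + 1)) :=
    { pQ := D.pQ
      pX₁ := D.pX₁
      pX₂ := D.pX₂
      pX₃ := D.pX₃
      pYhat := fun y₃ x₃ q => ⟨fun j => μ q x₃ j * (D.pYhat y₃ x₃ q : U → ℝ) (σ q x₃ j),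
        fun j => mul_nonneg (hμ q x₃ j) ((stdSimplex_isPMF _).nonneg _), by
          have := hσ q x₃ (Sum.inl y₃)
          simp only [Sum.elim_inl] at this
          rw [this, (stdSimplex_isPMF _).sum_one]⟩ }
  have hre : CFLaw.IsReweighting D.toLaw D'.toLaw σ μ := ⟨rfl, rfl, rfl, rfl, fun _ _ _ _ => rfl⟩
  refine ⟨D', rfl, rfl, rfl, rfl, fun R₁ R₂ R₃ => ?_⟩
  rw [D.conditions_iff W fun _ _ _ => le_min_iff, D'.conditions_iff W fun _ _ _ => le_min_iff]
  exact and_congr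
    (hre.receiverConditions_iff (receiverOne_isPMF W)
      (fun q x₃ i => hσ q x₃ (Sum.inr (Sum.inl i))) _ _ _ _)
    (hre.receiverConditions_iff (receiverTwo_isPMF W)
      (fun q x₃ i => hσ q x₃ (Sum.inr (Sum.inr i))) _ _ _ _)

end

/-! ### The theorem -/

theorem proposition5 {X₁ X₂ X₃ Y₁ Y₂ Y₃ : Type*}
    [Fintype X₁] [Fintype X₂] [Fintype X₃] [Fintype Y₁] [Fintype Y₂] [Fintype Y₃] :
    -- achievability: the closed conditions give points of the capacity region, the strict
    -- conditions give triplets that are achievable without passing to the closure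
    (∀ (W : CMACr X₁ X₂ X₃ Y₁ Y₂ Y₃)
        (Q : Type*) [Fintype Q] (Yhat : Type*) [Fintype Yhat]
        (D : CFDist X₁ X₂ X₃ Y₃ Q Yhat) (R₁ R₂ R₃ : ℝ),
        0 ≤ R₁ → 0 ≤ R₂ → 0 ≤ R₃ →
        (D.Conditions (· ≤ ·) W R₁ R₂ R₃ → (R₁, R₂, R₃) ∈ capacityRegion W) ∧
        (D.Conditions (· < ·) W R₁ R₂ R₃ → Achievable W (R₁, R₂, R₃))) ∧
    -- the cardinality of the alphabet of `Ŷ₃` can be bounded in terms of the channel alphabets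
    (∃ N : ℕ, ∀ (W : CMACr X₁ X₂ X₃ Y₁ Y₂ Y₃)
        (Q : Type*) [Fintype Q] (Yhat : Type*) [Fintype Yhat]
        (D : CFDist X₁ X₂ X₃ Y₃ Q Yhat),
        ∃ D' : CFDist X₁ X₂ X₃ Y₃ Q (Fin N),
          D'.pQ = D.pQ ∧ D'.pX₁ = D.pX₁ ∧ D'.pX₂ = D.pX₂ ∧ D'.pX₃ = D.pX₃ ∧
          ∀ R₁ R₂ R₃ : ℝ, 0 ≤ R₁ → 0 ≤ R₂ → 0 ≤ R₃ →
            D.Conditions (· ≤ ·) W R₁ R₂ R₃ → D'.Conditions (· ≤ ·) W R₁ R₂ R₃) := by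
  refine ⟨fun W Q _ Yhat _ D R₁ R₂ R₃ hR₁ hR₂ hR₃ =>
    ⟨mem_capacityRegion_of_conditions D W hR₁ hR₂ hR₃,
      achievable_of_conditions D W hR₁ hR₂ hR₃⟩,
    Fintype.card (Y₃ ⊕ Fin 4 ⊕ Fin 4) + 1, fun W Q _ Yhat _ D => ?_⟩
  obtain ⟨D', hQ, h₁, h₂, h₃, h⟩ := exists_bounded_alphabet D W
  exact ⟨D', hQ, h₁, h₂, h₃, fun R₁ R₂ R₃ _ _ _ => (h R₁ R₂ R₃).2⟩
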